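/- Let $n,m>3$ be natural numbers and let $\mathbf d=(d_1,\dots,d_m)\in\mathbb N^m$ be 2-balanced, i.e. $d_i+d_j<\sum_{k\neq i,j}d_k$ for all $i\neq j$; put $d=\sum_i d_i$. Let $S=\mathbb C[z_0,\dots,z_n]$, let $S_e$ be its degree $e$ part, and let $\mathbb C^m_{\mathbf d}=\{\mu\in\mathbb C^m:\sum_i d_i\mu_i=0\}$. Identify $H^0(\mathbb P^n,\Omega^2_{\mathbb P^n}(d))$ with the space of 2-forms on $\mathbb C^{n+1}$ with coefficients in $S_{d-2}$ that are annihilated by contraction with the radial field $R=\sum_i z_i\,\partial/\partial z_i$. Let $\lambda=\lambda^1\wedge\lambda^2\neq0$ with $\lambda^1,\lambda^2\in\mathbb C^m_{\mathbf d}$ represent a point of $Gr(2,\mathbb C^m_{\mathbf d})\subset\mathbb P(\bigwedge^2\mathbb C^m)$, with antisymmetric coordinates $\lambda_{ij}$, and let $F_i\in S_{d_i}$ $(1\le i\le m)$. Assume that $(\lambda,\underline F)\in\mathcal U_2(\mathbf d)$, that is: for all pairwise distinct $i,j,k$, $$\lambda_{ij}\neq0,\qquad \lambda_{ij}-\lambda_{ik}+\lambda_{jk}\neq0,\qquad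 \lambda_{ij}-\lambda_{ik}-\lambda_{jk}\neq0,$$ each $F_i$ is irreducible, and the hypersurfaces $(F_i=0)$ are smooth with normal crossings (at every $x\in\mathbb C^{n+1}\setminus\{0\}$ the differentials $d_xF_i$ of those $F_i$ that vanish at $x$ are linearly independent). Put $$\omega=\phi(\lambda,\underline F):=\sum_{i<j}\lambda_{ij}\hat F_{ij}\,dF_i\wedge dF_j,\qquad \hat F_{ij}=\prod_{k\neq i,j}F_k ,$$ so that $\rho(\lambda,\underline F)=[\omega]$ is the natural parametrization. Let $\mathcal F_2(d,\mathbb P^n)$ be the scheme of classes $[\omega]\in\mathbb P H^0(\mathbb P^n,\Omega^2_{\mathbb P^n}(d))$ defined by $\omega\wedge\omega=0$ and $i_v\omega\wedge d\omega=0$ for all $v\in\mathbb C^{n+1}$. Its Zariski tangent space $T_\omega\mathcal F_2(d,\mathbb P^n)$ consists of the classes $\alpha\in H^0(\mathbb P^n,\Omega^2_{\mathbb P^n}(d))/\langle\omega\rangle$ for which $\omega+\varepsilon\alpha$, with $\varepsilon^2=0$, satisfies these equations. Let $T_\lambda Gr(2,\mathbb C^m_{\mathbf d})=\{\lambda'\in\bigwedge^2\mathbb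 C^m_{\mathbf d}:\lambda'\wedge\lambda=0\}/\langle\lambda\rangle$ and $T_{F_i}\mathbb P(S_{d_i})=S_{d_i}/\langle F_i\rangle$. Then the derivative $$d\rho(\lambda,\underline F):T_\lambda Gr(2,\mathbb C^m_{\mathbf d})\times\prod_{i=1}^m T_{F_i}\mathbb P(S_{d_i})\longrightarrow H^0(\mathbb P^n,\Omega^2_{\mathbb P^n}(d))/\langle\omega\rangle,$$ $$(\lambda',(F_i')_i)\longmapsto \phi(\lambda',\underline F)+\sum_{i=1}^m\phi\bigl(\lambda,(F_1,\dots,F_{i-1},F_i',F_{i+1},\dots,F_m)\bigr),$$ has image exactly $T_\omega\mathcal F_2(d,\mathbb P^n)$; that is, it maps onto $T_\omega\mathcal F_2(d,\mathbb P^n)$. -/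

import Mathlib

noncomputable section

namespace LogForms

/-! ### Exterior algebra in coordinates -/

/-- `A ⊗ ⋀ᵏ (ℂ^ι)^*`: alternating `k`-forms on `ℂ^ι` with values in the `ℂ`-algebra `A`. The
coordinates of `a` are its values `a ![e_{i₁}, …, e_{iₖ}]` on the canonical basis.
For `A = ℂ` this is `⋀ᵏ ℂ^ι` in antisymmetric coordinates; for `A = ℂ[z_i : i ∈ ι]` these are the
polynomial differential `k`-forms on the affine space `ℂ^ι`. -/
abbrev Alt (ι A : Type) [CommRing A] [Algebra ℂ A] (k : ℕ) : Type :=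
  (ι → ℂ) [⋀^Fin k]→ₗ[ℂ] A

/-- The exterior product (the sum over shuffles), as a bilinear map. -/
def wedge {ι A : Type} [CommRing A] [Algebra ℂ A] {k l : ℕ} :
    Alt ι A k →ₗ[ℂ] Alt ι A l →ₗ[ℂ] Alt ι A (k + l) :=
  TensorProduct.curry
    ((AlternatingMap.domDomCongrₗ ℂ finSumFinEquiv).toLinearMap ∘ₗ
      (LinearMap.mul' ℂ A).compAlternatingMapₗ ℂ ∘ₗ AlternatingMap.domCoprod')

/-- The `1`-form `∑ i, μ i e_i`. -/
def oneForm {ι A : Type} [Fintype ι] [CommRing A] [Algebra ℂ A] (μ : ι → A) : Alt ι A 1 :=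
  AlternatingMap.ofSubsingleton ℂ (ι → ℂ) A (0 : Fin 1) (Fintype.linearCombination ℂ μ)

/-- The coordinate `a_{ij}` of a bivector. -/
def coord {ι : Type} [DecidableEq ι] (a : Alt ι ℂ 2) (i j : ι) : ℂ :=
  a ![Pi.single i 1, Pi.single j 1]

/-- The form `a + ε b` over the dual numbers `A[ε]`, `ε² = 0`. -/
def addEps {ι A : Type} [CommRing A] [Algebra ℂ A] {k : ℕ} (a b : Alt ι A k) :
    Alt ι (DualNumber A) k :=
  (TrivSqZeroExt.inlAlgHom ℂ A A).toLinearMap.compAlternatingMap a +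
    ((TrivSqZeroExt.inrHom A A).restrictScalars ℂ).compAlternatingMap b

/-! ### Polynomial differential forms on `ℂ^{n+1}` -/

/-- `S = ℂ[z_0, …, z_n]`. -/
abbrev Poly (n : ℕ) : Type := MvPolynomial (Fin (n + 1)) ℂ

/-- `S_e`, the homogeneous polynomials of degree `e`. -/
abbrev HomPoly (n e : ℕ) : Submodule ℂ (Poly n) :=
  MvPolynomial.homogeneousSubmodule (Fin (n + 1)) ℂ e

/-- Polynomial differential `k`-forms on `ℂ^{n+1}`. -/
abbrev Form (n k : ℕ) : Type := Alt (Fin (n + 1)) (Poly n) k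

/-- The derivative `v ↦ ∂_v` along constant vector fields. -/
def dirDeriv (n : ℕ) : (Fin (n + 1) → ℂ) →ₗ[ℂ] Poly n →ₗ[ℂ] Poly n :=
  Fintype.linearCombination ℂ fun i => (MvPolynomial.pderiv i).toLinearMap

/-- The exterior derivative
`(dω)(v_0, …, v_k) = ∑ i, (-1)^i ∂_{v_i} (ω (v_0, …, v̂_i, …, v_k))`. -/
def extD {n k : ℕ} (ω : Form n k) : Form n (k + 1) :=
  AlternatingMap.alternatizeUncurryFin
    { toFun := fun v => (dirDeriv n v).compAlternatingMap ω
      map_add' := fun v w => by ext; simp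
      map_smul' := fun c v => by ext; simp }

/-- The differential `dF = ∑ i, (∂F/∂z_i) dz_i` of a polynomial. -/
def dPoly {n : ℕ} (F : Poly n) : Form n 1 :=
  oneForm fun i => MvPolynomial.pderiv i F

/-- The interior product with the radial field `R = ∑ i, z_i ∂/∂z_i`. -/
def radial {n k : ℕ} (ω : Form n (k + 1)) : Form n k :=
  ∑ i, (MvPolynomial.X i : Poly n) • ω.curryLeft (Pi.single i 1)

/-- `H⁰(ℙⁿ, Ω²(d))`, for `d ≥ 2`, in homogeneous coordinates: the `2`-forms on `ℂ^{n+1}` with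
coefficients in `S_{d-2}` that are killed by the contraction with the radial field. -/
def projTwoForms (n d : ℕ) : Set (Form n 2) :=
  {ω | (∀ v, (ω v).IsHomogeneous (d - 2)) ∧ radial ω = 0}

/-- The representatives in `H⁰(ℙⁿ, Ω²(d))` of the tangent vectors at `ω` of the scheme of
foliations, given by the equations `ω ∧ ω = 0` and `i_v ω ∧ dω = 0` for all `v ∈ ℂ^{n+1}`: the forms
`α` for which `ω + ε α`, `ε² = 0`, solves these equations. -/
def tangentForms (n d : ℕ) (ω : Form n 2) : Set (Form n 2) :=
  {α | α ∈ projTwoForms n d ∧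
    wedge (addEps ω α) (addEps ω α) = 0 ∧
    ∀ v : Fin (n + 1) → ℂ,
      wedge (addEps (ω.curryLeft v) (α.curryLeft v)) (addEps (extD ω) (extD α)) = 0}

/-- The Zariski tangent space `T_ω F₂(d, ℙⁿ) ⊆ H⁰(ℙⁿ, Ω²(d)) / ⟨ω⟩`, as a subset of
the quotient by `⟨ω⟩` of the space of all polynomial `2`-forms on `ℂ^{n+1}`. -/
def zariskiTangent (n d : ℕ) (ω : Form n 2) : Set (Form n 2 ⧸ Submodule.span ℂ {ω}) :=
  (Submodule.span ℂ {ω}).mkQ '' tangentForms n d ω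

/-! ### The parameters -/

/-- `k`-balanced vectors of degrees. -/
def IsBalanced {m : ℕ} (k : ℕ) (d : Fin m → ℕ) : Prop :=
  ∀ I : Finset (Fin m), I.card = k → ∑ i ∈ I, d i < ∑ i ∈ Iᶜ, d i

/-- `ℂ^m_d = {μ ∈ ℂ^m : ∑ i, μ_i d_i = 0}`. -/
def perp {m : ℕ} (d : Fin m → ℕ) : Submodule ℂ (Fin m → ℂ) :=
  LinearMap.ker (Fintype.linearCombination ℂ fun i => (d i : ℂ))

/-- `lam` is a representative of a point of `Gr(2, ℂ^m_d)` in its Plücker embedding. -/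
def IsGrPoint {m : ℕ} (d : Fin m → ℕ) (lam : Alt (Fin m) ℂ 2) : Prop :=
  lam ≠ 0 ∧ ∃ μ ∈ perp d, ∃ ν ∈ perp d, lam = wedge (oneForm μ) (oneForm ν)

/-- `⋀² ℂ^m_d ⊆ ⋀² ℂ^m`. -/
def wedgeSqPerp {m : ℕ} (d : Fin m → ℕ) : Submodule ℂ (Alt (Fin m) ℂ 2) :=
  Submodule.span ℂ {a | ∃ μ ∈ perp d, ∃ ν ∈ perp d, a = wedge (oneForm μ) (oneForm ν)}

/-- The representatives `lam'` of tangent vectors of `Gr(2, ℂ^m_d)` at `lam`. -/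
def grTangentRep {m : ℕ} (d : Fin m → ℕ) (lam : Alt (Fin m) ℂ 2) :
    Submodule ℂ (Alt (Fin m) ℂ 2) :=
  wedgeSqPerp d ⊓ LinearMap.ker (wedge (l := 2).flip lam)

/-- `T_lam Gr(2, ℂ^m_d) = {lam' ∈ ⋀² ℂ^m_d : lam' ∧ lam = 0} / ⟨lam⟩`. -/
abbrev GrTangent {m : ℕ} (d : Fin m → ℕ) (lam : Alt (Fin m) ℂ 2) : Type :=
  grTangentRep d lam ⧸ (Submodule.span ℂ {lam}).submoduleOf (grTangentRep d lam)

/-- `T_F ℙ(S_e) = S_e / ⟨F⟩`. -/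
abbrev PolyTangent {n e : ℕ} (F : HomPoly n e) : Type :=
  HomPoly n e ⧸ Submodule.span ℂ {F}

/-- The hypersurfaces `F_i = 0` are smooth with normal crossings: at every point of `ℙⁿ` the
differentials of those `F_i` that vanish there are linearly independent (a single such `F_i` is
thus smooth there). -/
def NormalCrossings {n m : ℕ} (F : Fin m → Poly n) : Prop :=
  ∀ x : Fin (n + 1) → ℂ, x ≠ 0 →
    LinearIndependent ℂ fun i : {i : Fin m // MvPolynomial.eval x (F i) = 0} =>
      fun j : Fin (n + 1) => MvPolynomial.eval x (MvPolynomial.pderiv j (F i))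

/-- The open set `U₂(d)` of generic parameters (in terms of representatives). -/
structure IsGeneric {n m : ℕ} (d : Fin m → ℕ) (lam : Alt (Fin m) ℂ 2)
    (F : ∀ i, HomPoly n (d i)) : Prop where
  gr : IsGrPoint d lam
  ne_zero : ∀ i j, i ≠ j → coord lam i j ≠ 0
  sum_ne_zero : ∀ i j k, i ≠ j → i ≠ k → j ≠ k →
    coord lam i j - coord lam i k + coord lam j k ≠ 0
  diff_ne_zero : ∀ i j k, i ≠ j → i ≠ k → j ≠ k →
    coord lam i j - coord lam i k - coord lam j k ≠ 0
  irreducible : ∀ i, Irreducible (F i : Poly n)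
  normalCrossings : NormalCrossings fun i => (F i : Poly n)

/-! ### The natural parametrization and its derivative -/

/-- `F̂_{ij} dF_i ∧ dF_j`, where `F̂_{ij} = ∏ k ≠ i, j, F_k`. -/
def logTerm {n m : ℕ} (i j : Fin m) (F : Fin m → Poly n) : Form n 2 :=
  (∏ k ∈ ({i, j} : Finset (Fin m))ᶜ, F k) • wedge (dPoly (F i)) (dPoly (F j))

theorem dPoly_add {n : ℕ} (F G : Poly n) : dPoly (F + G) = dPoly F + dPoly G := by
  ext v
  simp [dPoly, oneForm, Fintype.linearCombination_apply, Finset.sum_add_distrib]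

theorem dPoly_smul {n : ℕ} (c : ℂ) (F : Poly n) : dPoly (c • F) = c • dPoly F := by
  ext v
  simp [dPoly, oneForm, Fintype.linearCombination_apply, Finset.smul_sum, smul_comm c]

theorem logTerm_update_add {n m : ℕ} {i j : Fin m} (hij : i ≠ j) (F : Fin m → Poly n) (k : Fin m)
    (x y : Poly n) :
    logTerm i j (Function.update F k (x + y)) =
      logTerm i j (Function.update F k x) + logTerm i j (Function.update F k y) := by
  unfold logTerm
  by_cases hk : k ∈ ({i, j} : Finset (Fin m))ᶜ
  · have hi : i ≠ k := by rintro rfl; simp at hk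
    have hj : j ≠ k := by rintro rfl; simp at hk
    simp only [Finset.prod_update_of_mem hk, Function.update_of_ne hi, Function.update_of_ne hj,
      add_mul, add_smul]
  · simp only [Finset.prod_update_of_notMem hk, ← smul_add]
    have hk' : k = i ∨ k = j := by simpa [or_iff_not_imp_left] using hk
    rcases hk' with rfl | rfl
    · simp only [Function.update_self, Function.update_of_ne hij.symm, dPoly_add, map_add,
        LinearMap.add_apply]
    · simp only [Function.update_self, Function.update_of_ne hij, dPoly_add, map_add]

theorem logTerm_update_smul {n m : ℕ} {i j : Fin m} (hij : i ≠ j) (F : Fin m → Poly n) (k : Fin m)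
    (c : ℂ) (x : Poly n) :
    logTerm i j (Function.update F k (c • x)) = c • logTerm i j (Function.update F k x) := by
  unfold logTerm
  by_cases hk : k ∈ ({i, j} : Finset (Fin m))ᶜ
  · have hi : i ≠ k := by rintro rfl; simp at hk
    have hj : j ≠ k := by rintro rfl; simp at hk
    simp only [Finset.prod_update_of_mem hk, Function.update_of_ne hi, Function.update_of_ne hj,
      smul_mul_assoc]
    ext v
    simp
  · simp only [Finset.prod_update_of_notMem hk]
    rw [smul_comm c]
    have hk' : k = i ∨ k = j := by simpa [or_iff_not_imp_left] using hk
    rcases hk' with rfl | rfl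
    · simp only [Function.update_self, Function.update_of_ne hij.symm, dPoly_smul, map_smul,
        LinearMap.smul_apply]
    · simp only [Function.update_self, Function.update_of_ne hij, dPoly_smul, map_smul]

theorem coe_update {n m : ℕ} {d : Fin m → ℕ} (F : ∀ i, HomPoly n (d i)) (k : Fin m)
    (x : HomPoly n (d k)) :
    (fun i => (Function.update F k x i : Poly n)) =
      Function.update (fun i => (F i : Poly n)) k x := by
  ext1 i
  by_cases h : i = k
  · subst h; simp
  · simp [Function.update_of_ne h]

/-- The map `(lam, F) ↦ ∑_{i < j} lam_{ij} F̂_{ij} dF_i ∧ dF_j`, which is linear in `lam` and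
multilinear in `F`. -/
def phi {n m : ℕ} (d : Fin m → ℕ) :
    Alt (Fin m) ℂ 2 →ₗ[ℂ] MultilinearMap ℂ (fun i => HomPoly n (d i)) (Form n 2) where
  toFun lam :=
    { toFun := fun F => ∑ i, ∑ j, if i < j then
        coord lam i j • logTerm i j (fun k => (F k : Poly n)) else 0
      map_update_add' := by
        intro inst F k x y
        obtain rfl : inst = instDecidableEqFin m := Subsingleton.elim _ _
        rw [← Finset.sum_add_distrib]
        refine Finset.sum_congr rfl fun i _ => ?_
        rw [← Finset.sum_add_distrib]
        refine Finset.sum_congr rfl fun j _ => ?_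
        split_ifs with hij
        · simp only [coe_update, Submodule.coe_add, logTerm_update_add hij.ne, smul_add]
        · simp
      map_update_smul' := by
        intro inst F k c x
        obtain rfl : inst = instDecidableEqFin m := Subsingleton.elim _ _
        rw [Finset.smul_sum]
        refine Finset.sum_congr rfl fun i _ => ?_
        rw [Finset.smul_sum]
        refine Finset.sum_congr rfl fun j _ => ?_
        split_ifs with hij
        · simp only [coe_update, Submodule.coe_smul, logTerm_update_smul hij.ne]
          rw [smul_comm]
        · simp }
  map_add' := by
    intro a b
    ext1 F
    simp only [MultilinearMap.coe_mk, add_apply]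
    rw [← Finset.sum_add_distrib]
    refine Finset.sum_congr rfl fun i _ => ?_
    rw [← Finset.sum_add_distrib]
    refine Finset.sum_congr rfl fun j _ => ?_
    split_ifs with hij
    · simp [coord, add_smul]
    · simp
  map_smul' := by
    intro c a
    ext1 F
    simp only [MultilinearMap.coe_mk, smul_apply, RingHom.id_apply]
    rw [Finset.smul_sum]
    refine Finset.sum_congr rfl fun i _ => ?_
    rw [Finset.smul_sum]
    refine Finset.sum_congr rfl fun j _ => ?_
    split_ifs with hij
    · simp [coord, mul_smul]
    · simp

/-- The partial derivative of the natural parametrization in the direction of the Grassmannian,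
`lam' ↦ phi lam' F`, on tangent spaces. -/
def dRhoGr {n m : ℕ} (d : Fin m → ℕ) (lam : Alt (Fin m) ℂ 2) (F : ∀ i, HomPoly n (d i)) :
    GrTangent d lam →ₗ[ℂ] Form n 2 ⧸ Submodule.span ℂ {phi d lam F} :=
  Submodule.mapQ _ _
    { toFun := fun lam' : grTangentRep d lam => phi d lam' F
      map_add' := fun a b => by simp
      map_smul' := fun c a => by simp }
    (by
      intro a ha
      obtain ⟨c, hc⟩ := Submodule.mem_span_singleton.mp ha
      refine Submodule.mem_span_singleton.mpr ⟨c, ?_⟩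
      change c • phi d lam F = phi d (a : Alt (Fin m) ℂ 2) F
      rw [← show c • lam = (a : Alt (Fin m) ℂ 2) from hc, map_smul, smul_apply])

/-- The partial derivative of the natural parametrization in the direction of `F_i`,
`F_i' ↦ phi lam (F_1, …, F_i', …, F_m)`, on tangent spaces. -/
def dRhoPoly {n m : ℕ} (d : Fin m → ℕ) (lam : Alt (Fin m) ℂ 2) (F : ∀ i, HomPoly n (d i))
    (i : Fin m) :
    PolyTangent (F i) →ₗ[ℂ] Form n 2 ⧸ Submodule.span ℂ {phi d lam F} :=
  Submodule.mapQ _ _ ((phi d lam).toLinearMap F i)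
    (by
      rw [Submodule.span_singleton_le_iff_mem]
      simp only [Submodule.mem_comap, MultilinearMap.toLinearMap_apply, Function.update_eq_self]
      exact Submodule.mem_span_singleton_self _)

/-- The derivative `dρ(lam, F)` of the natural parametrization `ρ(lam, F) = [phi lam F]`. -/
def dRho {n m : ℕ} (d : Fin m → ℕ) (lam : Alt (Fin m) ℂ 2) (F : ∀ i, HomPoly n (d i)) :
    (GrTangent d lam × ∀ i, PolyTangent (F i)) →ₗ[ℂ]
      Form n 2 ⧸ Submodule.span ℂ {phi d lam F} :=
  (dRhoGr d lam F).coprod (∑ i, dRhoPoly d lam F i ∘ₗ LinearMap.proj i)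

end LogForms

end

open LogForms

/-! ### Exterior products written out on vectors -/

noncomputable section
namespace LogForms
open Equiv

/-! Image in tangent space. With F = ∏ F_r, the form ω/F has constant coefficients λ_st in the
closed forms dF_s/F_s. Hence dω = (dF/F) ∧ ω, and for another residue matrix λ' both linearized
equations follow from λ ∧ λ' = 0 (`isTangent_logBil`). The directions F_i' follow by polarization,
since φ(λ, ·) always solves the quadratic equations (`isTangent_phi_update`).

Tangent space in image. Let J_A be the ideal of the F_s, s ∈ A (`stratum F A`), and F̂_A the product
of the other F_r (`hat F A`). A tangent vector α is corrected until it vanishes on strata of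
codimension three, then two, then one.

Two tools are used throughout. Away from the origin normal crossings give vector fields X_t with
dF_s(X_t) = u δ_st. A statement proved up to powers of such u holds up to powers of the irrelevant
ideal, hence outright when the stratum has positive depth (`mem_of_dualFrame`); for up to four
hypersurfaces this is where n > 3 enters. Secondly, a form vanishing modulo J_{A ∪ t} for all t in T
is a multiple of ∏_T F_t modulo J_A, so it vanishes modulo J_A if its degree is too small
(`IsArrangement.mem_of_forall_insert`); the balance condition provides such degree bounds.

Codimension three. Modulo J_ijk, ω vanishes and dω = (λ_ij − λ_ik + λ_jk) F̂_ijk dF_i∧dF_j∧dF_k. The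
equation then makes α a combination of the dF_s∧dF_t with coefficients divisible by F̂_ijk, that is
F̂_ijk (λ_jk g_i dF_j∧dF_k + λ_ik g_j dF_i∧dF_k + λ_ij g_k dF_i∧dF_j) for some g depending on the
triple (`IsTangent.exists_eq`). On codimension four the two linearized equations force these g to
agree (`IsTangent.residue_sub_mem`), so they glue to global g_i of degree d_i. Subtracting the
derivative in the directions F_i' = g_i leaves β vanishing modulo all J_ijk.

Codimension two. Modulo J_ij one has β = F̂_ij γ with γ of degree d_i + d_j − 2, and the equations
and degrees force γ = c_ij dF_i∧dF_j with c_ij constant (`IsReduced.exists_const_pair`). Subtracting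
the logarithmic form with residues c leaves η vanishing modulo all J_ij.

Codimension one. Modulo F_i one has η = F̂_i δ with δ of degree d_i − 2, and degrees force δ = 0
modulo F_i (`IsResidual.mem_single`). So each coefficient of η is divisible by F, of larger degree,
and η = 0.

Thus β is logarithmic with constant residues c. Evaluating the tangency equation on a frame gives λ
∧ c = 0, and contraction with the radial field gives Σ_s d_s c_st = 0, so c is a tangent vector of
the Grassmannian. -/

/-- A shuffle is a coset of permutations modulo those of the two blocks, so the sum over all
permutations counts each shuffle k! l! times. -/
theorem factorial_smul_wedge {ι A : Type} [CommRing A] [Algebra ℂ A] {k l : ℕ}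
    (a : Alt ι A k) (b : Alt ι A l) (v : Fin (k + l) → ι → ℂ) :
    (k.factorial * l.factorial) • wedge a b v =
      ∑ σ : Perm (Fin (k + l)), Perm.sign σ •
        (a (fun i => v (σ (Fin.castAdd l i))) * b (fun i => v (σ (Fin.natAdd k i)))) := by
  have h := congrArg (fun f => (LinearMap.mul' ℂ A) (f (fun i => v (finSumFinEquiv i))))
    (MultilinearMap.domCoprod_alternization_eq a b)
  simp only [Fintype.card_fin] at h
  have e : wedge a b v = LinearMap.mul' ℂ A (a.domCoprod b (fun i => v (finSumFinEquiv i))) := rfl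
  rw [e, ← map_nsmul, ← AlternatingMap.smul_apply, ← h, MultilinearMap.alternatization_apply,
    map_sum]
  refine Fintype.sum_equiv finSumFinEquiv.permCongr _ _ fun σ => ?_
  rw [Perm.sign_permCongr, Units.smul_def, Units.smul_def, map_zsmul]
  simp [MultilinearMap.domCoprod_apply, Equiv.permCongr_apply]

theorem sum_perm_succ {M : Type} [AddCommMonoid M] {n : ℕ} (f : Perm (Fin (n + 1)) → M) :
    ∑ σ, f σ = ∑ p, ∑ e, f (Perm.decomposeFin.symm (p, e)) := by
  rw [← Fintype.sum_prod_type']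
  exact (Fintype.sum_equiv Perm.decomposeFin.symm _ _ fun _ => rfl).symm

theorem sum_perm_two {A : Type} [AddCommGroup A] (g : Fin 2 → Fin 2 → A) :
    ∑ σ : Perm (Fin 2), Perm.sign σ • g (σ 0) (σ 1) = g 0 1 - g 1 0 := by
  rw [sum_perm_succ]
  simp [Fin.sum_univ_two, sub_eq_add_neg, Units.smul_def]

theorem sum_perm_three {A : Type} [AddCommGroup A] (g : Fin 3 → Fin 3 → Fin 3 → A) :
    ∑ σ : Perm (Fin 3), Perm.sign σ • g (σ 0) (σ 1) (σ 2) =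
      g 0 1 2 - g 0 2 1 - g 1 0 2 + g 1 2 0 - g 2 1 0 + g 2 0 1 := by
  have e2 : (2 : Fin 3) = Fin.succ 1 := rfl
  have h (p : Fin 3) := sum_perm_two
    (fun a b => g p (swap 0 p (Fin.succ a)) (swap 0 p (Fin.succ b)))
  rw [sum_perm_succ]
  simp only [Perm.decomposeFin.symm_sign, Perm.decomposeFin_symm_apply_zero,
    Perm.decomposeFin_symm_apply_one, e2, Perm.decomposeFin_symm_apply_succ, mul_smul,
    ← Finset.smul_sum, h]
  have a1 : swap (0 : Fin 3) 1 1 = 0 := by decide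
  have a2 : swap (0 : Fin 3) 1 2 = 2 := by decide
  have a3 : swap (0 : Fin 3) 2 1 = 1 := by decide
  have a4 : swap (0 : Fin 3) 2 2 = 0 := by decide
  simp only [Fin.sum_univ_three]
  simp [a1, a2, a3, a4, Units.smul_def, Fin.succ_zero_eq_one, Fin.succ_one_eq_two]
  abel

theorem sum_perm_four {A : Type} [AddCommGroup A] (g : Fin 4 → Fin 4 → Fin 4 → Fin 4 → A) :
    ∑ σ : Perm (Fin 4), Perm.sign σ • g (σ 0) (σ 1) (σ 2) (σ 3) =
      (g 0 1 2 3 - g 0 1 3 2 - g 0 2 1 3 + g 0 2 3 1 - g 0 3 2 1 + g 0 3 1 2) -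
      (g 1 0 2 3 - g 1 0 3 2 - g 1 2 0 3 + g 1 2 3 0 - g 1 3 2 0 + g 1 3 0 2) -
      (g 2 1 0 3 - g 2 1 3 0 - g 2 0 1 3 + g 2 0 3 1 - g 2 3 0 1 + g 2 3 1 0) -
      (g 3 1 2 0 - g 3 1 0 2 - g 3 2 1 0 + g 3 2 0 1 - g 3 0 2 1 + g 3 0 1 2) := by
  have e2 : (2 : Fin 4) = Fin.succ 1 := rfl
  have e3 : (3 : Fin 4) = Fin.succ 2 := rfl
  have h (p : Fin 4) := sum_perm_three
    (fun a b c => g p (swap 0 p (Fin.succ a)) (swap 0 p (Fin.succ b)) (swap 0 p (Fin.succ c)))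
  rw [sum_perm_succ]
  simp only [Perm.decomposeFin.symm_sign, Perm.decomposeFin_symm_apply_zero,
    Perm.decomposeFin_symm_apply_one, e2, e3, Perm.decomposeFin_symm_apply_succ, mul_smul,
    ← Finset.smul_sum, h]
  have a (i j : Fin 4) : swap (0 : Fin 4) i j = if j = 0 then i else if j = i then 0 else j := rfl
  simp only [Fin.sum_univ_four, a, Fin.succ_zero_eq_one, ← e3, ← e2,
    Units.smul_def]
  simp only [Fin.reduceEq, if_true, if_false]
  simp
  abel

theorem swap_two {ι A : Type} [CommRing A] [Algebra ℂ A]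
    (a : Alt ι A 2) (v w : ι → ℂ) : a ![w, v] = - a ![v, w] := by
  have := a.map_swap ![v, w] (i := 0) (j := 1) (by decide)
  rw [← this]; congr 1; ext i; fin_cases i <;> simp

theorem swap_three_left {ι A : Type} [CommRing A] [Algebra ℂ A]
    (a : Alt ι A 3) (u v w : ι → ℂ) : a ![v, u, w] = - a ![u, v, w] := by
  have := a.map_swap ![u, v, w] (i := 0) (j := 1) (by decide)
  rw [← this]; congr 1; ext i; fin_cases i <;> simp [Equiv.swap_apply_def]

theorem swap_three_right {ι A : Type} [CommRing A] [Algebra ℂ A]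
    (a : Alt ι A 3) (u v w : ι → ℂ) : a ![u, w, v] = - a ![u, v, w] := by
  have := a.map_swap ![u, v, w] (i := 1) (j := 2) (by decide)
  rw [← this]; congr 1; ext i; fin_cases i <;> simp [Equiv.swap_apply_def]

theorem wedge_one_one {ι A : Type} [CommRing A] [Algebra ℂ A]
    (a b : Alt ι A 1) (v₀ v₁ : ι → ℂ) :
    wedge a b ![v₀, v₁] = a ![v₀] * b ![v₁] - a ![v₁] * b ![v₀] := by
  have h := factorial_smul_wedge a b ![v₀, v₁]
  have e : ∀ (c : Alt ι A 1) (x : Fin 1 → ι → ℂ), c x = c ![x 0] := by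
    intro c x; congr 1; ext i; fin_cases i; rfl
  have h := h.trans ((Finset.sum_congr rfl fun σ _ => by rw [e a, e b]; rfl).trans
    (sum_perm_two fun i j => a ![![v₀, v₁] i] * b ![![v₀, v₁] j]))
  simpa using h

theorem wedge_two_two {ι A : Type} [CommRing A] [Algebra ℂ A]
    (a b : Alt ι A 2) (v₀ v₁ v₂ v₃ : ι → ℂ) :
    wedge a b ![v₀, v₁, v₂, v₃] =
      a ![v₀, v₁] * b ![v₂, v₃] - a ![v₀, v₂] * b ![v₁, v₃] + a ![v₀, v₃] * b ![v₁, v₂]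
      + a ![v₁, v₂] * b ![v₀, v₃] - a ![v₁, v₃] * b ![v₀, v₂] + a ![v₂, v₃] * b ![v₀, v₁] := by
  have h := factorial_smul_wedge a b ![v₀, v₁, v₂, v₃]
  have e : ∀ (c : Alt ι A 2) (x : Fin 2 → ι → ℂ), c x = c ![x 0, x 1] := by
    intro c x; congr 1; ext i; fin_cases i <;> rfl
  have h := h.trans ((Finset.sum_congr rfl fun σ _ => by rw [e a, e b]; rfl).trans
    (sum_perm_four fun i j k l => a ![![v₀, v₁, v₂, v₃] i, ![v₀, v₁, v₂, v₃] j] *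
      b ![![v₀, v₁, v₂, v₃] k, ![v₀, v₁, v₂, v₃] l]))
  have h4 : (4 : ℂ) ≠ 0 := by norm_num
  refine (IsUnit.mk0 (4 : ℂ) h4).smul_left_cancel.mp ?_
  have h5 : (Nat.factorial 2 * Nat.factorial 2) = 4 := rfl
  rw [h5] at h
  have h6 : ∀ x : A, (4 : ℂ) • x = 4 • x := fun x => by
    rw [← Nat.cast_smul_eq_nsmul ℂ]; norm_num
  rw [h6, h6]
  refine h.trans ?_
  simp only [Matrix.cons_val]
  rw [swap_two a v₀ v₁, swap_two a v₀ v₂, swap_two a v₀ v₃, swap_two a v₁ v₂, swap_two a v₁ v₃,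
    swap_two a v₂ v₃, swap_two b v₀ v₁, swap_two b v₀ v₂, swap_two b v₀ v₃, swap_two b v₁ v₂,
    swap_two b v₁ v₃, swap_two b v₂ v₃]
  rw [nsmul_eq_mul]
  push_cast
  ring

theorem wedge_one_three {ι A : Type} [CommRing A] [Algebra ℂ A]
    (a : Alt ι A 1) (b : Alt ι A 3) (v₀ v₁ v₂ v₃ : ι → ℂ) :
    wedge a b ![v₀, v₁, v₂, v₃] =
      a ![v₀] * b ![v₁, v₂, v₃] - a ![v₁] * b ![v₀, v₂, v₃] + a ![v₂] * b ![v₀, v₁, v₃]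
      - a ![v₃] * b ![v₀, v₁, v₂] := by
  have h := factorial_smul_wedge a b ![v₀, v₁, v₂, v₃]
  have ea : ∀ (c : Alt ι A 1) (x : Fin 1 → ι → ℂ), c x = c ![x 0] := by
    intro c x; congr 1; ext i; fin_cases i; rfl
  have e : ∀ (c : Alt ι A 3) (x : Fin 3 → ι → ℂ), c x = c ![x 0, x 1, x 2] := by
    intro c x; congr 1; ext i; fin_cases i <;> rfl
  have h := h.trans ((Finset.sum_congr rfl fun σ _ => by rw [ea a, e b]; rfl).trans
    (sum_perm_four fun i j k l => a ![![v₀, v₁, v₂, v₃] i] *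
      b ![![v₀, v₁, v₂, v₃] j, ![v₀, v₁, v₂, v₃] k, ![v₀, v₁, v₂, v₃] l]))
  have h6 : (6 : ℂ) ≠ 0 := by norm_num
  refine (IsUnit.mk0 (6 : ℂ) h6).smul_left_cancel.mp ?_
  have h5 : (Nat.factorial 1 * Nat.factorial 3) = 6 := rfl
  rw [h5] at h
  have h6 : ∀ x : A, (6 : ℂ) • x = 6 • x := fun x => by
    rw [← Nat.cast_smul_eq_nsmul ℂ]; norm_num
  rw [h6, h6]
  refine h.trans ?_
  simp only [Matrix.cons_val]
  have s (x y z : ι → ℂ) : b ![x, z, y] = - b ![x, y, z] ∧ b ![y, x, z] = - b ![x, y, z] ∧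
      b ![y, z, x] = b ![x, y, z] ∧ b ![z, x, y] = b ![x, y, z] ∧ b ![z, y, x] = - b ![x, y, z] := by
    refine ⟨swap_three_right b .., swap_three_left b .., ?_, ?_, ?_⟩
    · rw [swap_three_right b y x z, swap_three_left b x y z, neg_neg]
    · rw [swap_three_left b x z y, swap_three_right b x y z, neg_neg]
    · rw [swap_three_left b y z x, swap_three_right b y x z, swap_three_left b x y z, neg_neg]
  obtain ⟨p1, p2, p3, p4, p5⟩ := s v₁ v₂ v₃
  obtain ⟨q1, q2, q3, q4, q5⟩ := s v₀ v₂ v₃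
  obtain ⟨r1, r2, r3, r4, r5⟩ := s v₀ v₁ v₃
  obtain ⟨t1, t2, t3, t4, t5⟩ := s v₀ v₁ v₂
  rw [p1, p2, p3, p4, p5, q1, q2, q3, q4, q5, r1, r2, r3, r4, r5, t1, t2, t3, t4, t5]
  rw [nsmul_eq_mul]
  push_cast
  ring
end LogForms

end

/-! ### Calculus of bilinear forms on polynomial vector fields -/

noncomputable section
namespace LogForms
open MvPolynomial

/-- Polynomial vector fields on `ℂ^{n+1}`. -/
abbrev VF (n : ℕ) : Type := Fin (n + 1) → Poly n

/-- Bilinear forms on polynomial vector fields. -/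
abbrev Bil (n : ℕ) : Type := VF n →ₗ[Poly n] VF n →ₗ[Poly n] Poly n

/-- The derivation `f ↦ ∑ i, u_i ∂f/∂z_i` given by a vector field `u`. -/
def along {n : ℕ} : VF n →ₗ[Poly n] Derivation ℂ (Poly n) (Poly n) :=
  Fintype.linearCombination (Poly n) fun i => pderiv i

theorem along_apply {n : ℕ} (u : VF n) (f : Poly n) : along u f = ∑ i, u i * pderiv i f := by
  have h := map_sum (Derivation.coeFnAddMonoidHom (R := ℂ) (A := Poly n) (M := Poly n))
    (fun i => u i • pderiv i) Finset.univ
  rw [along, Fintype.linearCombination_apply]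
  refine (congrFun h f).trans ?_
  rw [Finset.sum_apply]
  rfl

theorem along_single {n : ℕ} (a : Fin (n + 1)) (f : Poly n) :
    along (Pi.single a 1) f = pderiv a f := by
  simp [along_apply, Pi.single_apply]

theorem along_X {n : ℕ} (u : VF n) (a : Fin (n + 1)) : along u (X a) = u a := by
  simp [along_apply, pderiv_X, Pi.single_apply]

/-- The differential of `f` as a linear form on vector fields. -/
def diff {n : ℕ} (f : Poly n) : VF n →ₗ[Poly n] Poly n where
  toFun u := along u f
  map_add' u v := by simp
  map_smul' c u := by simp

@[simp] theorem diff_apply {n : ℕ} (f : Poly n) (u : VF n) : diff f u = along u f := rfl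

/-- The coefficientwise derivative of the vector field `v` along `u`. -/
def transport {n : ℕ} (u v : VF n) : VF n := fun b => along u (v b)

theorem transport_add_right {n : ℕ} (u v w : VF n) :
    transport u (v + w) = transport u v + transport u w := by
  ext1 b; simp [transport]

theorem transport_smul_right {n : ℕ} (u v : VF n) (f : Poly n) :
    transport u (f • v) = along u f • v + f • transport u v := by
  ext1 b; simp [transport]; ring

theorem transport_add_left {n : ℕ} (u v w : VF n) :
    transport (u + v) w = transport u w + transport v w := by
  ext1 b; simp [transport]

theorem transport_smul_left {n : ℕ} (u v : VF n) (f : Poly n) :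
    transport (f • u) v = f • transport u v := by
  ext1 b; simp [transport]

/-- The Hessian `along u ∘ along v - along (transport u v)` is symmetric. -/
theorem along_along {n : ℕ} (u v : VF n) (f : Poly n) :
    along u (along v f) - along (transport u v) f =
      along v (along u f) - along (transport v u) f := by
  -- Both sides are derivations, so it suffices to compare them on the coordinate functions.
  have h : ⁅along u, along v⁆ = along (transport u v - transport v u) := by
    refine derivation_ext fun i => ?_
    simp only [Derivation.commutator_apply, along_X, transport, Pi.sub_apply]
  have h := DFunLike.congr_fun h f
  simp only [Derivation.commutator_apply, map_sub, Derivation.sub_apply] at h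
  linear_combination h

/-- The covariant derivative along `u` of a bilinear form on vector fields. -/
def nab {n : ℕ} (B : Bil n) (u v w : VF n) : Poly n :=
  along u (B v w) - B (transport u v) w - B v (transport u w)

/-- The exterior derivative of an alternating bilinear form on vector fields. -/
def extB {n : ℕ} (B : Bil n) (u v w : VF n) : Poly n :=
  nab B u v w - nab B v u w + nab B w u v

/-- The exterior product of two alternating bilinear forms. -/
def wedgeB {n : ℕ} (B B' : Bil n) (v₀ v₁ v₂ v₃ : VF n) : Poly n :=
  B v₀ v₁ * B' v₂ v₃ - B v₀ v₂ * B' v₁ v₃ + B v₀ v₃ * B' v₁ v₂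
      + B v₁ v₂ * B' v₀ v₃ - B v₁ v₃ * B' v₀ v₂ + B v₂ v₃ * B' v₀ v₁

/-- The exterior product of the linear form `B v` and `dB'`. -/
def wedgeD {n : ℕ} (B B' : Bil n) (v u₀ u₁ u₂ u₃ : VF n) : Poly n :=
  B v u₀ * extB B' u₁ u₂ u₃ - B v u₁ * extB B' u₀ u₂ u₃ + B v u₂ * extB B' u₀ u₁ u₃
    - B v u₃ * extB B' u₀ u₁ u₂

/-- The linearization at `B` of the equations of foliations, at `B'`. -/
structure IsTangent {n : ℕ} (B B' : Bil n) : Prop where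
  wedge_eq : ∀ v₀ v₁ v₂ v₃, wedgeB B B' v₀ v₁ v₂ v₃ = 0
  wedgeD_eq : ∀ v u₀ u₁ u₂ u₃, wedgeD B' B v u₀ u₁ u₂ u₃ + wedgeD B B' v u₀ u₁ u₂ u₃ = 0

section nab
variable {n : ℕ} (B B' : Bil n) (c : ℂ) (f : Poly n) (u u' v v' w w' : VF n)

theorem nab_add : nab (B + B') u v w = nab B u v w + nab B' u v w := by
  simp [nab]; ring
theorem nab_smul : nab (c • B) u v w = c • nab B u v w := by
  simp [nab, smul_sub]
theorem nab_add_left : nab B (u + u') v w = nab B u v w + nab B u' v w := by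
  simp [nab, transport_add_left]; ring
theorem nab_smul_left : nab B (f • u) v w = f * nab B u v w := by
  simp [nab, transport_smul_left]; ring
theorem nab_add_mid : nab B u (v + v') w = nab B u v w + nab B u v' w := by
  simp [nab, transport_add_right]; ring
theorem nab_smul_mid : nab B u (f • v) w = f * nab B u v w := by
  simp [nab, transport_smul_right]; ring
theorem nab_add_right : nab B u v (w + w') = nab B u v w + nab B u v w' := by
  simp [nab, transport_add_right]; ring
theorem nab_smul_right : nab B u v (f • w) = f * nab B u v w := by
  simp [nab, transport_smul_right]; ring

theorem extB_add : extB (B + B') u v w = extB B u v w + extB B' u v w := by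
  simp only [extB, nab_add]; ring
theorem extB_smul : extB (c • B) u v w = c • extB B u v w := by
  simp only [extB, nab_smul, smul_sub, smul_add]
theorem extB_add₁ : extB B (u + u') v w = extB B u v w + extB B u' v w := by
  simp only [extB, nab_add_left, nab_add_mid]; ring
theorem extB_smul₁ : extB B (f • u) v w = f * extB B u v w := by
  simp only [extB, nab_smul_left, nab_smul_mid]; ring
theorem extB_add₂ : extB B u (v + v') w = extB B u v w + extB B u v' w := by
  simp only [extB, nab_add_left, nab_add_mid, nab_add_right]; ring
theorem extB_smul₂ : extB B u (f • v) w = f * extB B u v w := by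
  simp only [extB, nab_smul_left, nab_smul_mid, nab_smul_right]; ring
theorem extB_add₃ : extB B u v (w + w') = extB B u v w + extB B u v w' := by
  simp only [extB, nab_add_left, nab_add_right]; ring
theorem extB_smul₃ : extB B u v (f • w) = f * extB B u v w := by
  simp only [extB, nab_smul_left, nab_smul_right]; ring
theorem extB_zero : extB (0 : Bil n) u v w = 0 := by
  simp [extB, nab]
end nab

theorem IsTangent.add {n : ℕ} {B B₁ B₂ : Bil n} (h₁ : IsTangent B B₁) (h₂ : IsTangent B B₂) :
    IsTangent B (B₁ + B₂) where
  wedge_eq v₀ v₁ v₂ v₃ := by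
    have e₁ := h₁.wedge_eq v₀ v₁ v₂ v₃
    have e₂ := h₂.wedge_eq v₀ v₁ v₂ v₃
    simp only [wedgeB, LinearMap.add_apply] at *
    linear_combination e₁ + e₂
  wedgeD_eq v u₀ u₁ u₂ u₃ := by
    have e₁ := h₁.wedgeD_eq v u₀ u₁ u₂ u₃
    have e₂ := h₂.wedgeD_eq v u₀ u₁ u₂ u₃
    simp only [wedgeD, LinearMap.add_apply, extB_add] at *
    linear_combination e₁ + e₂

theorem IsTangent.smul {n : ℕ} {B B₁ : Bil n} (h₁ : IsTangent B B₁) (c : ℂ) :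
    IsTangent B (c • B₁) where
  wedge_eq v₀ v₁ v₂ v₃ := by
    have e₁ := h₁.wedge_eq v₀ v₁ v₂ v₃
    simp only [wedgeB, LinearMap.smul_apply, smul_eq_C_mul] at *
    linear_combination C c * e₁
  wedgeD_eq v u₀ u₁ u₂ u₃ := by
    have e₁ := h₁.wedgeD_eq v u₀ u₁ u₂ u₃
    simp only [wedgeD, LinearMap.smul_apply, extB_smul, smul_eq_C_mul] at *
    linear_combination C c * e₁

theorem isTangent_zero {n : ℕ} (B : Bil n) : IsTangent B 0 where
  wedge_eq v₀ v₁ v₂ v₃ := by simp [wedgeB]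
  wedgeD_eq v u₀ u₁ u₂ u₃ := by simp [wedgeD, extB_zero]

theorem IsTangent.sum {n : ℕ} {ι : Type} (s : Finset ι) {B : Bil n} {f : ι → Bil n}
    (h : ∀ i ∈ s, IsTangent B (f i)) : IsTangent B (∑ i ∈ s, f i) := by
  classical
  induction s using Finset.induction_on with
  | empty => simpa using isTangent_zero B
  | insert a s ha ih =>
    rw [Finset.sum_insert ha]
    exact (h a (by simp)).add (ih fun i hi => h i (by simp [hi]))

theorem IsTangent.sub {n : ℕ} {B B₁ B₂ : Bil n} (h₁ : IsTangent B B₁) (h₂ : IsTangent B B₂) :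
    IsTangent B (B₁ - B₂) := by
  have e : B₁ - B₂ = B₁ + (-1 : ℂ) • B₂ := by
    refine LinearMap.ext fun v => LinearMap.ext fun w => ?_
    simp [sub_eq_add_neg]
  rw [e]
  exact h₁.add (h₂.smul (-1))

/-! ### Forms as bilinear maps on vector fields -/

/-- The extension of a `2`-form to polynomial vector fields. -/
def bil {n : ℕ} : Form n 2 →ₗ[ℂ] Bil n where
  toFun ω := Matrix.toLinearMap₂' (Poly n) (Matrix.of fun a b => ω ![Pi.single a 1, Pi.single b 1])
  map_add' ω α := by rw [← map_add]; congr 1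
  map_smul' c ω := by
    refine LinearMap.ext fun v => LinearMap.ext fun w => ?_
    simp [Matrix.toLinearMap₂'_apply, Finset.smul_sum, smul_eq_C_mul, mul_left_comm]

theorem bil_apply {n : ℕ} (ω : Form n 2) (v w : VF n) :
    bil ω v w = ∑ a, ∑ b, v a * w b * ω ![Pi.single a 1, Pi.single b 1] := by
  simp [bil, Matrix.toLinearMap₂'_apply, mul_assoc]

/-- Constant vector fields. -/
def const {n : ℕ} (v : Fin (n + 1) → ℂ) : VF n := fun i => C (v i)

theorem const_single {n : ℕ} (a : Fin (n + 1)) : const (Pi.single a 1) = Pi.single a 1 := by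
  ext1 i; by_cases h : i = a <;> simp [const, h]

theorem sum_smul_single {n : ℕ} (v : Fin (n + 1) → ℂ) : v = ∑ a, v a • Pi.single a (1 : ℂ) := by
  ext i; simp [Pi.single_apply]

theorem bil_const {n : ℕ} (ω : Form n 2) (v w : Fin (n + 1) → ℂ) :
    bil ω (const v) (const w) = ω ![v, w] := by
  have h1 : ∀ (w : Fin (n + 1) → ℂ), ω ![v, w] = ∑ a, v a • ω ![Pi.single a 1, w] := by
    intro w
    have := map_sum (ω.toMultilinearMap.toLinearMap ![0, w] 0) (fun a => v a • Pi.single a (1 : ℂ))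
      Finset.univ
    rw [← sum_smul_single] at this
    have e (x : Fin (n + 1) → ℂ) : Function.update ![0, w] 0 x = ![x, w] := by
      ext i; fin_cases i <;> rfl
    simpa [MultilinearMap.toLinearMap, e] using this
  have h2 : ∀ (v : Fin (n + 1) → ℂ), ω ![v, w] = ∑ a, w a • ω ![v, Pi.single a 1] := by
    intro v
    have := map_sum (ω.toMultilinearMap.toLinearMap ![v, 0] 1) (fun a => w a • Pi.single a (1 : ℂ))
      Finset.univ
    rw [← sum_smul_single] at this
    have e (x : Fin (n + 1) → ℂ) : Function.update ![v, 0] 1 x = ![v, x] := by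
      ext i; fin_cases i <;> rfl
    simpa [MultilinearMap.toLinearMap, e] using this
  rw [h1, bil_apply]
  refine Finset.sum_congr rfl fun a _ => ?_
  rw [h2, Finset.smul_sum]
  refine Finset.sum_congr rfl fun b _ => ?_
  simp [const, smul_eq_C_mul, mul_assoc]

theorem bil_single {n : ℕ} (ω : Form n 2) (a b : Fin (n + 1)) :
    bil ω (Pi.single a 1) (Pi.single b 1) = ω ![Pi.single a 1, Pi.single b 1] := by
  rw [← const_single, ← const_single, bil_const]

theorem bil_self {n : ℕ} (ω : Form n 2) (v : VF n) : bil ω v v = 0 := by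
  have h : bil ω v v = - bil ω v v := by
    conv_lhs => rw [bil_apply, Finset.sum_comm]
    rw [bil_apply, ← Finset.sum_neg_distrib]
    refine Finset.sum_congr rfl fun a _ => ?_
    rw [← Finset.sum_neg_distrib]
    refine Finset.sum_congr rfl fun b _ => ?_
    rw [swap_two]; ring
  exact self_eq_neg.mp h

theorem bil_swap {n : ℕ} (ω : Form n 2) (v w : VF n) : bil ω w v = - bil ω v w := by
  have h := bil_self ω (v + w)
  simp only [map_add, LinearMap.add_apply, bil_self] at h
  linear_combination h

theorem bil_injective {n : ℕ} : Function.Injective (bil (n := n)) := by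
  intro ω α h
  ext v
  have e : v = ![v 0, v 1] := by ext i; fin_cases i <;> rfl
  rw [e, ← bil_const, ← bil_const, h]

theorem dirDeriv_eq_along {n : ℕ} (v : Fin (n + 1) → ℂ) (f : Poly n) :
    dirDeriv n v f = along (const v) f := by
  simp [dirDeriv, Fintype.linearCombination_apply, along_apply, const, smul_eq_C_mul]

theorem transport_const {n : ℕ} (u : VF n) (v : Fin (n + 1) → ℂ) : transport u (const v) = 0 := by
  ext1 b; simp [transport, const]

/-- Constant fields have zero `transport`, so only the directional derivatives of the values
survive. -/
theorem extD_eq {n : ℕ} (ω : Form n 2) (u v w : Fin (n + 1) → ℂ) :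
    extD ω ![u, v, w] = extB (bil ω) (const u) (const v) (const w) := by
  have e1 : Fin.removeNth (1 : Fin 3) ![u, v, w] = ![u, w] := by
    ext i; fin_cases i <;> rfl
  have e2 : Fin.removeNth (2 : Fin 3) ![u, v, w] = ![u, v] := by
    ext i; fin_cases i <;> rfl
  simp [extD, AlternatingMap.alternatizeUncurryFin_apply, Fin.sum_univ_three, extB, nab,
    transport_const, bil_const, dirDeriv_eq_along, e1, e2]
  ring

/-- A linear function on vector fields vanishes if it vanishes on the constant fields. -/
theorem eq_zero_of_linear {n : ℕ} {f : VF n → Poly n} (hadd : ∀ v w, f (v + w) = f v + f w)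
    (hsmul : ∀ (c : Poly n) v, f (c • v) = c * f v) (h : ∀ v, f (const v) = 0) (v : VF n) :
    f v = 0 := by
  let g : VF n →ₗ[Poly n] Poly n := ⟨⟨f, hadd⟩, hsmul⟩
  have : g = 0 := by
    refine LinearMap.pi_ext' fun a => LinearMap.ext_ring ?_
    simpa [g, const_single] using h (Pi.single a 1)
  exact LinearMap.congr_fun this v

/-- The equations are given on constant vectors but are needed on dual frames, whose coefficients
are polynomials. Linearity over the polynomials in each slot bridges the two. -/
theorem wedgeB_eq_zero {n : ℕ} {B B' : Bil n}
    (h : ∀ v₀ v₁ v₂ v₃, wedgeB B B' (const v₀) (const v₁) (const v₂) (const v₃) = 0)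
    (v₀ v₁ v₂ v₃ : VF n) : wedgeB B B' v₀ v₁ v₂ v₃ = 0 := by
  unfold wedgeB at *
  revert v₀
  refine eq_zero_of_linear (fun v w => by simp only [map_add, LinearMap.add_apply]; ring)
    (fun c v => by simp only [map_smul, LinearMap.smul_apply, smul_eq_mul]; ring) fun w₀ => ?_
  revert v₁
  refine eq_zero_of_linear (fun v w => by simp only [map_add, LinearMap.add_apply]; ring)
    (fun c v => by simp only [map_smul, LinearMap.smul_apply, smul_eq_mul]; ring) fun w₁ => ?_
  revert v₂
  refine eq_zero_of_linear (fun v w => by simp only [map_add, LinearMap.add_apply]; ring)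
    (fun c v => by simp only [map_smul, LinearMap.smul_apply, smul_eq_mul]; ring) fun w₂ => ?_
  revert v₃
  refine eq_zero_of_linear (fun v w => by simp only [map_add]; ring)
    (fun c v => by simp only [map_smul, smul_eq_mul]; ring) fun w₃ => ?_
  exact h w₀ w₁ w₂ w₃

/-- The same passage works for dω because the `transport` terms make `extB` linear over polynomials
in every slot. -/
theorem wedgeD_add_eq_zero {n : ℕ} {B B' : Bil n}
    (h : ∀ v u₀ u₁ u₂ u₃,
      wedgeD B' B (const v) (const u₀) (const u₁) (const u₂) (const u₃) +
        wedgeD B B' (const v) (const u₀) (const u₁) (const u₂) (const u₃) = 0)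
    (v u₀ u₁ u₂ u₃ : VF n) : wedgeD B' B v u₀ u₁ u₂ u₃ + wedgeD B B' v u₀ u₁ u₂ u₃ = 0 := by
  simp only [wedgeD] at *
  revert v
  refine eq_zero_of_linear (fun v w => by simp only [map_add, LinearMap.add_apply]; ring)
    (fun c v => by simp only [map_smul, LinearMap.smul_apply, smul_eq_mul]; ring) fun w => ?_
  revert u₀
  refine eq_zero_of_linear (fun v w => by simp only [map_add, extB_add₁]; ring)
    (fun c v => by simp only [map_smul, smul_eq_mul, extB_smul₁]; ring) fun w₀ => ?_
  revert u₁
  refine eq_zero_of_linear (fun v w => by simp only [map_add, extB_add₁, extB_add₂]; ring)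
    (fun c v => by simp only [map_smul, smul_eq_mul, extB_smul₁, extB_smul₂]; ring) fun w₁ => ?_
  revert u₂
  refine eq_zero_of_linear (fun v w => by simp only [map_add, extB_add₂, extB_add₃]; ring)
    (fun c v => by simp only [map_smul, smul_eq_mul, extB_smul₂, extB_smul₃]; ring) fun w₂ => ?_
  revert u₃
  refine eq_zero_of_linear (fun v w => by simp only [map_add, extB_add₃]; ring)
    (fun c v => by simp only [map_smul, smul_eq_mul, extB_smul₃]; ring) fun w₃ => ?_
  exact h w w₀ w₁ w₂ w₃

theorem addEps_apply {ι A : Type} [CommRing A] [Algebra ℂ A] {k : ℕ} (a b : Alt ι A k)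
    (v : Fin k → ι → ℂ) :
    addEps a b v = TrivSqZeroExt.inl (a v) + TrivSqZeroExt.inr (b v) := rfl

/-- The constant part over the dual numbers is the foliation equation for ω itself, expressed as
tangency of ω to itself, which counts the second equation twice. The ε-part is the linearization,
where symmetry of the exterior product doubles the first equation. -/
theorem mem_tangentForms_iff {n d : ℕ} {ω α : Form n 2} :
    α ∈ tangentForms n d ω ↔
      α ∈ projTwoForms n d ∧ IsTangent (bil ω) (bil ω) ∧ IsTangent (bil ω) (bil α) := by
  have e4 {X : Type} (v : Fin 4 → X) : v = ![v 0, v 1, v 2, v 3] := by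
    ext i; fin_cases i <;> rfl
  have c1 (β : Form n 2) (v w : Fin (n + 1) → ℂ) : β.curryLeft v ![w] = β ![v, w] := rfl
  refine and_congr_right fun _ => ⟨fun ⟨h1, h2⟩ => ?_, fun ⟨h1, h2⟩ => ⟨?_, fun v => ?_⟩⟩
  · have k1 (v₀ v₁ v₂ v₃) := DFunLike.congr_fun h1 ![v₀, v₁, v₂, v₃]
    have k2 (v u₀ u₁ u₂ u₃) :=
      (wedge_one_three _ _ _ _ _ _).symm.trans (DFunLike.congr_fun (h2 v) ![u₀, u₁, u₂, u₃])
    simp only [wedge_two_two, addEps_apply, TrivSqZeroExt.ext_iff] at k1 k2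
    simp only [TrivSqZeroExt.fst_add, TrivSqZeroExt.fst_sub, TrivSqZeroExt.fst_mul,
      TrivSqZeroExt.fst_inl, TrivSqZeroExt.fst_inr, TrivSqZeroExt.snd_add, TrivSqZeroExt.snd_sub,
      TrivSqZeroExt.snd_mul, TrivSqZeroExt.snd_inl, TrivSqZeroExt.snd_inr, c1,
      AlternatingMap.zero_apply, TrivSqZeroExt.fst_zero, TrivSqZeroExt.snd_zero, add_zero,
      zero_add, smul_eq_mul, MulOpposite.smul_eq_mul_unop, MulOpposite.unop_op, extD_eq, ← bil_const] at k1 k2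
    refine ⟨⟨wedgeB_eq_zero fun v₀ v₁ v₂ v₃ => ?_, wedgeD_add_eq_zero fun v u₀ u₁ u₂ u₃ => ?_⟩,
      wedgeB_eq_zero fun v₀ v₁ v₂ v₃ => ?_, wedgeD_add_eq_zero fun v u₀ u₁ u₂ u₃ => ?_⟩
    · unfold wedgeB
      linear_combination (k1 v₀ v₁ v₂ v₃).1
    · unfold wedgeD
      linear_combination 2 * (k2 v u₀ u₁ u₂ u₃).1
    · unfold wedgeB
      have h2 : (2 : Poly n) ≠ 0 := two_ne_zero
      refine (mul_right_injective₀ h2) ?_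
      dsimp only
      linear_combination (k1 v₀ v₁ v₂ v₃).2
    · unfold wedgeD
      linear_combination (k2 v u₀ u₁ u₂ u₃).2
  · ext1 v
    rw [e4 v, wedge_two_two]
    have k1 := h1.wedge_eq (const (v 0)) (const (v 1)) (const (v 2)) (const (v 3))
    have k2 := h2.wedge_eq (const (v 0)) (const (v 1)) (const (v 2)) (const (v 3))
    simp only [addEps_apply, TrivSqZeroExt.ext_iff]
    simp only [TrivSqZeroExt.fst_add, TrivSqZeroExt.fst_sub, TrivSqZeroExt.fst_mul,
      TrivSqZeroExt.fst_inl, TrivSqZeroExt.fst_inr, TrivSqZeroExt.snd_add, TrivSqZeroExt.snd_sub,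
      TrivSqZeroExt.snd_mul, TrivSqZeroExt.snd_inl, TrivSqZeroExt.snd_inr,
      AlternatingMap.zero_apply, TrivSqZeroExt.fst_zero, TrivSqZeroExt.snd_zero, add_zero,
      zero_add, smul_eq_mul, MulOpposite.smul_eq_mul_unop, MulOpposite.unop_op, ← bil_const]
    unfold wedgeB at k1 k2
    exact ⟨by linear_combination k1, by linear_combination 2 * k2⟩
  · ext1 u
    refine (congrArg _ (e4 u)).trans ((wedge_one_three _ _ _ _ _ _).trans ?_)
    have k1 := h1.wedgeD_eq (const v) (const (u 0)) (const (u 1)) (const (u 2)) (const (u 3))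
    have k2 := h2.wedgeD_eq (const v) (const (u 0)) (const (u 1)) (const (u 2)) (const (u 3))
    simp only [addEps_apply, TrivSqZeroExt.ext_iff]
    simp only [TrivSqZeroExt.fst_add, TrivSqZeroExt.fst_sub, TrivSqZeroExt.fst_mul,
      TrivSqZeroExt.fst_inl, TrivSqZeroExt.fst_inr, TrivSqZeroExt.snd_add, TrivSqZeroExt.snd_sub,
      TrivSqZeroExt.snd_mul, TrivSqZeroExt.snd_inl, TrivSqZeroExt.snd_inr, c1,
      AlternatingMap.zero_apply, TrivSqZeroExt.fst_zero, TrivSqZeroExt.snd_zero, add_zero,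
      zero_add, smul_eq_mul, MulOpposite.smul_eq_mul_unop, MulOpposite.unop_op, extD_eq, ← bil_const]
    unfold wedgeD at k1 k2
    refine ⟨?_, by linear_combination k2⟩
    have h2 : (2 : Poly n) ≠ 0 := two_ne_zero
    refine (mul_right_injective₀ h2) ?_
    dsimp only
    linear_combination k1

theorem sum_apply_vec {ι A κ : Type} [CommRing A] [Algebra ℂ A] {k : ℕ}
    (s : Finset κ) (f : κ → Alt ι A k) (v : Fin k → ι → ℂ) : (∑ i ∈ s, f i) v = ∑ i ∈ s, f i v :=
  map_sum (⟨⟨fun g : Alt ι A k => g v, rfl⟩, fun _ _ => rfl⟩ : Alt ι A k →+ A) f s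

/-- The radial vector field. -/
def radialField (n : ℕ) : VF n := fun i => X i

theorem radial_eq_zero_iff {n : ℕ} {ω : Form n 2} :
    radial ω = 0 ↔ ∀ v, bil ω (radialField n) v = 0 := by
  have key (b : Fin (n + 1) → ℂ) : radial ω ![b] = bil ω (radialField n) (const b) := by
    have e : radialField n = ∑ a, (X a : Poly n) • const (Pi.single a 1) := by
      ext1 i; simp [radialField, const_single, Pi.single_apply]
    rw [e, map_sum, LinearMap.sum_apply]
    simp only [map_smul, LinearMap.smul_apply, bil_const]
    rw [radial, sum_apply_vec]
    rfl
  constructor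
  · intro h v
    refine eq_zero_of_linear (by simp) (by simp) (fun b => ?_) v
    rw [← key, h]; rfl
  · intro h
    ext1 v
    have e : v = ![v 0] := by ext i; fin_cases i; rfl
    rw [e, key, h]; rfl

end LogForms

end

noncomputable section
namespace LogForms
open MvPolynomial

/-! ### Logarithmic forms -/

/-- `∑_{s, t ∈ T} l_{st} (∏_{r ∈ T ∖ {s, t}} F_r) dF_s ⊗ dF_t`. -/
def logBil {n m : ℕ} (l : Fin m → Fin m → ℂ) (F : Fin m → Poly n) (T : Finset (Fin m)) : Bil n :=
  ∑ s ∈ T, ∑ t ∈ T, (C (l s t) * ∏ r ∈ T \ {s, t}, F r) • (diff (F s)).smulRight (diff (F t))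

theorem logBil_apply {n m : ℕ} (l : Fin m → Fin m → ℂ) (F : Fin m → Poly n) (T : Finset (Fin m))
    (v w : VF n) : logBil l F T v w =
      ∑ s ∈ T, ∑ t ∈ T, C (l s t) * (∏ r ∈ T \ {s, t}, F r) * along v (F s) * along w (F t) := by
  simp [logBil, LinearMap.sum_apply, mul_assoc]

theorem sum_antisymm_eq_zero {ι R : Type} [CommRing R] [CharZero R] [IsDomain R]
    (T : Finset ι) (f : ι → ι → R) (h : ∀ s t, f t s = - f s t) : ∑ s ∈ T, ∑ t ∈ T, f s t = 0 := by
  have : ∑ s ∈ T, ∑ t ∈ T, f s t = - ∑ s ∈ T, ∑ t ∈ T, f s t := by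
    conv_lhs => rw [Finset.sum_comm]
    simp only [← Finset.sum_neg_distrib, ← h]
  exact self_eq_neg.mp this

theorem sum_lt_eq_sum {m : ℕ} {M : Type} [AddCommMonoid M] (f : Fin m → Fin m → M)
    (h : ∀ i, f i i = 0) :
    ∑ i, ∑ j, (if i < j then f i j + f j i else 0) = ∑ i, ∑ j, f i j := by
  have e : ∑ i, ∑ j, (if i < j then f i j + f j i else 0) =
      ∑ i, ∑ j, (if i < j then f i j else 0) + ∑ i, ∑ j, (if j < i then f i j else 0) := by
    rw [Finset.sum_comm (f := fun i j => if j < i then f i j else 0), ← Finset.sum_add_distrib]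
    refine Finset.sum_congr rfl fun i _ => ?_
    rw [← Finset.sum_add_distrib]
    refine Finset.sum_congr rfl fun j _ => ?_
    split_ifs <;> simp
  rw [e, ← Finset.sum_add_distrib]
  refine Finset.sum_congr rfl fun i _ => ?_
  rw [← Finset.sum_add_distrib]
  refine Finset.sum_congr rfl fun j _ => ?_
  rcases lt_trichotomy i j with h' | rfl | h'
  · simp [h', h'.not_gt]
  · simp [h]
  · simp [h', h'.not_gt]

/-- The Hessian of `f` on a pair of vector fields. -/
def hess {n : ℕ} (f : Poly n) (u v : VF n) : Poly n :=
  along u (along v f) - along (transport u v) f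

theorem hess_comm {n : ℕ} (f : Poly n) (u v : VF n) : hess f u v = hess f v u :=
  along_along u v f

theorem nab_logBil {n m : ℕ} (l : Fin m → Fin m → ℂ) (F : Fin m → Poly n) (T : Finset (Fin m))
    (u v w : VF n) : nab (logBil l F T) u v w =
      ∑ s ∈ T, ∑ t ∈ T, (C (l s t) * along u (∏ r ∈ T \ {s, t}, F r) * along v (F s) * along w (F t)
        + C (l s t) * (∏ r ∈ T \ {s, t}, F r) *
          (hess (F s) u v * along w (F t) + along v (F s) * hess (F t) u w)) := by
  simp only [nab, logBil_apply, map_sum, ← Finset.sum_sub_distrib]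
  refine Finset.sum_congr rfl fun s _ => Finset.sum_congr rfl fun t _ => ?_
  simp only [Derivation.leibniz, smul_eq_mul, derivation_C, hess]
  ring

/-- The exterior derivative of a logarithmic form. -/
theorem extB_logBil {n m : ℕ} {l : Fin m → Fin m → ℂ} (hl : ∀ s t, l t s = - l s t)
    (F : Fin m → Poly n) (T : Finset (Fin m)) (u v w : VF n) : extB (logBil l F T) u v w =
      ∑ s ∈ T, ∑ t ∈ T, C (l s t) * (
        along u (∏ r ∈ T \ {s, t}, F r) * along v (F s) * along w (F t)
        - along v (∏ r ∈ T \ {s, t}, F r) * along u (F s) * along w (F t)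
        + along w (∏ r ∈ T \ {s, t}, F r) * along u (F s) * along v (F t)) := by
  -- These are the second-derivative terms left over after the alternation: the Hessian is symmetric
  -- and l antisymmetric.
  have h0 : ∑ s ∈ T, ∑ t ∈ T, C (l s t) * (∏ r ∈ T \ {s, t}, F r) *
      (along v (F s) * hess (F t) u w + hess (F s) u w * along v (F t)) = 0 := by
    refine sum_antisymm_eq_zero T _ fun s t => ?_
    rw [hl s t, Finset.pair_comm t s, C_neg]
    ring
  rw [← add_zero (∑ s ∈ T, ∑ t ∈ T, C (l s t) * _), ← h0]
  simp only [extB, nab_logBil, ← Finset.sum_sub_distrib, ← Finset.sum_add_distrib]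
  refine Finset.sum_congr rfl fun s _ => Finset.sum_congr rfl fun t _ => ?_
  rw [hess_comm (F s) v u, hess_comm (F s) w u, hess_comm (F t) w v]
  ring

section kill
variable {n m : ℕ} {l : Fin m → Fin m → ℂ} {F : Fin m → Poly n} {T : Finset (Fin m)} {a : Fin m}

theorem prod_sdiff_pair_eq_mul (haT : a ∈ T) {s t : Fin m} (hs : s ≠ a) (ht : t ≠ a) :
    ∏ r ∈ T \ {s, t}, F r = F a * ∏ r ∈ T.erase a \ {s, t}, F r := by
  rw [Finset.erase_sdiff_comm, Finset.mul_prod_erase]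
  simp [haT, hs.symm, ht.symm]

/-- Terms containing dF_a die on fields killing F_a, and every other term carries the factor F_a.
The quotient is the logarithmic form of the remaining hypersurfaces. -/
theorem logBil_eq_mul (haT : a ∈ T) {v w : VF n} (hv : along v (F a) = 0)
    (hw : along w (F a) = 0) : logBil l F T v w = F a * logBil l F (T.erase a) v w := by
  rw [logBil_apply, logBil_apply, ← Finset.sum_erase T (a := a) (by simp [hv]), Finset.mul_sum]
  refine Finset.sum_congr rfl fun s hs => ?_
  rw [← Finset.sum_erase T (a := a) (by simp [hw]), Finset.mul_sum]
  refine Finset.sum_congr rfl fun t ht => ?_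
  rw [prod_sdiff_pair_eq_mul haT (Finset.ne_of_mem_erase hs) (Finset.ne_of_mem_erase ht)]
  ring

theorem extB_logBil_eq_mul (hl : ∀ s t, l t s = - l s t) (haT : a ∈ T) {u v w : VF n}
    (hu : along u (F a) = 0) (hv : along v (F a) = 0) (hw : along w (F a) = 0) :
    extB (logBil l F T) u v w = F a * extB (logBil l F (T.erase a)) u v w := by
  rw [extB_logBil hl, extB_logBil hl, ← Finset.sum_erase T (a := a) (by simp [hu, hv]),
    Finset.mul_sum]
  refine Finset.sum_congr rfl fun s hs => ?_
  rw [← Finset.sum_erase T (a := a) (by simp [hv, hw]), Finset.mul_sum]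
  refine Finset.sum_congr rfl fun t ht => ?_
  rw [prod_sdiff_pair_eq_mul haT (Finset.ne_of_mem_erase hs) (Finset.ne_of_mem_erase ht)]
  simp only [Derivation.leibniz, smul_eq_mul, hu, hv, hw]
  ring
end kill

/-! ### Reduction modulo the ideals of the strata -/

/-- The ideal generated by the `F_i`, `i ∈ A`. -/
def stratum {n m : ℕ} (F : Fin m → Poly n) (A : Finset (Fin m)) : Ideal (Poly n) :=
  Ideal.span (F '' A)

section stratum
variable {n m : ℕ} {l : Fin m → Fin m → ℂ} {F : Fin m → Poly n} {T A B : Finset (Fin m)}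

theorem mem_stratum {a : Fin m} (h : a ∈ A) : F a ∈ stratum F A :=
  Ideal.subset_span ⟨a, h, rfl⟩

theorem stratum_mono (h : A ⊆ B) : stratum F A ≤ stratum F B :=
  Ideal.span_mono (Set.image_mono (by simpa using h))

theorem mem_stratum_insert {a : Fin m} {x : Poly n} :
    x ∈ stratum F (insert a A) ↔ ∃ c, x - c * F a ∈ stratum F A := by
  rw [stratum, Finset.coe_insert, Set.image_insert_eq, Ideal.mem_span_insert']
  constructor
  · rintro ⟨c, hc⟩
    exact ⟨-c, by rw [stratum]; convert hc using 1; ring⟩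
  · rintro ⟨c, hc⟩
    exact ⟨-c, by rw [stratum] at hc; convert hc using 1; ring⟩

theorem sum_sub_sum_mem {J : Ideal (Poly n)} (hAT : A ⊆ T) (f : Fin m → Fin m → Poly n)
    (h : ∀ s t, s ∉ A ∨ t ∉ A → f s t ∈ J) :
    ∑ s ∈ T, ∑ t ∈ T, f s t - ∑ s ∈ A, ∑ t ∈ A, f s t ∈ J := by
  rw [← Finset.sum_sdiff hAT, add_sub_assoc, ← Finset.sum_sub_distrib]
  refine J.add_mem (J.sum_mem fun s hs => J.sum_mem fun t _ => h s t (.inl ?_))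
    (J.sum_mem fun s _ => ?_)
  · exact (Finset.mem_sdiff.mp hs).2
  · rw [← Finset.sum_sdiff hAT, add_sub_cancel_right]
    exact J.sum_mem fun t ht => h s t (.inr (Finset.mem_sdiff.mp ht).2)

theorem prod_mem_stratum {s t : Fin m} (hAT : A ⊆ T) {a : Fin m} (ha : a ∈ A) (hs : a ≠ s)
    (ht : a ≠ t) : ∏ r ∈ T \ {s, t}, F r ∈ stratum F A := by
  rw [prod_sdiff_pair_eq_mul (hAT ha) hs.symm ht.symm]
  exact Ideal.mul_mem_right _ _ (mem_stratum ha)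

/-- Modulo (F_i, F_j) only the products omitting both F_i and F_j survive, namely those of the pairs
(i, j) and (j, i). -/
theorem logBil_sub_mem (hl : ∀ s t, l t s = - l s t) {i j : Fin m} (hij : i ≠ j)
    (hi : i ∈ T) (hj : j ∈ T) (v w : VF n) :
    logBil l F T v w - C (l i j) * (∏ r ∈ T \ {i, j}, F r) *
      (along v (F i) * along w (F j) - along v (F j) * along w (F i)) ∈ stratum F {i, j} := by
  have hAT : ({i, j} : Finset (Fin m)) ⊆ T := by
    intro x hx; simp at hx; rcases hx with rfl | rfl <;> assumption
  have hd : ∀ s, l s s = 0 := fun s => self_eq_neg.mp (hl s s)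
  have key := sum_sub_sum_mem (J := stratum F {i, j}) hAT (fun s t =>
    C (l s t) * (∏ r ∈ T \ {s, t}, F r) * along v (F s) * along w (F t)) (fun s t h => by
      have : ∏ r ∈ T \ {s, t}, F r ∈ stratum F {i, j} := by
        have : ∃ a ∈ ({i, j} : Finset (Fin m)), a ≠ s ∧ a ≠ t := by
          simp only [Finset.mem_insert, Finset.mem_singleton, exists_eq_or_imp,
            exists_eq_left] at h ⊢
          grind
        obtain ⟨a, ha, h1, h2⟩ := this
        exact prod_mem_stratum hAT ha h1 h2
      exact Ideal.mul_mem_right _ _ (Ideal.mul_mem_right _ _ (Ideal.mul_mem_left _ _ this)))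
  rw [logBil_apply]
  convert key using 2
  rw [Finset.sum_pair hij, Finset.sum_pair hij, Finset.sum_pair hij, hd, hd, hl i j,
    Finset.pair_comm j i]
  simp only [C_0, C_neg]
  ring

theorem along_prod_mem_stratum {s t a b : Fin m} (hAT : A ⊆ T) (ha : a ∈ A) (hb : b ∈ A)
    (hab : a ≠ b) (hs : a ≠ s) (ht : a ≠ t) (hs' : b ≠ s) (ht' : b ≠ t) (u : VF n) :
    along u (∏ r ∈ T \ {s, t}, F r) ∈ stratum F A := by
  rw [prod_sdiff_pair_eq_mul (hAT ha) hs.symm ht.symm,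
    prod_sdiff_pair_eq_mul (Finset.mem_erase.mpr ⟨hab.symm, hAT hb⟩) hs'.symm ht'.symm,
    Derivation.leibniz, Derivation.leibniz]
  simp only [smul_eq_mul]
  have h1 : F a ∈ stratum F A := mem_stratum ha
  have h2 : F b ∈ stratum F A := mem_stratum hb
  refine Ideal.add_mem _ (Ideal.mul_mem_right _ _ h1) ?_
  exact Ideal.mul_mem_right _ _ (Ideal.mul_mem_right _ _ h2)

theorem along_mul_sub_mem {J : Ideal (Poly n)} {f g : Poly n} (hf : f ∈ J) (u : VF n) :
    along u (f * g) - along u f * g ∈ J := by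
  rw [Derivation.leibniz, smul_eq_mul, smul_eq_mul, mul_comm g, add_sub_cancel_right]
  exact J.mul_mem_right _ hf

theorem along_prod_sub_mem {s t r : Fin m} (hAT : {r, s, t} ⊆ T) (hs : s ≠ r) (ht : t ≠ r)
    (u : VF n) :
    along u (∏ q ∈ T \ {s, t}, F q) - along u (F r) * ∏ q ∈ T \ {r, s, t}, F q ∈
      stratum F {r, s, t} := by
  rw [prod_sdiff_pair_eq_mul (a := r) (hAT (by simp)) hs ht]
  have e : T.erase r \ {s, t} = T \ {r, s, t} := by ext x; simp; tauto
  rw [e]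
  exact along_mul_sub_mem (mem_stratum (by simp)) u

/-- A differentiated product stays in the ideal if it contains two of F_i, F_j, F_k. So only pairs
inside {i, j, k} count, with the derivative falling on the third factor; the three pairs give the
three summands of the coefficient. -/
theorem extB_logBil_sub_mem (hl : ∀ s t, l t s = - l s t) {i j k : Fin m} (hij : i ≠ j)
    (hik : i ≠ k) (hjk : j ≠ k) (hAT : {i, j, k} ⊆ T) (u v w : VF n) :
    extB (logBil l F T) u v w - C (l i j - l i k + l j k) * (∏ r ∈ T \ {i, j, k}, F r) *
      (along u (F i) * (along v (F j) * along w (F k) - along v (F k) * along w (F j))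
      - along u (F j) * (along v (F i) * along w (F k) - along v (F k) * along w (F i))
      + along u (F k) * (along v (F i) * along w (F j) - along v (F j) * along w (F i))) ∈
        stratum F {i, j, k} := by
  have hd : ∀ s, l s s = 0 := fun s => self_eq_neg.mp (hl s s)
  have key := sum_sub_sum_mem (J := stratum F {i, j, k}) hAT (fun s t =>
    C (l s t) * (
        along u (∏ r ∈ T \ {s, t}, F r) * along v (F s) * along w (F t)
        - along v (∏ r ∈ T \ {s, t}, F r) * along u (F s) * along w (F t)
        + along w (∏ r ∈ T \ {s, t}, F r) * along u (F s) * along v (F t))) (fun s t h => by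
      have : ∀ u : VF n, along u (∏ r ∈ T \ {s, t}, F r) ∈ stratum F {i, j, k} := by
        have : ∃ a ∈ ({i, j, k} : Finset (Fin m)), ∃ b ∈ ({i, j, k} : Finset (Fin m)),
            a ≠ b ∧ a ≠ s ∧ a ≠ t ∧ b ≠ s ∧ b ≠ t := by
          simp only [Finset.mem_insert, Finset.mem_singleton, exists_eq_or_imp,
            exists_eq_left] at h ⊢
          grind
        obtain ⟨a, ha, b, hb, h1, h2, h3, h4, h5⟩ := this
        exact fun u => along_prod_mem_stratum hAT ha hb h1 h2 h3 h4 h5 u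
      refine Ideal.mul_mem_left _ _ (Ideal.add_mem _ (Ideal.sub_mem _ ?_ ?_) ?_) <;>
      exact Ideal.mul_mem_right _ _ (Ideal.mul_mem_right _ _ (this _)))
  rw [extB_logBil hl]
  have hi := fun u => along_prod_sub_mem (F := F) hAT hij.symm hik.symm u
  have hj := fun u => along_prod_sub_mem (F := F) (T := T) (s := i) (t := k) (r := j)
    (by rw [Finset.insert_comm]; exact hAT) hij hjk.symm u
  have hk := fun u => along_prod_sub_mem (F := F) (T := T) (s := i) (t := j) (r := k)
    (by rw [Finset.insert_comm, Finset.pair_comm k j]; exact hAT) hik hjk u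
  rw [Finset.insert_comm j i] at hj
  rw [Finset.insert_comm k i, Finset.pair_comm k j] at hk
  rw [← Ideal.Quotient.eq_zero_iff_mem, map_sub, sub_eq_zero] at key ⊢
  refine key.trans ?_
  simp only [← Ideal.Quotient.eq_zero_iff_mem, map_sub, map_mul, sub_eq_zero] at hi hj hk
  have hnot1 : i ∉ ({j, k} : Finset (Fin m)) := by simp [hij, hik]
  simp only [Finset.sum_insert hnot1, Finset.sum_pair hjk, hd, hl i j, hl i k, hl j k,
    Finset.pair_comm j i, Finset.pair_comm k i, Finset.pair_comm k j, map_add, map_mul, map_sub,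
    map_neg, map_zero, hi, hj, hk]
  ring

end stratum

end LogForms

end

noncomputable section
namespace LogForms
open MvPolynomial

/-! ### Logarithmic forms are tangent -/

/-- The coordinates of the exterior product of two bivectors. -/
def wedgeCoord {m : ℕ} {R : Type} [CommRing R] (l l' : Fin m → Fin m → R) (s t p q : Fin m) : R :=
  l s t * l' p q - l s p * l' t q + l s q * l' t p + l t p * l' s q - l t q * l' s p + l p q * l' s t

theorem eq_zero_of_linear_pi {ι R : Type} [Finite ι] [DecidableEq ι] [CommRing R] {f : (ι → R) → R}
    (hadd : ∀ v w, f (v + w) = f v + f w) (hsmul : ∀ (c : R) v, f (c • v) = c * f v)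
    (h : ∀ a, f (Pi.single a 1) = 0) (v : ι → R) : f v = 0 := by
  let g : (ι → R) →ₗ[R] R := ⟨⟨f, hadd⟩, hsmul⟩
  have : g = 0 := by
    refine LinearMap.pi_ext' fun a => LinearMap.ext_ring ?_
    simpa [g] using h a
  exact LinearMap.congr_fun this v

theorem wedge_bilinear_eq_zero {m : ℕ} {R : Type} [CommRing R]
    (B B' : (Fin m → R) →ₗ[R] (Fin m → R) →ₗ[R] R)
    (h : ∀ s t p q, wedgeCoord (fun s t => B (Pi.single s 1) (Pi.single t 1))
      (fun s t => B' (Pi.single s 1) (Pi.single t 1)) s t p q = 0) (a b c e : Fin m → R) :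
    B a b * B' c e - B a c * B' b e + B a e * B' b c + B b c * B' a e - B b e * B' a c
      + B c e * B' a b = 0 := by
  revert a
  refine eq_zero_of_linear_pi (fun v w => by simp only [map_add, LinearMap.add_apply]; ring)
    (fun c v => by simp only [map_smul, LinearMap.smul_apply, smul_eq_mul]; ring) fun s => ?_
  revert b
  refine eq_zero_of_linear_pi (fun v w => by simp only [map_add, LinearMap.add_apply]; ring)
    (fun c v => by simp only [map_smul, LinearMap.smul_apply, smul_eq_mul]; ring) fun t => ?_
  revert c
  refine eq_zero_of_linear_pi (fun v w => by simp only [map_add, LinearMap.add_apply]; ring)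
    (fun c v => by simp only [map_smul, LinearMap.smul_apply, smul_eq_mul]; ring) fun p => ?_
  revert e
  refine eq_zero_of_linear_pi (fun v w => by simp only [map_add]; ring)
    (fun c v => by simp only [map_smul, smul_eq_mul]; ring) fun q => ?_
  exact h s t p q

section tangent
variable {n m : ℕ} {l l' : Fin m → Fin m → ℂ} (F : Fin m → Poly n)

/-- The bilinear form with coefficients `l`. -/
def constBil (n : ℕ) (l : Fin m → Fin m → ℂ) :
    (Fin m → Poly n) →ₗ[Poly n] (Fin m → Poly n) →ₗ[Poly n] Poly n :=
  Matrix.toLinearMap₂' (Poly n) (Matrix.of fun s t => C (l s t))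

theorem constBil_apply (l : Fin m → Fin m → ℂ) (a b : Fin m → Poly n) :
    constBil n l a b = ∑ s, ∑ t, C (l s t) * (a s * b t) := by
  simp only [constBil, Matrix.toLinearMap₂'_apply, Matrix.of_apply, smul_eq_mul]
  exact Finset.sum_congr rfl fun s _ => Finset.sum_congr rfl fun t _ => by ring

theorem constBil_single (l : Fin m → Fin m → ℂ) (s t : Fin m) :
    constBil n l (Pi.single s 1) (Pi.single t 1) = C (l s t) := by
  simp [constBil_apply, Pi.single_apply]

/-- `(∏_{r ≠ s} F_r) ∂_v F_s`, the product of `∏ r, F_r` and the logarithmic derivative of `F_s`. -/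
def logDer (v : VF n) (s : Fin m) : Poly n := along v (F s) * ∏ r ∈ Finset.univ.erase s, F r

theorem prod_eq_mul_mul {s t : Fin m} (h : s ≠ t) :
    ∏ r, F r = F s * (F t * ∏ r ∈ Finset.univ \ {s, t}, F r) := by
  have e : Finset.univ \ {s, t} = (Finset.univ.erase s).erase t := by ext; simp; tauto
  rw [e, Finset.mul_prod_erase _ _ (by simp [h.symm]), Finset.mul_prod_erase _ _ (by simp)]

theorem logDer_left {s t : Fin m} (h : s ≠ t) (v : VF n) :
    logDer F v s = along v (F s) * (F t * ∏ r ∈ Finset.univ \ {s, t}, F r) := by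
  have e : Finset.univ \ {s, t} = (Finset.univ.erase s).erase t := by ext; simp; tauto
  rw [e, Finset.mul_prod_erase _ _ (by simp [h.symm]), logDer]

/-- This is F ω = Σ l_st (F dF_s/F_s)(F dF_t/F_t) cleared of denominators: a form with constant
coefficients in the vectors `logDer`. -/
theorem prod_mul_logBil (hl : ∀ s t, l t s = - l s t) (v w : VF n) :
    (∏ r, F r) * logBil l F Finset.univ v w = constBil n l (logDer F v) (logDer F w) := by
  have hd : ∀ s, l s s = 0 := fun s => self_eq_neg.mp (hl s s)
  rw [logBil_apply, constBil_apply, Finset.mul_sum]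
  refine Finset.sum_congr rfl fun s _ => ?_
  rw [Finset.mul_sum]
  refine Finset.sum_congr rfl fun t _ => ?_
  by_cases h : s = t
  · subst h; simp [hd]
  · have h2 := logDer_left F (Ne.symm h) w
    rw [Finset.pair_comm t s] at h2
    rw [prod_eq_mul_mul F h, logDer_left F h, h2]
    ring

/-- This is F dω = dF ∧ ω, the closedness of ω/F, multiplied once more by F. -/
theorem prod_sq_mul_extB (hl : ∀ s t, l t s = - l s t) (u v w : VF n) :
    (∏ r, F r) ^ 2 * extB (logBil l F Finset.univ) u v w =
      along u (∏ r, F r) * constBil n l (logDer F v) (logDer F w)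
      - along v (∏ r, F r) * constBil n l (logDer F u) (logDer F w)
      + along w (∏ r, F r) * constBil n l (logDer F u) (logDer F v) := by
  have hd : ∀ s, l s s = 0 := fun s => self_eq_neg.mp (hl s s)
  -- dF also contains the derivatives of F_s and F_t, which are absent from dF̂_st. Their
  -- contribution is this sum, antisymmetric in (s, t).
  have h0 : ∑ s, ∑ t, C (l s t) *
      (logDer F u t * logDer F v s * logDer F w t + logDer F u s * logDer F v t * logDer F w s)
      = 0 := by
    refine sum_antisymm_eq_zero _ _ fun s t => ?_
    rw [hl s t, C_neg]
    ring
  rw [extB_logBil hl, constBil_apply, constBil_apply, constBil_apply]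
  simp only [Finset.mul_sum]
  rw [← sub_zero (∑ s, ∑ t, _ - _ + _), ← h0]
  simp only [← Finset.sum_sub_distrib, ← Finset.sum_add_distrib]
  refine Finset.sum_congr rfl fun s _ => Finset.sum_congr rfl fun t _ => ?_
  by_cases h : s = t
  · subst h; simp [hd]
  · have h2 (w : VF n) := logDer_left F (Ne.symm h) w
    rw [Finset.pair_comm t s] at h2
    simp only [prod_eq_mul_mul F h, logDer_left F h, h2, Derivation.leibniz, smul_eq_mul]
    ring

/-- After multiplication by a power of F, the first equation is λ ∧ λ' = 0 evaluated on logarithmic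
derivatives. Since dω = (dF/F) ∧ ω for both forms, the second is a combination of the first with
coefficients the derivatives of F. -/
theorem isTangent_logBil (hl : ∀ s t, l t s = - l s t) (hl' : ∀ s t, l' t s = - l' s t)
    (hF : ∏ r, F r ≠ 0) (h : ∀ s t p q, wedgeCoord l l' s t p q = 0) :
    IsTangent (logBil l F Finset.univ) (logBil l' F Finset.univ) := by
  have key (a b c e : VF n) := wedge_bilinear_eq_zero (constBil n l) (constBil n l')
    (fun s t p q => by
      have := congrArg (C (σ := Fin (n + 1))) (h s t p q)
      simpa [constBil_single, wedgeCoord] using this)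
    (logDer F a) (logDer F b) (logDer F c) (logDer F e)
  constructor
  · intro v₀ v₁ v₂ v₃
    refine (mul_right_injective₀ (pow_ne_zero 2 hF)) ?_
    dsimp only [wedgeB]
    have k := key v₀ v₁ v₂ v₃
    simp only [← prod_mul_logBil F hl, ← prod_mul_logBil F hl'] at k
    linear_combination k
  · intro v u₀ u₁ u₂ u₃
    refine (mul_right_injective₀ (pow_ne_zero 3 hF)) ?_
    dsimp only [wedgeD]
    have e (a b c : VF n) := prod_sq_mul_extB F hl a b c
    have e' (a b c : VF n) := prod_sq_mul_extB F hl' a b c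
    have p (a b : VF n) := prod_mul_logBil F hl a b
    have p' (a b : VF n) := prod_mul_logBil F hl' a b
    have r (A A' : Bil n) (x y a b c : VF n) : (∏ r, F r) ^ 3 * (A x y * extB A' a b c) =
      ((∏ r, F r) * A x y) * ((∏ r, F r) ^ 2 * extB A' a b c) := by ring
    simp only [mul_add, mul_sub, r, e, e', p, p']
    have k0 := key v u₁ u₂ u₃
    have k1 := key v u₀ u₂ u₃
    have k2 := key v u₀ u₁ u₃
    have k3 := key v u₀ u₁ u₂
    linear_combination (along u₀ (∏ r, F r)) * k0 * (-1) + (along u₁ (∏ r, F r)) * k1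
      - (along u₂ (∏ r, F r)) * k2 + (along u₃ (∏ r, F r)) * k3
end tangent

end LogForms

end

/-! ### The natural parametrization: tangency, degree and radial contraction -/

noncomputable section
namespace LogForms
open MvPolynomial

theorem dPoly_apply {n : ℕ} (F : Poly n) (a : Fin (n + 1)) :
    dPoly F ![Pi.single a 1] = pderiv a F := by
  simp [dPoly, oneForm, Fintype.linearCombination_apply, Pi.single_apply]

theorem oneForm_apply {m : ℕ} (μ : Fin m → ℂ) (s : Fin m) :
    oneForm μ ![Pi.single s 1] = μ s := by
  simp [oneForm, Fintype.linearCombination_apply, Pi.single_apply]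

theorem coord_swap {m : ℕ} (lam : Alt (Fin m) ℂ 2) (s t : Fin m) :
    coord lam t s = - coord lam s t := swap_two lam _ _

theorem coord_wedge {m : ℕ} (μ ν : Fin m → ℂ) (s t : Fin m) :
    coord (wedge (oneForm μ) (oneForm ν)) s t = μ s * ν t - μ t * ν s := by
  rw [coord]
  refine (wedge_one_one _ _ _ _).trans ?_
  simp only [oneForm_apply]

theorem bil_logTerm {n m : ℕ} (i j : Fin m) (F : Fin m → Poly n) (v w : VF n) :
    bil (logTerm i j F) v w = (∏ k ∈ Finset.univ \ {i, j}, F k) *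
      (along v (F i) * along w (F j) - along v (F j) * along w (F i)) := by
  have h : ∀ a b, bil (logTerm i j F) (Pi.single a 1) (Pi.single b 1) =
      (∏ k ∈ Finset.univ \ {i, j}, F k) *
        (pderiv a (F i) * pderiv b (F j) - pderiv a (F j) * pderiv b (F i)) := by
    intro a b
    rw [bil_single, logTerm, Finset.compl_eq_univ_sdiff, AlternatingMap.smul_apply, smul_eq_mul,
      wedge_one_one]
    simp only [dPoly_apply]
    ring
  rw [← sub_eq_zero]
  revert v
  refine eq_zero_of_linear_pi ?_ ?_ ?_
  · intro v v'; simp only [map_add, LinearMap.add_apply, Derivation.add_apply]; ring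
  · intro c v; simp only [map_smul, LinearMap.smul_apply, Derivation.smul_apply, smul_eq_mul]; ring
  intro a
  revert w
  refine eq_zero_of_linear_pi ?_ ?_ ?_
  · intro v v'; simp only [map_add, Derivation.add_apply]; ring
  · intro c v; simp only [map_smul, Derivation.smul_apply, smul_eq_mul]; ring
  intro b
  rw [h]
  simp only [along_single]
  ring

theorem bil_phi {n m : ℕ} (d : Fin m → ℕ) (lam : Alt (Fin m) ℂ 2) (F : ∀ i, HomPoly n (d i)) :
    bil (phi d lam F) = logBil (coord lam) (fun i => (F i : Poly n)) Finset.univ := by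
  refine LinearMap.ext fun v => LinearMap.ext fun w => ?_
  rw [logBil_apply, ← sum_lt_eq_sum]
  · change bil (∑ i, ∑ j, if i < j then
      coord lam i j • logTerm i j (fun k => (F k : Poly n)) else 0) v w = _
    simp only [map_sum, LinearMap.sum_apply]
    refine Finset.sum_congr rfl fun i _ => Finset.sum_congr rfl fun j _ => ?_
    split_ifs
    · rw [map_smul, LinearMap.smul_apply, LinearMap.smul_apply, bil_logTerm, coord_swap lam i j,
        Finset.pair_comm j i, smul_eq_C_mul, C_neg]
      ring
    · simp
  · intro i
    have : coord lam i i = 0 := self_eq_neg.mp (coord_swap lam i i)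
    simp [this]

theorem isTangent_phi {n m : ℕ} (d : Fin m → ℕ) {lam lam' : Alt (Fin m) ℂ 2}
    (h : ∀ s t p q, wedgeCoord (coord lam) (coord lam') s t p q = 0)
    (F : ∀ i, HomPoly n (d i)) : IsTangent (bil (phi d lam F)) (bil (phi d lam' F)) := by
  -- The F_i are arbitrary here, since the lemma is later applied after replacing one of them by any
  -- polynomial; division by ∏ F_r needs the zero case apart.
  by_cases hF : ∏ r, (F r : Poly n) = 0
  · obtain ⟨i, -, hi⟩ := Finset.prod_eq_zero_iff.mp hF
    have hi : F i = 0 := Subtype.ext hi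
    rw [MultilinearMap.map_coord_zero _ i hi, MultilinearMap.map_coord_zero _ i hi, map_zero]
    exact isTangent_zero _
  · rw [bil_phi, bil_phi]
    exact isTangent_logBil _ (coord_swap lam) (coord_swap lam') hF h

/-- Polarization: the quadratic equations hold at F, at F with F_i replaced by x, and at F with F_i
replaced by F_i + x. By multilinearity of φ, subtracting the first two from the third leaves twice
the linearized equations. -/
theorem isTangent_phi_update {n m : ℕ} (d : Fin m → ℕ) {lam : Alt (Fin m) ℂ 2}
    (h : ∀ s t p q, wedgeCoord (coord lam) (coord lam) s t p q = 0)
    (F : ∀ i, HomPoly n (d i)) (i : Fin m) (x : HomPoly n (d i)) :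
    IsTangent (bil (phi d lam F)) (bil (phi d lam (Function.update F i x))) := by
  have h1 := isTangent_phi d h F
  have h2 := isTangent_phi d h (Function.update F i x)
  have h3 := isTangent_phi d h (Function.update F i (F i + x))
  rw [MultilinearMap.map_update_add, Function.update_eq_self, map_add] at h3
  constructor
  · intro v₀ v₁ v₂ v₃
    have e1 := h1.wedge_eq v₀ v₁ v₂ v₃
    have e2 := h2.wedge_eq v₀ v₁ v₂ v₃
    have e3 := h3.wedge_eq v₀ v₁ v₂ v₃
    simp only [wedgeB, LinearMap.add_apply] at *
    refine (mul_right_injective₀ (two_ne_zero (α := Poly n))) ?_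
    dsimp only
    linear_combination e3 - e1 - e2
  · intro v u₀ u₁ u₂ u₃
    have e1 := h1.wedgeD_eq v u₀ u₁ u₂ u₃
    have e2 := h2.wedgeD_eq v u₀ u₁ u₂ u₃
    have e3 := h3.wedgeD_eq v u₀ u₁ u₂ u₃
    simp only [wedgeD, LinearMap.add_apply, extB_add] at *
    refine (mul_right_injective₀ (two_ne_zero (α := Poly n))) ?_
    dsimp only
    linear_combination e3 - e1 - e2

theorem along_radialField {n e : ℕ} {F : Poly n} (h : F.IsHomogeneous e) :
    along (radialField n) F = C (e : ℂ) * F := by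
  rw [along_apply]
  have := h.sum_X_mul_pderiv
  simpa [radialField, nsmul_eq_mul] using this

/-- Euler's identity turns dF_s(R) into d_s F_s, which restores the missing factor F_s of F̂_st. -/
theorem logBil_radialField {n m : ℕ} {d : Fin m → ℕ} {l : Fin m → Fin m → ℂ}
    (hl : ∀ s t, l t s = - l s t) (F : ∀ i, HomPoly n (d i)) (v : VF n) :
    logBil l (fun i => (F i : Poly n)) Finset.univ (radialField n) v =
      ∑ t, C (∑ s, d s * l s t) * logDer (fun i => (F i : Poly n)) v t := by
  rw [logBil_apply, Finset.sum_comm]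
  refine Finset.sum_congr rfl fun t _ => ?_
  rw [map_sum, Finset.sum_mul]
  refine Finset.sum_congr rfl fun s _ => ?_
  by_cases h : s = t
  · have hd : l t t = 0 := self_eq_neg.mp (hl t t)
    subst h; simp [hd]
  · rw [along_radialField (F s).2, logDer_left _ (Ne.symm h), Finset.pair_comm t s, C_mul]
    ring

theorem isHomogeneous_along_const {n e : ℕ} {F : Poly n} (h : F.IsHomogeneous e)
    (v : Fin (n + 1) → ℂ) : (along (const v) F).IsHomogeneous (e - 1) := by
  rw [along_apply]
  exact IsHomogeneous.sum _ _ _ fun i _ => h.pderiv.C_mul _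

theorem isHomogeneous_logTerm {n m : ℕ} {d : Fin m → ℕ} (hd : ∀ i, 0 < d i) {F : Fin m → Poly n}
    (hF : ∀ i, (F i).IsHomogeneous (d i)) {s t : Fin m} (h : s ≠ t) (v w : Fin (n + 1) → ℂ) :
    ((∏ k ∈ Finset.univ \ {s, t}, F k) * along (const v) (F s) *
      along (const w) (F t)).IsHomogeneous (∑ i, d i - 2) := by
  have h1 := ((IsHomogeneous.prod (Finset.univ \ {s, t}) F d fun i _ => hF i).mul
    (isHomogeneous_along_const (hF s) v)).mul (isHomogeneous_along_const (hF t) w)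
  convert h1 using 1
  have e := Finset.sum_sdiff (f := d) (Finset.subset_univ {s, t})
  rw [Finset.sum_pair h] at e
  have := hd s; have := hd t
  omega

theorem phi_mem_projTwoForms {n m : ℕ} {d : Fin m → ℕ} (hd : ∀ i, 0 < d i)
    {lam : Alt (Fin m) ℂ 2} (hlam : ∀ t, ∑ s, d s * coord lam s t = 0)
    (F : ∀ i, HomPoly n (d i)) : phi d lam F ∈ projTwoForms n (∑ i, d i) := by
  refine ⟨fun v => ?_, radial_eq_zero_iff.mpr fun v => ?_⟩
  · have e : v = ![v 0, v 1] := by ext i; fin_cases i <;> rfl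
    rw [e, ← bil_const, bil_phi, logBil_apply]
    refine IsHomogeneous.sum _ _ _ fun s _ => IsHomogeneous.sum _ _ _ fun t _ => ?_
    by_cases h : s = t
    · have hd : coord lam t t = 0 := self_eq_neg.mp (coord_swap lam t t)
      subst h; simp [hd, isHomogeneous_zero]
    · rw [mul_assoc (C _), mul_assoc (C _)]
      exact (isHomogeneous_logTerm hd (fun i => (F i).2) h _ _).C_mul _
  · rw [bil_phi, logBil_radialField (coord_swap lam)]
    simp [hlam]

theorem sum_mul_coord_of_mem {m : ℕ} {d : Fin m → ℕ} {lam : Alt (Fin m) ℂ 2}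
    (h : lam ∈ wedgeSqPerp d) (t : Fin m) : ∑ s, d s * coord lam s t = 0 := by
  induction h using Submodule.span_induction with
  | mem x hx =>
    obtain ⟨μ, hμ, ν, hν, rfl⟩ := hx
    simp only [perp, LinearMap.mem_ker, Fintype.linearCombination_apply, smul_eq_mul] at hμ hν
    simp only [coord_wedge, mul_sub, Finset.sum_sub_distrib]
    have e1 : ∑ s, (d s : ℂ) * (μ s * ν t) = (∑ s, μ s * d s) * ν t := by
      rw [Finset.sum_mul]; exact Finset.sum_congr rfl fun _ _ => by ring
    have e2 : ∑ s, (d s : ℂ) * (μ t * ν s) = (∑ s, ν s * d s) * μ t := by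
      rw [Finset.sum_mul]; exact Finset.sum_congr rfl fun _ _ => by ring
    rw [e1, e2, hμ, hν]; simp
  | zero => simp [coord]
  | add x y _ _ hx hy =>
    simp only [coord, AlternatingMap.add_apply, mul_add, Finset.sum_add_distrib] at *
    rw [hx, hy, add_zero]
  | smul c x _ hx =>
    have : ∑ s, (d s : ℂ) * coord (c • x) s t = c * ∑ s, d s * coord x s t := by
      rw [Finset.mul_sum]
      exact Finset.sum_congr rfl fun _ _ => by simp [coord]; ring
    rw [this, hx, mul_zero]

theorem wedge_eq_zero_iff {m : ℕ} {a b : Alt (Fin m) ℂ 2} :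
    wedge a b = 0 ↔ ∀ s t p q, wedgeCoord (coord a) (coord b) s t p q = 0 := by
  constructor
  · intro h s t p q
    have := DFunLike.congr_fun h ![Pi.single s 1, Pi.single t 1, Pi.single p 1, Pi.single q 1]
    exact (wedge_two_two _ _ _ _ _ _).symm.trans this
  · intro h
    refine Module.Basis.ext_alternating (Pi.basisFun ℂ (Fin m)) fun v _ => ?_
    have e : (fun i => Pi.basisFun ℂ (Fin m) (v i)) = ![Pi.single (v 0) 1, Pi.single (v 1) 1,
      Pi.single (v 2) 1, Pi.single (v 3) 1] := by
      ext1 i; fin_cases i <;> simp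
    rw [e]
    exact (wedge_two_two _ _ _ _ _ _).trans (h _ _ _ _)

theorem IsGrPoint.wedgeCoord_self {m : ℕ} {d : Fin m → ℕ} {lam : Alt (Fin m) ℂ 2}
    (h : IsGrPoint d lam) (s t p q : Fin m) :
    wedgeCoord (coord lam) (coord lam) s t p q = 0 := by
  obtain ⟨-, μ, -, ν, -, rfl⟩ := h
  simp only [wedgeCoord, coord_wedge]
  ring

theorem IsGrPoint.mem_wedgeSqPerp {m : ℕ} {d : Fin m → ℕ} {lam : Alt (Fin m) ℂ 2}
    (h : IsGrPoint d lam) : lam ∈ wedgeSqPerp d := by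
  obtain ⟨-, μ, hμ, ν, hν, rfl⟩ := h
  exact Submodule.subset_span ⟨μ, hμ, ν, hν, rfl⟩

/-- A bivector whose contraction with `d` vanishes lies in `⋀² ℂ^m_d`. -/
theorem mem_wedgeSqPerp {m : ℕ} {d : Fin m → ℕ} (hd : ∃ i, d i ≠ 0) {c : Alt (Fin m) ℂ 2}
    (hc : ∀ t, ∑ s, d s * coord c s t = 0) : c ∈ wedgeSqPerp d := by
  obtain ⟨o, ho⟩ := hd
  have ho : (d o : ℂ) ≠ 0 := by exact_mod_cast ho
  -- The projection of e_i to ℂ^m_d along e_o. Substituting p_i ∧ p_j for e_i ∧ e_j does not change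
  -- c, since c contracts to zero with d; the factor 1/2 accounts for ordered pairs.
  let p : Fin m → Fin m → ℂ := fun i => Pi.single i 1 - ((d i : ℂ) / d o) • Pi.single o 1
  have hp : ∀ i, p i ∈ perp d := by
    intro i
    rw [perp, LinearMap.mem_ker, map_sub, map_smul, Fintype.linearCombination_apply_single,
      Fintype.linearCombination_apply_single]
    simp; field_simp; simp
  have e : c = ∑ i, ∑ j, (coord c i j / 2) • wedge (oneForm (p i)) (oneForm (p j)) := by
    refine Module.Basis.ext_alternating (Pi.basisFun ℂ (Fin m)) fun v _ => ?_
    have e : (fun i => Pi.basisFun ℂ (Fin m) (v i)) = ![Pi.single (v 0) 1, Pi.single (v 1) 1] := by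
      ext1 i; fin_cases i <;> simp
    rw [e, sum_apply_vec]
    simp only [sum_apply_vec, AlternatingMap.smul_apply]
    change coord c (v 0) (v 1) = ∑ i, ∑ j, (coord c i j / 2) •
      coord (wedge (oneForm (p i)) (oneForm (p j))) (v 0) (v 1)
    simp only [coord_wedge]
    have h1 (x : Fin m) : ∑ i, coord c i x * d i = 0 := by simpa [mul_comm] using hc x
    have h2 (x : Fin m) : ∑ i, coord c x i * d i = 0 := by
      have := h1 x
      simp only [coord_swap c x, neg_mul, Finset.sum_neg_distrib, neg_eq_zero] at this
      exact this
    have h3 (x y : Fin m) : ∑ i, ∑ j, coord c i j * (p i x * p j y) = coord c x y := by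
      have q1 (i : Fin m) : ∑ j, coord c i j * p j y = coord c i y := by
        simp only [p, Pi.sub_apply, Pi.smul_apply, smul_eq_mul, mul_sub, Finset.sum_sub_distrib]
        have : ∑ j, coord c i j * (d j / d o * (Pi.single o (1 : ℂ) : Fin m → ℂ) y) =
          (∑ j, coord c i j * d j) * ((Pi.single o (1 : ℂ) : Fin m → ℂ) y / d o) := by
          rw [Finset.sum_mul]; exact Finset.sum_congr rfl fun _ _ => by ring
        rw [this, h2]; simp [Pi.single_apply]
      have q2 : ∑ i, coord c i y * p i x = coord c x y := by
        simp only [p, Pi.sub_apply, Pi.smul_apply, smul_eq_mul, mul_sub, Finset.sum_sub_distrib]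
        have : ∑ j, coord c j y * (d j / d o * (Pi.single o (1 : ℂ) : Fin m → ℂ) x) =
          (∑ j, coord c j y * d j) * ((Pi.single o (1 : ℂ) : Fin m → ℂ) x / d o) := by
          rw [Finset.sum_mul]; exact Finset.sum_congr rfl fun _ _ => by ring
        rw [this, h1]; simp [Pi.single_apply]
      rw [← q2]
      refine Finset.sum_congr rfl fun i _ => ?_
      rw [← q1 i, Finset.sum_mul]
      exact Finset.sum_congr rfl fun _ _ => by ring
    have h4 : ∑ i, ∑ j, (coord c i j / 2) • (p i (v 0) * p j (v 1) - p i (v 1) * p j (v 0)) =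
      (∑ i, ∑ j, coord c i j * (p i (v 0) * p j (v 1)) -
        ∑ i, ∑ j, coord c i j * (p i (v 1) * p j (v 0))) / 2 := by
      rw [← Finset.sum_sub_distrib, Finset.sum_div]
      refine Finset.sum_congr rfl fun i _ => ?_
      rw [← Finset.sum_sub_distrib, Finset.sum_div]
      exact Finset.sum_congr rfl fun _ _ => by rw [smul_eq_mul]; ring
    rw [h4, h3, h3, coord_swap c (v 0)]
    ring
  rw [e]
  exact Submodule.sum_mem _ fun i _ => Submodule.sum_mem _ fun j _ =>
    Submodule.smul_mem _ _ (Submodule.subset_span ⟨p i, hp i, p j, hp j, rfl⟩)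

end LogForms

end

noncomputable section
namespace LogForms
open MvPolynomial

/-! ### Depth -/

section depth
open CategoryTheory Abelian Pointwise

/-- `f` is a nonzerodivisor modulo `J`. -/
def NzdMod {R : Type} [CommRing R] (J : Ideal R) (f : R) : Prop := ∀ x, f * x ∈ J → x ∈ J

theorem NzdMod.pow {R : Type} [CommRing R] {J : Ideal R} {f : R} (h : NzdMod J f) (k : ℕ) :
    NzdMod J (f ^ k) := by
  induction k with
  | zero => intro x hx; simpa using hx
  | succ k ih => intro x hx; exact ih x (h _ (by rwa [pow_succ', mul_assoc] at hx))

theorem NzdMod.mul {R : Type} [CommRing R] {J : Ideal R} {f g : R} (hf : NzdMod J f)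
    (hg : NzdMod J g) : NzdMod J (f * g) :=
  fun x hx => hg x (hf _ (by rwa [mul_assoc] at hx))

theorem NzdMod.prod {R ι : Type} [CommRing R] {J : Ideal R} {f : ι → R} {T : Finset ι}
    (h : ∀ i ∈ T, NzdMod J (f i)) : NzdMod J (∏ i ∈ T, f i) := by
  classical
  induction T using Finset.induction_on with
  | empty => intro x hx; simpa using hx
  | insert a s ha ih =>
    rw [Finset.prod_insert ha]
    exact (h a (by simp)).mul (ih fun i hi => h i (by simp [hi]))

/-- `m` has depth at least `t` on `R ⧸ J`. -/
def HasDepth {R : Type} [CommRing R] (m : Ideal R) : ℕ → Ideal R → Prop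
  | 0, _ => True
  | t + 1, J => (∃ r ∈ m, NzdMod J r) ∧
      ∀ f ∈ m, NzdMod J f → HasDepth m t (J ⊔ Ideal.span {f})

theorem HasDepth.of_succ {R : Type} [CommRing R] {m : Ideal R} {t : ℕ} :
    ∀ {J : Ideal R}, HasDepth m (t + 1) J → HasDepth m t J := by
  induction t with
  | zero => intros; trivial
  | succ t ih => exact fun h => ⟨h.1, fun f hf hJ => ih (h.2 f hf hJ)⟩

theorem HasDepth.mono {R : Type} [CommRing R] {m : Ideal R} {s t : ℕ} (hst : s ≤ t)
    {J : Ideal R} (h : HasDepth m t J) : HasDepth m s J := by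
  induction hst with
  | refl => exact h
  | step _ ih => exact ih h.of_succ

/-- `HasDepth` allows quotients by any nonzerodivisor in the ideal, and this freedom comes from
vanishing of Ext. Hom(R/m, M) = 0 gives an M-regular element of m. For any M-regular f, the long
exact sequence of 0 → M → M → M/fM → 0 passes the vanishing to M/fM with one degree less. -/
theorem hasDepth_of_ext {R : Type} [CommRing R] [IsNoetherianRing R] (m : Ideal R) :
    ∀ (t : ℕ) (M : ModuleCat.{0} R) [Module.Finite R M] (π : R →ₗ[R] M),
      Function.Surjective π → (∀ i < t, Subsingleton (Ext (ModuleCat.of R (R ⧸ m)) M i)) →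
      HasDepth m t (LinearMap.ker π) := by
  intro t
  induction t with
  | zero => intros; trivial
  | succ t ih =>
    intro M _ π hπ hE
    have hreg : ∀ f, NzdMod (LinearMap.ker π) f ↔ IsSMulRegular M f := by
      intro f
      rw [isSMulRegular_iff_right_eq_zero_of_smul]
      constructor
      · intro h x hx
        obtain ⟨x, rfl⟩ := hπ x
        exact h x (by rw [LinearMap.mem_ker, ← smul_eq_mul, map_smul, hx])
      · intro h x hx
        exact h _ (by rw [LinearMap.mem_ker, ← smul_eq_mul, map_smul] at hx; exact hx)
    constructor
    · have : Subsingleton (ModuleCat.of R (R ⧸ m) ⟶ M) :=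
        Ext.addEquiv₀.subsingleton_congr.mp (hE 0 t.zero_lt_succ)
      have : Subsingleton ((R ⧸ m) →ₗ[R] M) :=
        (ModuleCat.homAddEquiv (M := ModuleCat.of R (R ⧸ m)) (N := M)).symm.subsingleton
      obtain ⟨r, hr, h⟩ := IsSMulRegular.subsingleton_linearMap_iff.mp this
      rw [Ideal.annihilator_quotient] at hr
      exact ⟨r, hr, (hreg r).mpr h⟩
    · intro f hf hJ
      have hf' := (hreg f).mp hJ
      have hk : LinearMap.ker ((Submodule.mkQ (f • (⊤ : Submodule R M))) ∘ₗ π) =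
          LinearMap.ker π ⊔ Ideal.span {f} := by
        rw [LinearMap.ker_comp, Submodule.ker_mkQ]
        apply le_antisymm
        · intro x hx
          obtain ⟨y, -, hy⟩ := hx
          obtain ⟨y, rfl⟩ := hπ y
          have e : x = (x - f * y) + f * y := by ring
          rw [e]
          refine Submodule.add_mem_sup ?_ (Ideal.mem_span_singleton'.mpr ⟨y, mul_comm _ _⟩)
          have hy' : f • π y = π x := hy
          rw [LinearMap.mem_ker, map_sub, ← hy', ← smul_eq_mul, map_smul, sub_self]
        · refine sup_le ?_ ?_
          · intro x hx
            have hx' : π x = 0 := hx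
            rw [Submodule.mem_comap, hx']; exact Submodule.zero_mem _
          · rw [Ideal.span_singleton_le_iff_mem]
            have e : π f = f • π 1 := by rw [← map_smul, smul_eq_mul, mul_one]
            rw [Submodule.mem_comap, e]
            exact Submodule.smul_mem_pointwise_smul _ _ _ trivial
      rw [← hk]
      refine ih (ModuleCat.of R (QuotSMulTop f M)) _
        ((Submodule.mkQ_surjective _).comp hπ) fun i hi => ?_
      have zero1 := AddCommGrpCat.isZero_of_iff_subsingleton.mpr (hE i (by omega))
      have zero2 := AddCommGrpCat.isZero_of_iff_subsingleton.mpr (hE (i + 1) (by omega))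
      exact AddCommGrpCat.subsingleton_of_isZero <| ShortComplex.Exact.isZero_of_both_zeros
        ((Ext.covariant_sequence_exact₃' _ hf'.smulShortComplex_shortExact) i (i + 1) rfl)
        (zero1.eq_zero_of_src _) (zero2.eq_zero_of_tgt _)

-- Ideals generated by variables are detected on exponents, and multiplication by another variable
-- does not alter the exponents of the generating variables.
open RingTheory.Sequence in
theorem isRegular_X (n : ℕ) : IsRegular (Poly n) (List.ofFn fun i : Fin (n + 1) => (X i : Poly n)) := by
  have hof (k : ℕ) : (Ideal.ofList ((List.ofFn fun i : Fin (n + 1) => (X i : Poly n)).take k)) =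
      Ideal.span (X '' {i : Fin (n + 1) | (i : ℕ) < k}) := by
    refine congrArg Ideal.span (Set.ext fun x => ?_)
    simp only [Set.mem_ofPred_eq, List.mem_take_iff_getElem, List.getElem_ofFn, Set.mem_image]
    constructor
    · rintro ⟨j, hj, rfl⟩
      simp only [List.length_ofFn] at hj
      exact ⟨⟨j, by omega⟩, by simp; omega, rfl⟩
    · rintro ⟨i, hi, rfl⟩
      exact ⟨i, by simp; omega, rfl⟩
  refine ⟨⟨fun i hi => ?_⟩, ?_⟩
  · simp only [List.length_ofFn] at hi
    rw [hof, smul_eq_mul, Ideal.mul_top, List.getElem_ofFn,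
      isSMulRegular_iff_right_eq_zero_of_smul]
    intro x hx
    obtain ⟨x, rfl⟩ := Ideal.Quotient.mk_surjective x
    rw [← Ideal.Quotient.mk_eq_mk, ← Submodule.Quotient.mk_smul, Submodule.Quotient.mk_eq_zero,
      mem_ideal_span_X_image] at hx
    rw [Ideal.Quotient.eq_zero_iff_mem, mem_ideal_span_X_image]
    intro a ha
    obtain ⟨j, hj, h⟩ := hx (Finsupp.single ⟨i, hi⟩ 1 + a) (by
      rw [mem_support_iff, smul_eq_mul, coeff_X_mul]; exact mem_support_iff.mp ha)
    refine ⟨j, hj, ?_⟩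
    have hj' : (⟨i, hi⟩ : Fin (n + 1)) ≠ j := by rintro rfl; simp at hj
    simpa [Finsupp.single_apply, hj'] using h
  · have h := hof (n + 1)
    rw [List.take_of_length_le (by simp)] at h
    rw [h, smul_eq_mul, Ideal.mul_top]
    intro e
    have h1 : (1 : Poly n) ∈ Ideal.span (X '' {i : Fin (n + 1) | (i : ℕ) < n + 1}) := by
      rw [← e]; trivial
    rw [mem_ideal_span_X_image] at h1
    obtain ⟨i, -, hi⟩ := h1 0 (by rw [mem_support_iff]; simp)
    simp at hi

theorem hasDepth_bot (n : ℕ) : HasDepth (idealOfVars (Fin (n + 1)) ℂ) (n + 1) ⊥ := by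
  have hker : LinearMap.ker (LinearMap.id : Poly n →ₗ[Poly n] Poly n) = ⊥ := by simp
  rw [← hker]
  have hlen : (List.ofFn fun i : Fin (n + 1) => (X i : Poly n)).length = n + 1 := by simp
  refine hasDepth_of_ext (idealOfVars (Fin (n + 1)) ℂ) (n + 1)
    (ModuleCat.of (Poly n) (Poly n)) LinearMap.id Function.surjective_id ?_
  intro i hi
  refine ModuleCat.subsingleton_ext_of_exists_isRegular (idealOfVars (Fin (n + 1)) ℂ) _ ?_ _ ?_ _ ?_
    (isRegular_X n) i (hi.trans_eq hlen.symm)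
  · refine (Module.support_eq_zeroLocus (R := Poly n)
      (M := Poly n ⧸ idealOfVars (Fin (n + 1)) ℂ)).subset.trans ?_
    rw [Ideal.annihilator_quotient]
  · rw [lt_top_iff_ne_top]
    intro e
    have h1 : (1 : Poly n) ∈ idealOfVars (Fin (n + 1)) ℂ • (⊤ : Ideal (Poly n)) := by
      rw [show idealOfVars (Fin (n + 1)) ℂ • (⊤ : Ideal (Poly n)) = ⊤ from e]; trivial
    rw [smul_eq_mul, Ideal.mul_top, idealOfVars, ← Set.image_univ, mem_ideal_span_X_image] at h1
    obtain ⟨i, -, hi⟩ := h1 0 (by rw [mem_support_iff]; simp)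
    simp at hi
  · intro r hr
    obtain ⟨i, rfl⟩ := List.mem_ofFn.mp hr
    exact Ideal.subset_span ⟨i, rfl⟩

end depth

end LogForms

end

noncomputable section
namespace LogForms
open MvPolynomial

/-! ### Dual frames and regularity of the strata -/

/-- Vector fields `X_t`, `t ∈ A`, with `dF_s(X_t) = u δ_{st}`. -/
def DualFrame {n m : ℕ} (F : Fin m → Poly n) (A : Finset (Fin m)) (X : Fin m → VF n)
    (u : Poly n) : Prop :=
  ∀ s ∈ A, ∀ t ∈ A, along (X t) (F s) = if s = t then u else 0

section frame
variable {n m : ℕ} {F : Fin m → Poly n} {A B : Finset (Fin m)}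

theorem DualFrame.mono {X : Fin m → VF n} {u : Poly n} (h : DualFrame F B X u) (hAB : A ⊆ B) :
    DualFrame F A X u := fun s hs t ht => h s (hAB hs) t (hAB ht)

theorem DualFrame.self {X : Fin m → VF n} {u : Poly n} (h : DualFrame F A X u) {s : Fin m}
    (hs : s ∈ A) : along (X s) (F s) = u := by simp [h s hs s hs]

theorem DualFrame.ne {X : Fin m → VF n} {u : Poly n} (h : DualFrame F A X u) {s t : Fin m}
    (hs : s ∈ A) (ht : t ∈ A) (hst : s ≠ t) : along (X t) (F s) = 0 := by simp [h s hs t ht, hst]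

theorem exists_dual_vectors {ι : Type} [Fintype ι] [DecidableEq ι] {k : ℕ} {f : ι → Fin k → ℂ}
    (h : LinearIndependent ℂ f) :
    ∃ v : ι → Fin k → ℂ, ∀ s t, ∑ j, f s j * v t j = if s = t then 1 else 0 := by
  have hinj : Function.Injective (Matrix.of f).transpose.mulVec :=
    Matrix.mulVec_injective_iff.mpr h
  obtain ⟨g, hg⟩ := LinearMap.exists_leftInverse_of_injective
    (Matrix.mulVecLin (Matrix.of f).transpose) (LinearMap.ker_eq_bot.mpr hinj)
  refine ⟨fun t j => g (Pi.single j 1) t, fun s t => ?_⟩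
  have h1 := congrFun (LinearMap.congr_fun hg (Pi.single s 1)) t
  simp only [LinearMap.comp_apply, Matrix.mulVecLin_apply, Matrix.mulVec_single_one,
    LinearMap.id_apply] at h1
  have e : (Matrix.of f).transpose.col s = ∑ j, f s j • Pi.single j (1 : ℂ) := by
    ext j; simp [Pi.single_apply, Matrix.col_apply]
  rw [e, map_sum, Finset.sum_apply] at h1
  simpa [Pi.single_apply, eq_comm] using h1

/-- Constant vectors dual to the differentials at x give a matrix of derivatives equal to the
identity at x. Multiplying by its adjugate makes it u times the identity everywhere, with u the
determinant. -/
theorem exists_dualFrame (hF : NormalCrossings F) (A : Finset (Fin m)) {x : Fin (n + 1) → ℂ}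
    (hx : x ≠ 0) (hA : ∀ s ∈ A, eval x (F s) = 0) :
    ∃ X u, DualFrame F A X u ∧ eval x u ≠ 0 := by
  have hind : LinearIndependent ℂ fun i : A => fun j => eval x (pderiv j (F i)) :=
    (hF x hx).comp (fun i : A => (⟨i, hA i i.2⟩ : {i : Fin m // eval x (F i) = 0}))
      fun a b hab => Subtype.ext (congrArg (fun z => (z.1 : Fin m)) hab)
  obtain ⟨v, hv⟩ := exists_dual_vectors hind
  let M : Matrix A A (Poly n) := Matrix.of fun s t => along (const (v t)) (F s)
  refine ⟨fun t => if ht : t ∈ A then ∑ r, M.adjugate r ⟨t, ht⟩ • const (v r) else 0, M.det, ?_, ?_⟩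
  · intro s hs t ht
    have h1 := congrFun (congrFun M.mul_adjugate ⟨s, hs⟩) ⟨t, ht⟩
    rw [Matrix.mul_apply, Matrix.smul_apply, Matrix.one_apply, smul_eq_mul, mul_ite, mul_one,
      mul_zero] at h1
    simp only [Subtype.mk.injEq] at h1
    have h2 : (if ht : t ∈ A then ∑ r, M.adjugate r ⟨t, ht⟩ • const (v r) else 0) =
      ∑ r, M.adjugate r ⟨t, ht⟩ • const (v r) := dif_pos ht
    dsimp only
    rw [← h1, h2, ← diff_apply, map_sum]
    simp only [map_smul, diff_apply, smul_eq_mul, M, Matrix.of_apply]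
    exact Finset.sum_congr rfl fun r _ => mul_comm _ _
  · have : (eval x).mapMatrix M = 1 := by
      ext s t
      simp only [RingHom.mapMatrix_apply, Matrix.map_apply, M, Matrix.of_apply, along_apply,
        map_sum, map_mul, const, eval_C, Matrix.one_apply, ← hv]
      exact Finset.sum_congr rfl fun r _ => mul_comm _ _
    rw [RingHom.map_det, this, Matrix.det_one]
    exact one_ne_zero

/-- By the Nullstellensatz it is enough that K has no zero besides the origin. Any other zero would
lie on the stratum, where some frame has u ≠ 0, while a power of u is in K. -/
theorem idealOfVars_le_radical (hF : NormalCrossings F) (A : Finset (Fin m)) {K : Ideal (Poly n)}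
    (hA : ∀ s ∈ A, F s ∈ K) (h : ∀ X u, DualFrame F A X u → ∃ k, u ^ k ∈ K) :
    idealOfVars (Fin (n + 1)) ℂ ≤ K.radical := by
  rw [← vanishingIdeal_zeroLocus_eq_radical (K := ℂ)]
  refine Ideal.span_le.mpr ?_
  rintro _ ⟨i, rfl⟩
  refine mem_vanishingIdeal_iff.mpr fun z hz => ?_
  rw [mem_zeroLocus_iff] at hz
  have hz0 : z = 0 := by
    by_contra hne
    obtain ⟨X, u, hX, hu⟩ := exists_dualFrame hF A hne fun s hs => by
      have := hz (F s) (hA s hs)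
      rwa [aeval_eq_eval] at this
    obtain ⟨k, hk⟩ := h X u hX
    have := hz _ hk
    rw [aeval_eq_eval, map_pow] at this
    exact pow_ne_zero k hu this
  simp [hz0]

/-- The local-to-global principle of the proof: the ideal of multipliers taking x into J contains a
power of each element of the irrelevant ideal, one of which is a nonzerodivisor modulo J. -/
theorem mem_of_dualFrame (hF : NormalCrossings F) (A : Finset (Fin m)) {J : Ideal (Poly n)}
    (hJ : HasDepth (idealOfVars (Fin (n + 1)) ℂ) 1 J) {x : Poly n} (hA : ∀ s ∈ A, F s * x ∈ J)
    (h : ∀ X u, DualFrame F A X u → ∃ k, u ^ k * x ∈ J) : x ∈ J := by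
  obtain ⟨⟨r, hr, hrJ⟩, -⟩ := hJ
  obtain ⟨k, hk⟩ := idealOfVars_le_radical hF A
    (K := Submodule.comap (LinearMap.toSpanSingleton (Poly n) (Poly n) x) J) hA h hr
  exact hrJ.pow k x hk

/-- A derivation that preserves `J` and takes `f` to `u` makes `f` a nonzerodivisor modulo `J`,
up to powers of `u`. -/
theorem exists_pow_mul_mem {J : Ideal (Poly n)} {f u x : Poly n}
    (D : Derivation ℂ (Poly n) (Poly n)) (hD : ∀ y ∈ J, D y ∈ J) (hf : D f = u)
    (hx : f * x ∈ J) : ∃ k, u ^ k * x ∈ J := by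
  -- Applying D to f^(j+1) y ∈ J gives (j+1) u f^j y ≡ −f^(j+1) D y. This trades a factor u for a
  -- further factor f, and characteristic zero allows division by j + 1.
  have key : ∀ j : ℕ, ∃ e y, u ^ e * x - f ^ j * y ∈ J ∧ f ^ (j + 1) * y ∈ J := by
    intro j
    induction j with
    | zero => exact ⟨0, x, by simp, by simpa using hx⟩
    | succ j ih =>
      obtain ⟨e, y, h1, h2⟩ := ih
      have h3 := hD _ h2
      rw [Derivation.leibniz, Derivation.leibniz_pow, hf, Nat.add_sub_cancel] at h3
      simp only [smul_eq_mul, nsmul_eq_mul] at h3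
      have hc : C ((j + 1 : ℂ)⁻¹) * ((j + 1 : ℕ) : Poly n) = 1 := by
        rw [show ((j + 1 : ℕ) : Poly n) = C ((j + 1 : ℂ)) by simp, ← C_mul,
          inv_mul_cancel₀ (Nat.cast_add_one_ne_zero j), C_1]
      refine ⟨e + 1, - C ((j + 1 : ℂ)⁻¹) * D y, ?_, ?_⟩
      · have := J.add_mem (J.mul_mem_left u h1) (J.mul_mem_left (C ((j + 1 : ℂ)⁻¹)) h3)
        convert this using 1
        linear_combination (f ^ j * u * y) * (-hc)
      · have := J.sub_mem (J.mul_mem_left u h2)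
          (J.mul_mem_left (C ((j + 1 : ℂ)⁻¹) * f) h3)
        convert this using 1
        linear_combination (f ^ (j + 1) * u * y) * hc
  -- The colon ideals (J : f^j) stabilize at some N; for j = N the second relation of `key` then
  -- already gives f^N y ∈ J.
  let K : ℕ →o Ideal (Poly n) :=
    { toFun := fun j => Submodule.comap (LinearMap.toSpanSingleton (Poly n) (Poly n) (f ^ j)) J
      monotone' := monotone_nat_of_le_succ fun j y hy => by
        have hy' : y * f ^ j ∈ J := hy
        change y * f ^ (j + 1) ∈ J
        rw [pow_succ, ← mul_assoc]
        exact J.mul_mem_right _ hy' }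
  obtain ⟨N, hN⟩ := monotone_stabilizes_iff_noetherian.mpr inferInstance K
  obtain ⟨e, y, h1, h2⟩ := key N
  have h3 : y ∈ K (N + 1) := by change y * f ^ (N + 1) ∈ J; rwa [mul_comm]
  rw [← hN (N + 1) (Nat.le_succ N)] at h3
  have h4 : y * f ^ N ∈ J := h3
  refine ⟨e, ?_⟩
  have := J.add_mem h1 h4
  convert this using 1
  ring

theorem along_mem_stratum {v : VF n} (h : ∀ s ∈ A, along v (F s) ∈ stratum F A) {y : Poly n}
    (hy : y ∈ stratum F A) : along v y ∈ stratum F A := by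
  refine Submodule.span_induction ?_ ?_ ?_ ?_ hy
  · rintro _ ⟨s, hs, rfl⟩; exact h s hs
  · simp
  · intro a b _ _ ha hb; rw [map_add]; exact Ideal.add_mem _ ha hb
  · intro a b hb' hb
    rw [smul_eq_mul, Derivation.leibniz]
    exact Ideal.add_mem _ (Ideal.mul_mem_left _ _ hb) (Ideal.mul_mem_right _ _ hb')

theorem stratum_insert (a : Fin m) : stratum F (insert a A) = stratum F A ⊔ Ideal.span {F a} := by
  rw [stratum, Finset.coe_insert, Set.image_insert_eq, Ideal.span_insert, sup_comm]; rfl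

/-- The frame field X_p annihilates the generators of J_A, so it preserves J_A, and it sends F_p to
u. Thus F_p is a nonzerodivisor up to powers of u, and depth removes them. -/
theorem nzdMod_stratum (hF : NormalCrossings F)
    (hA : HasDepth (idealOfVars (Fin (n + 1)) ℂ) 1 (stratum F A)) {p : Fin m} (hp : p ∉ A) :
    NzdMod (stratum F A) (F p) := by
  intro x hx
  refine mem_of_dualFrame hF (insert p A) hA ?_ ?_
  · intro s hs
    rcases Finset.mem_insert.mp hs with rfl | hs
    · exact hx
    · exact Ideal.mul_mem_right _ _ (mem_stratum hs)
  · intro X u hX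
    refine exists_pow_mul_mem (along (X p)) (fun y hy => along_mem_stratum (fun s hs => ?_) hy)
      (hX.self (Finset.mem_insert_self _ _)) hx
    rw [hX.ne (Finset.mem_insert_of_mem hs) (Finset.mem_insert_self _ _)
      (by rintro rfl; exact hp hs)]
    exact Ideal.zero_mem _

/-- Each further F_a is a nonzerodivisor modulo the previous ones, so the depth n + 1 of the
polynomial ring drops by one at each step. -/
theorem hasDepth_stratum (hF : NormalCrossings F)
    (hF0 : ∀ i, F i ∈ idealOfVars (Fin (n + 1)) ℂ) (A : Finset (Fin m)) :
    ∀ t, A.card + t = n + 1 → HasDepth (idealOfVars (Fin (n + 1)) ℂ) t (stratum F A) := by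
  induction A using Finset.induction_on with
  | empty =>
    intro t ht
    have : stratum F ∅ = ⊥ := by simp [stratum]
    rw [Finset.card_empty, zero_add] at ht
    rw [ht, this]
    exact hasDepth_bot n
  | insert a s ha ih =>
    intro t ht
    rw [Finset.card_insert_of_notMem ha] at ht
    have h := ih (t + 1) (by omega)
    rw [stratum_insert]
    exact h.2 _ (hF0 a) (nzdMod_stratum hF (h.mono (by omega)) ha)

end frame
end LogForms

end

noncomputable section
namespace LogForms
open MvPolynomial

/-! ### Division of forms along the strata -/

/-- The vector fields that kill `F_s`, `s ∈ A`. -/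
def Kills {n m : ℕ} (F : Fin m → Poly n) (A : Finset (Fin m)) (v : VF n) : Prop :=
  ∀ s ∈ A, along v (F s) = 0

section division
variable {n m : ℕ} {F : Fin m → Poly n} {A : Finset (Fin m)} {J : Ideal (Poly n)}

theorem along_sum_smul {ι : Type} (T : Finset ι) (c : ι → Poly n) (X : ι → VF n) (f : Poly n) :
    along (∑ s ∈ T, c s • X s) f = ∑ s ∈ T, c s * along (X s) f := by
  rw [← diff_apply, map_sum]
  simp only [map_smul, smul_eq_mul, diff_apply]

theorem DualFrame.along_sum {X : Fin m → VF n} {u : Poly n} (h : DualFrame F A X u)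
    (c : Fin m → Poly n) {s : Fin m} (hs : s ∈ A) :
    along (∑ t ∈ A, c t • X t) (F s) = c s * u := by
  rw [along_sum_smul, Finset.sum_eq_single s, h.self hs]
  · intro t ht hts; rw [h.ne hs ht hts.symm, mul_zero]
  · exact fun h => absurd hs h

theorem DualFrame.kills {X : Fin m → VF n} {u : Poly n} (h : DualFrame F A X u) (w : VF n) :
    Kills F A (u • w - ∑ s ∈ A, along w (F s) • X s) := by
  intro s hs
  rw [map_sub, Derivation.sub_apply, h.along_sum _ hs, map_smul, Derivation.smul_apply,
    smul_eq_mul, mul_comm, sub_self]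

/-- The dF_s are independent modulo J: evaluation on X_s isolates u c_s. -/
theorem mem_of_sum_along_mem (hF : NormalCrossings F) (hAJ : stratum F A ≤ J)
    (hJ : HasDepth (idealOfVars (Fin (n + 1)) ℂ) 1 J) {c : Fin m → Poly n}
    (h : ∀ w : VF n, ∑ s ∈ A, c s * along w (F s) ∈ J) {s : Fin m} (hs : s ∈ A) : c s ∈ J := by
  refine mem_of_dualFrame hF A hJ (fun t ht => J.mul_mem_right _ (hAJ (mem_stratum ht))) ?_
  intro X u hX
  refine ⟨1, ?_⟩
  have := h (X s)
  rw [Finset.sum_eq_single s, hX.self hs] at this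
  · rwa [pow_one, mul_comm]
  · intro t ht hts; rw [hX.ne ht hs hts, mul_zero]
  · exact fun h => absurd hs h

/-- The `p` for which `p l` is a combination of the `dF_s`, `s ∈ A`, modulo `J`. -/
def divIdeal (F : Fin m → Poly n) (A : Finset (Fin m)) (J : Ideal (Poly n))
    (l : VF n →ₗ[Poly n] Poly n) : Ideal (Poly n) where
  carrier := {p | ∃ c : Fin m → Poly n, ∀ w, p * l w - ∑ s ∈ A, c s * along w (F s) ∈ J}
  add_mem' := by
    rintro a b ⟨c, hc⟩ ⟨c', hc'⟩
    refine ⟨c + c', fun w => ?_⟩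
    convert J.add_mem (hc w) (hc' w) using 1
    simp only [Pi.add_apply, add_mul, Finset.sum_add_distrib]
    ring
  zero_mem' := ⟨0, fun w => by simp⟩
  smul_mem' := by
    rintro a b ⟨c, hc⟩
    refine ⟨a • c, fun w => ?_⟩
    convert J.mul_mem_left a (hc w) using 1
    simp only [Pi.smul_apply, smul_eq_mul, mul_sub, Finset.mul_sum, mul_assoc]

/-- The `p` for which `p B` is in the ideal of the `dF_s`, `s ∈ A`, modulo `J`. -/
def divIdealTwo (F : Fin m → Poly n) (A : Finset (Fin m)) (J : Ideal (Poly n)) (B : Bil n) :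
    Ideal (Poly n) where
  carrier := {p | ∃ a : Fin m → VF n →ₗ[Poly n] Poly n, ∀ v w,
    p * B v w - ∑ s ∈ A, (along v (F s) * a s w - along w (F s) * a s v) ∈ J}
  add_mem' := by
    rintro p q ⟨a, ha⟩ ⟨b, hb⟩
    refine ⟨a + b, fun v w => ?_⟩
    convert J.add_mem (ha v w) (hb v w) using 1
    rw [sub_add_sub_comm, ← Finset.sum_add_distrib, add_mul]
    congr 1
    refine Finset.sum_congr rfl fun s _ => ?_
    simp only [Pi.add_apply, LinearMap.add_apply]
    ring
  zero_mem' := ⟨0, fun v w => by simp⟩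
  smul_mem' := by
    rintro p q ⟨a, ha⟩
    refine ⟨fun s => p • a s, fun v w => ?_⟩
    convert J.mul_mem_left p (ha v w) using 1
    rw [mul_sub, Finset.mul_sum, smul_eq_mul, mul_assoc]
    congr 1
    refine Finset.sum_congr rfl fun s _ => ?_
    simp only [LinearMap.smul_apply, smul_eq_mul]
    ring

theorem mem_divIdeal {l : VF n →ₗ[Poly n] Poly n} {p : Poly n} : p ∈ divIdeal F A J l ↔
    ∃ c : Fin m → Poly n, ∀ w, p * l w - ∑ s ∈ A, c s * along w (F s) ∈ J := Iff.rfl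

theorem mem_divIdealTwo {B : Bil n} {p : Poly n} : p ∈ divIdealTwo F A J B ↔
    ∃ a : Fin m → VF n →ₗ[Poly n] Poly n, ∀ v w,
      p * B v w - ∑ s ∈ A, (along v (F s) * a s w - along w (F s) * a s v) ∈ J := Iff.rfl

theorem HasDepth.exists_mem {t : ℕ} (hJ : HasDepth (idealOfVars (Fin (n + 1)) ℂ) (t + 1) J)
    {K : Ideal (Poly n)} (hK : idealOfVars (Fin (n + 1)) ℂ ≤ K.radical) :
    ∃ R ∈ K, NzdMod J R ∧ HasDepth (idealOfVars (Fin (n + 1)) ℂ) t (J ⊔ Ideal.span {R}) := by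
  obtain ⟨⟨r, hr, hrJ⟩, hdep⟩ := hJ
  obtain ⟨k, hk⟩ := hK hr
  -- The extra factor keeps the power inside the irrelevant ideal even if k = 0.
  refine ⟨r ^ (k + 1), by rw [pow_succ]; exact Ideal.mul_mem_right _ _ hk, hrJ.pow _,
    hdep _ (by rw [pow_succ]; exact Ideal.mul_mem_left _ _ hr) (hrJ.pow _)⟩

theorem exists_sub_mul_mem {x r : Poly n} (h : x ∈ J ⊔ Ideal.span {r}) :
    ∃ b, x - b * r ∈ J := by
  obtain ⟨y, hy, z, hz, e⟩ := Submodule.mem_sup.mp h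
  obtain ⟨b, rfl⟩ := Ideal.mem_span_singleton'.mp hz
  exact ⟨b, by rw [← e, add_sub_cancel_right]; exact hy⟩

theorem exists_linear_sub_mem {R : Poly n} (l : VF n →ₗ[Poly n] Poly n)
    (h : ∀ w, l w ∈ J ⊔ Ideal.span {R}) :
    ∃ l' : VF n →ₗ[Poly n] Poly n, ∀ w, l w - R * l' w ∈ J := by
  choose b hb using fun w => exists_sub_mul_mem (h w)
  refine ⟨Fintype.linearCombination (Poly n) fun a => b (Pi.single a 1), fun w => ?_⟩
  have e : w = ∑ a, w a • Pi.single a (1 : Poly n) := by ext1 i; simp [Pi.single_apply]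
  have := J.sum_mem (t := Finset.univ) fun a _ => J.mul_mem_left (w a) (hb (Pi.single a 1))
  convert this using 1
  conv_lhs => rw [e]
  simp only [map_sum, map_smul, smul_eq_mul, mul_sub, Finset.sum_sub_distrib, Finset.mul_sum]
  congr 1
  refine Finset.sum_congr rfl fun a _ => ?_
  rw [Fintype.linearCombination_apply_single, one_smul]
  ring

/-- Frames express u l through the dF_s, so R l is such a combination modulo J for some
nonzerodivisor R preserving depth one. Modulo (J, R) that combination is zero, so by independence
its coefficients are divisible by R, and R cancels. -/
theorem exists_sum_along (hF : NormalCrossings F) (hAJ : stratum F A ≤ J)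
    (hJ : HasDepth (idealOfVars (Fin (n + 1)) ℂ) 2 J) (l : VF n →ₗ[Poly n] Poly n)
    (h : ∀ w, Kills F A w → l w ∈ J) :
    ∃ c : Fin m → Poly n, ∀ w, l w - ∑ s ∈ A, c s * along w (F s) ∈ J := by
  have hK : idealOfVars (Fin (n + 1)) ℂ ≤ (divIdeal F A J l).radical := by
    refine idealOfVars_le_radical hF A (fun s hs => mem_divIdeal.mpr ⟨0, fun w => ?_⟩) fun X u hX => ⟨1, ?_⟩
    · simpa using J.mul_mem_right _ (hAJ (mem_stratum hs))
    · rw [pow_one]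
      refine mem_divIdeal.mpr ⟨fun s => l (X s), fun w => ?_⟩
      have := h _ (hX.kills w)
      simp only [map_sub, map_smul, map_sum, smul_eq_mul] at this
      convert this using 2
      exact Finset.sum_congr rfl fun s _ => mul_comm _ _
  obtain ⟨R, hR, hrk, hd⟩ := hJ.exists_mem hK
  obtain ⟨c, hc⟩ := mem_divIdeal.mp hR
  have hcJ : ∀ s ∈ A, ∃ b, c s - b * R ∈ J := by
    intro s hs
    refine exists_sub_mul_mem (mem_of_sum_along_mem hF (hAJ.trans le_sup_left) hd (fun w => ?_) hs)
    have h1 : R * l w ∈ J ⊔ Ideal.span {R} :=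
      Ideal.mem_sup_right (Ideal.mul_mem_right _ _ (Ideal.mem_span_singleton_self _))
    have := Ideal.sub_mem _ h1 (Ideal.mem_sup_left (hc w))
    rwa [sub_sub_cancel] at this
  choose! b hb using hcJ
  refine ⟨b, fun w => hrk _ ?_⟩
  have h2 : ∑ s ∈ A, (c s - b s * R) * along w (F s) ∈ J :=
    J.sum_mem fun s hs => J.mul_mem_right _ (hb s hs)
  have e : R * (l w - ∑ s ∈ A, b s * along w (F s)) =
      R * l w - ∑ s ∈ A, c s * along w (F s) + ∑ s ∈ A, (c s - b s * R) * along w (F s) := by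
    rw [mul_sub, Finset.mul_sum, sub_add, ← Finset.sum_sub_distrib]
    congr 1
    exact Finset.sum_congr rfl fun s _ => by ring
  rw [e]
  exact J.add_mem (hc w) h2

/-- The linear division is applied twice: to each row of B, then to the coefficients as linear forms
in the first argument. -/
theorem exists_sum_sum_along (hF : NormalCrossings F) (hAJ : stratum F A ≤ J)
    (hJ : HasDepth (idealOfVars (Fin (n + 1)) ℂ) 2 J) (B : Bil n)
    (hl : ∀ v w, Kills F A v → B v w ∈ J) (hr : ∀ v w, Kills F A w → B v w ∈ J) :
    ∃ P : Fin m → Fin m → Poly n, ∀ v w,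
      B v w - ∑ s ∈ A, ∑ t ∈ A, P s t * along v (F s) * along w (F t) ∈ J := by
  have h1 := fun a : Fin (n + 1) => exists_sum_along hF hAJ hJ (B (Pi.single a 1))
    fun w hw => hr _ w hw
  choose c hc using h1
  let l : Fin m → VF n →ₗ[Poly n] Poly n := fun t => Fintype.linearCombination (Poly n) fun a => c a t
  have hB : ∀ v w, B v w - ∑ t ∈ A, l t v * along w (F t) ∈ J := by
    intro v w
    have e : v = ∑ a, v a • Pi.single a (1 : Poly n) := by ext1 i; simp [Pi.single_apply]
    have := J.sum_mem (t := Finset.univ) fun a _ => J.mul_mem_left (v a) (hc a w)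
    convert this using 1
    conv_lhs => rw [e]
    simp only [map_sum, map_smul, LinearMap.sum_apply, LinearMap.smul_apply, smul_eq_mul, mul_sub,
      Finset.sum_sub_distrib]
    congr 1
    simp only [l, Finset.mul_sum, Fintype.linearCombination_apply, Finset.sum_mul, smul_eq_mul,
      ]
    rw [Finset.sum_comm]
    refine Finset.sum_congr rfl fun a _ => Finset.sum_congr rfl fun t _ => ?_
    simp [Pi.single_apply, mul_assoc]
  have h2 : ∀ t ∈ A, ∃ p : Fin m → Poly n, ∀ v, l t v - ∑ s ∈ A, p s * along v (F s) ∈ J := by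
    intro t ht
    refine exists_sum_along hF hAJ hJ (l t) fun v hv => ?_
    refine mem_of_sum_along_mem hF hAJ hJ.of_succ (c := fun t => l t v) (fun w => ?_) ht
    have := J.sub_mem (hl v w hv) (hB v w)
    rwa [sub_sub_cancel] at this
  choose! p hp using h2
  refine ⟨fun s t => p t s, fun v w => ?_⟩
  have := J.add_mem (hB v w) (J.sum_mem fun t ht => J.mul_mem_right (along w (F t)) (hp t ht v))
  convert this using 1
  simp only [sub_mul, Finset.sum_sub_distrib, sub_add_sub_cancel, Finset.sum_mul]
  rw [Finset.sum_comm]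

/-- As for linear forms, R B ≡ Σ dF_s ∧ a_s modulo J. Modulo (J, R) this sum vanishes, which forces
a_s ≡ Σ_t p_st dF_t with p symmetric. The symmetric part contributes nothing to the sum and the rest
is divisible by R. Linear division modulo (J, R) needs depth two, hence depth three for J. -/
theorem exists_sum_wedge_along (hF : NormalCrossings F) (hAJ : stratum F A ≤ J)
    (hJ : HasDepth (idealOfVars (Fin (n + 1)) ℂ) 3 J) (B : Bil n) (hB : ∀ v w, B w v = - B v w)
    (h : ∀ v w, Kills F A v → Kills F A w → B v w ∈ J) :
    ∃ a : Fin m → VF n →ₗ[Poly n] Poly n, ∀ v w,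
      B v w - ∑ s ∈ A, (along v (F s) * a s w - along w (F s) * a s v) ∈ J := by
  have hK : idealOfVars (Fin (n + 1)) ℂ ≤ (divIdealTwo F A J B).radical := by
    refine idealOfVars_le_radical hF A (fun s hs => mem_divIdealTwo.mpr ⟨0, fun v w => ?_⟩) fun X u hX => ⟨2, ?_⟩
    · simpa using J.mul_mem_right (B v w) (hAJ (mem_stratum hs))
    · have hc : C (2⁻¹ : ℂ) * 2 = (1 : Poly n) := by
        rw [← map_ofNat C 2, ← C_mul, inv_mul_cancel₀ two_ne_zero, C_1]
      -- Found by expanding B on the projections uv − Σ dF_s(v) X_s and uw − Σ dF_s(w) X_s, both of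
      -- which kill A. Alternation counts the double sum twice, whence the half.
      refine mem_divIdealTwo.mpr ⟨fun s => u • B (X s) -
        (C (2⁻¹ : ℂ) : Poly n) • ∑ t ∈ A, B (X s) (X t) • diff (F t), fun v w => ?_⟩
      have h1 := h _ _ (hX.kills v) (hX.kills w)
      have e1 : B (u • v - ∑ s ∈ A, along v (F s) • X s) (u • w - ∑ s ∈ A, along w (F s) • X s) =
          u * u * B v w - u * ∑ s ∈ A, along v (F s) * B (X s) w
            + u * ∑ s ∈ A, along w (F s) * B (X s) v
            + ∑ s ∈ A, ∑ t ∈ A, along v (F s) * along w (F t) * B (X s) (X t) := by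
        simp only [map_sub, map_smul, map_sum, LinearMap.sub_apply, LinearMap.smul_apply,
          LinearMap.sum_apply, hB (X _) v, smul_eq_mul, mul_sub, Finset.mul_sum, mul_neg,
          Finset.sum_neg_distrib, Finset.sum_sub_distrib]
        rw [Finset.sum_comm]
        have a1 : ∑ x ∈ A, along w (F x) * (u * B (X x) v) =
            ∑ x ∈ A, u * (along w (F x) * B (X x) v) := Finset.sum_congr rfl fun _ _ => by ring
        have a2 : ∑ y ∈ A, ∑ x ∈ A, along w (F x) * (along v (F y) * B (X y) (X x)) =
            ∑ y ∈ A, ∑ x ∈ A, along v (F y) * along w (F x) * B (X y) (X x) :=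
          Finset.sum_congr rfl fun _ _ => Finset.sum_congr rfl fun _ _ => by ring
        rw [a1, a2]
        ring
      have e2 : ∑ s ∈ A, ∑ t ∈ A, along w (F s) * along v (F t) * B (X s) (X t) =
          - ∑ s ∈ A, ∑ t ∈ A, along v (F s) * along w (F t) * B (X s) (X t) := by
        rw [Finset.sum_comm, ← Finset.sum_neg_distrib]
        refine Finset.sum_congr rfl fun s _ => ?_
        rw [← Finset.sum_neg_distrib]
        refine Finset.sum_congr rfl fun t _ => ?_
        rw [hB (X s) (X t)]; ring
      have e3 : ∀ v w : VF n, ∑ s ∈ A, along v (F s) * (u • B (X s) -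
          (C (2⁻¹ : ℂ) : Poly n) • ∑ t ∈ A, B (X s) (X t) • diff (F t)) w =
          u * ∑ s ∈ A, along v (F s) * B (X s) w - C (2⁻¹ : ℂ) *
            ∑ s ∈ A, ∑ t ∈ A, along v (F s) * along w (F t) * B (X s) (X t) := by
        intro v w
        rw [Finset.mul_sum, Finset.mul_sum, ← Finset.sum_sub_distrib]
        refine Finset.sum_congr rfl fun s _ => ?_
        simp only [LinearMap.sub_apply, LinearMap.smul_apply, LinearMap.sum_apply, smul_eq_mul,
          diff_apply, mul_sub, Finset.mul_sum]
        refine congrArg₂ _ (by ring) (Finset.sum_congr rfl fun t _ => by ring)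
      rw [Finset.sum_sub_distrib, e3, e3, e2]
      rw [e1] at h1
      convert h1 using 1
      linear_combination (∑ s ∈ A, ∑ t ∈ A, along v (F s) * along w (F t) * B (X s) (X t)) * hc
  obtain ⟨R, hR, hrk, hd⟩ := hJ.exists_mem hK
  obtain ⟨a, ha⟩ := mem_divIdealTwo.mp hR
  set J' := J ⊔ Ideal.span {R} with hJ'
  have hAJ' : stratum F A ≤ J' := hAJ.trans le_sup_left
  have ha' : ∀ v w, ∑ s ∈ A, (along v (F s) * a s w - along w (F s) * a s v) ∈ J' := by
    intro v w
    have h1 : R * B v w ∈ J' :=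
      Ideal.mem_sup_right (Ideal.mul_mem_right _ _ (Ideal.mem_span_singleton_self _))
    have := Ideal.sub_mem _ h1 (Ideal.mem_sup_left (ha v w))
    rwa [sub_sub_cancel] at this
  have hp : ∀ s ∈ A, ∃ p : Fin m → Poly n, ∀ w, a s w - ∑ t ∈ A, p t * along w (F t) ∈ J' := by
    intro s hs
    refine exists_sum_along hF hAJ' hd (a s) fun w hw => ?_
    refine mem_of_sum_along_mem hF hAJ' hd.of_succ (c := fun s => a s w) (fun v => ?_) hs
    convert ha' v w using 1
    refine Finset.sum_congr rfl fun s hs => ?_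
    rw [hw s hs]; ring
  choose! p hp using hp
  -- Inserting a_s ≡ Σ p_st dF_t into Σ dF_s ∧ a_s ≡ 0 leaves the antisymmetric part of p against
  -- the products dF_s dF_t, and independence is used in each argument.
  have hsym : ∀ s ∈ A, ∀ t ∈ A, p s t - p t s ∈ J' := by
    intro s hs t ht
    have h1 : ∀ v, ∀ t ∈ A, ∑ s ∈ A, (p s t - p t s) * along v (F s) ∈ J' := by
      intro v t ht
      refine mem_of_sum_along_mem hF hAJ' hd.of_succ
        (c := fun t => ∑ s ∈ A, (p s t - p t s) * along v (F s)) (fun w => ?_) ht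
      have h1 := J'.sub_mem (ha' v w) (J'.sum_mem fun s hs => J'.sub_mem
        (J'.mul_mem_left (along v (F s)) (hp s hs w)) (J'.mul_mem_left (along w (F s)) (hp s hs v)))
      convert h1 using 1
      have e : ∀ s ∈ A, along v (F s) * a s w - along w (F s) * a s v -
          (along v (F s) * (a s w - ∑ t ∈ A, p s t * along w (F t)) -
            along w (F s) * (a s v - ∑ t ∈ A, p s t * along v (F t))) =
          ∑ t ∈ A, p s t * along v (F s) * along w (F t) -
            ∑ t ∈ A, p s t * along v (F t) * along w (F s) := by
        intro s _
        have e1 : ∑ t ∈ A, p s t * along v (F s) * along w (F t) =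
          along v (F s) * ∑ t ∈ A, p s t * along w (F t) := by
          rw [Finset.mul_sum]; exact Finset.sum_congr rfl fun _ _ => by ring
        have e2 : ∑ t ∈ A, p s t * along v (F t) * along w (F s) =
          along w (F s) * ∑ t ∈ A, p s t * along v (F t) := by
          rw [Finset.mul_sum]; exact Finset.sum_congr rfl fun _ _ => by ring
        rw [e1, e2]; ring
      rw [← Finset.sum_sub_distrib, Finset.sum_congr rfl e, Finset.sum_sub_distrib,
        Finset.sum_comm, ← Finset.sum_sub_distrib]
      refine Finset.sum_congr rfl fun t _ => ?_
      rw [Finset.sum_mul, ← Finset.sum_sub_distrib]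
      exact Finset.sum_congr rfl fun s _ => by ring
    exact mem_of_sum_along_mem hF hAJ' hd.of_succ (c := fun s => p s t - p t s)
      (fun v => h1 v t ht) hs
  have hq : ∀ s ∈ A, ∀ t ∈ A, ∃ q, p s t - p t s - q * R ∈ J := fun s hs t ht =>
    exists_sub_mul_mem (hsym s hs t ht)
  choose! q hq using hq
  have ha'' : ∀ s ∈ A, ∃ a' : VF n →ₗ[Poly n] Poly n, ∀ w,
      a s w - ∑ t ∈ A, p s t * along w (F t) - R * a' w ∈ J := by
    intro s hs
    obtain ⟨a', h'⟩ := exists_linear_sub_mem (J := J) (R := R)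
      (a s - ∑ t ∈ A, p s t • diff (F t)) fun w => by
        simpa [LinearMap.sum_apply] using hp s hs w
    refine ⟨a', fun w => ?_⟩
    simpa [LinearMap.sum_apply] using h' w
  choose! a' ha'' using ha''
  have hc : C (2⁻¹ : ℂ) * 2 = (1 : Poly n) := by
    rw [← map_ofNat C 2, ← C_mul, inv_mul_cancel₀ two_ne_zero, C_1]
  -- The quotients by R: a' from a_s − Σ p_st dF_t, and q/2 from the antisymmetric part of p.
  refine ⟨fun s => a' s + (C (2⁻¹ : ℂ) : Poly n) • ∑ t ∈ A, q s t • diff (F t),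
    fun v w => hrk _ ?_⟩
  have k1 := J.sum_mem fun s hs => J.sub_mem
    (J.mul_mem_left (along v (F s)) (ha'' s hs w)) (J.mul_mem_left (along w (F s)) (ha'' s hs v))
  have k2 : ∑ s ∈ A, ∑ t ∈ A, C (2⁻¹ : ℂ) * (along v (F s) * along w (F t) -
      along w (F s) * along v (F t)) * (p s t - p t s - q s t * R) ∈ J :=
    J.sum_mem fun s hs => J.sum_mem fun t ht => J.mul_mem_left _ (hq s hs t ht)
  have k3 : ∑ s ∈ A, ∑ t ∈ A, C (2⁻¹ : ℂ) * (along v (F s) * along w (F t) -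
      along w (F s) * along v (F t)) * (p s t - p t s) = ∑ s ∈ A, ∑ t ∈ A,
        (along v (F s) * along w (F t) - along w (F s) * along v (F t)) * p s t := by
    have : ∑ s ∈ A, ∑ t ∈ A, C (2⁻¹ : ℂ) * (along v (F s) * along w (F t) -
      along w (F s) * along v (F t)) * p t s = - ∑ s ∈ A, ∑ t ∈ A, C (2⁻¹ : ℂ) *
        (along v (F s) * along w (F t) - along w (F s) * along v (F t)) * p s t := by
      rw [Finset.sum_comm, ← Finset.sum_neg_distrib]
      refine Finset.sum_congr rfl fun s _ => ?_
      rw [← Finset.sum_neg_distrib]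
      exact Finset.sum_congr rfl fun t _ => by ring
    simp only [mul_sub _ (p _ _) (p _ _), Finset.sum_sub_distrib]
    rw [this, sub_neg_eq_add, ← Finset.sum_add_distrib]
    refine Finset.sum_congr rfl fun s _ => ?_
    rw [← Finset.sum_add_distrib]
    refine Finset.sum_congr rfl fun t _ => ?_
    linear_combination ((along v (F s) * along w (F t) - along w (F s) * along v (F t)) * p s t) * hc
  have k4 : ∀ s, ∑ t ∈ A, (along v (F s) * along w (F t) - along w (F s) * along v (F t)) * p s t =
      along v (F s) * ∑ t ∈ A, p s t * along w (F t)
        - along w (F s) * ∑ t ∈ A, p s t * along v (F t) := by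
    intro s
    rw [Finset.mul_sum, Finset.mul_sum, ← Finset.sum_sub_distrib]
    exact Finset.sum_congr rfl fun t _ => by ring
  have k5 : ∀ s, ∑ t ∈ A, C (2⁻¹ : ℂ) * (along v (F s) * along w (F t) -
      along w (F s) * along v (F t)) * (q s t * R) =
      R * C (2⁻¹ : ℂ) * (along v (F s) * ∑ t ∈ A, q s t * along w (F t)
        - along w (F s) * ∑ t ∈ A, q s t * along v (F t)) := by
    intro s
    rw [Finset.mul_sum, Finset.mul_sum, ← Finset.sum_sub_distrib, Finset.mul_sum]
    exact Finset.sum_congr rfl fun t _ => by ring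
  simp only [mul_sub _ (p _ _ - p _ _) _, Finset.sum_sub_distrib _ (fun _ => _ * (_ * R)), k5] at k2
  rw [Finset.sum_sub_distrib, k3] at k2
  simp only [k4] at k2
  convert J.add_mem (J.add_mem (ha v w) k1) k2 using 1
  rw [mul_sub, Finset.mul_sum, ← Finset.sum_sub_distrib, sub_add, sub_add,
    ← Finset.sum_sub_distrib, ← Finset.sum_sub_distrib]
  congr 1
  refine Finset.sum_congr rfl fun s _ => ?_
  simp only [LinearMap.add_apply, LinearMap.smul_apply, LinearMap.sum_apply, smul_eq_mul,
    diff_apply]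
  ring

end division
end LogForms

end

noncomputable section
namespace LogForms
open MvPolynomial

/-! ### Homogeneous parts -/

/-- The part of `p` which multiplied with a form of degree `k` has degree `e`. -/
def degPart {n : ℕ} (e k : ℕ) (p : Poly n) : Poly n :=
  if k ≤ e then homogeneousComponent (e - k) p else 0

theorem homogeneousComponent_mul {n : ℕ} (e : ℕ) {k : ℕ} (p : Poly n) {q : Poly n}
    (hq : q.IsHomogeneous k) : homogeneousComponent e (p * q) = degPart e k p * q := by
  have h (i : ℕ) : homogeneousComponent e (homogeneousComponent i p * q) =
      if i + k = e then homogeneousComponent i p * q else 0 := by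
    have := homogeneousComponent_of_mem (n := i + k) (m := e)
      (p := homogeneousComponent i p * q) ((homogeneousComponent_isHomogeneous i p).mul hq)
    rw [this]
    exact if_congr eq_comm rfl rfl
  conv_lhs => rw [← sum_homogeneousComponent p, Finset.sum_mul, map_sum]
  simp only [h]
  rw [degPart]
  split_ifs with hk
  · rw [Finset.sum_eq_single (e - k)]
    · simp [Nat.sub_add_cancel hk]
    · intro i _ hi; rw [if_neg (by omega)]
    · intro hi
      rw [if_pos (Nat.sub_add_cancel hk), homogeneousComponent_eq_zero _ _ (by simp at hi; omega),
        zero_mul]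
  · rw [zero_mul]
    exact Finset.sum_eq_zero fun i _ => if_neg (by omega)

theorem isHomogeneous_degPart {n : ℕ} (e k : ℕ) (p : Poly n) :
    (degPart e k p).IsHomogeneous (e - k) := by
  rw [degPart]
  split_ifs
  · exact homogeneousComponent_isHomogeneous _ _
  · exact isHomogeneous_zero _ _ _

theorem degPart_of_lt {n : ℕ} {e k : ℕ} (h : e < k) (p : Poly n) : degPart e k p = 0 :=
  if_neg (by omega)

/-! ### Arrangements with normal crossings -/

/-- Homogeneous polynomials of positive degree that define hypersurfaces with normal crossings. -/
structure IsArrangement {n m : ℕ} (d : Fin m → ℕ) (F : Fin m → Poly n) : Prop where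
  nc : NormalCrossings F
  hom : ∀ i, (F i).IsHomogeneous (d i)
  pos : ∀ i, 0 < d i

namespace IsArrangement
variable {n m : ℕ} {d : Fin m → ℕ} {F : Fin m → Poly n} {A T : Finset (Fin m)}

theorem mem_idealOfVars (h : IsArrangement d F) (i : Fin m) :
    F i ∈ idealOfVars (Fin (n + 1)) ℂ := by
  rw [idealOfVars, ← Set.image_univ, mem_ideal_span_X_image]
  intro a ha
  by_contra! h0
  have ha0 : a = 0 := by ext i; simpa using h0 i (Set.mem_univ i)
  have := h.hom i (mem_support_iff.mp ha)
  rw [ha0, map_zero] at this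
  exact (h.pos i).ne this

theorem hasDepth (h : IsArrangement d F) {t : ℕ} (hA : A.card + t ≤ n + 1) :
    HasDepth (idealOfVars (Fin (n + 1)) ℂ) t (stratum F A) :=
  (hasDepth_stratum h.nc h.mem_idealOfVars A (n + 1 - A.card) (by omega)).mono (by omega)

theorem nzdMod (h : IsArrangement d F) (hA : A.card ≤ n) {p : Fin m} (hp : p ∉ A) :
    NzdMod (stratum F A) (F p) :=
  nzdMod_stratum h.nc (h.hasDepth (by omega)) hp

theorem nzdMod_prod (h : IsArrangement d F) (hA : A.card ≤ n) (hT : ∀ t ∈ T, t ∉ A) :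
    NzdMod (stratum F A) (∏ t ∈ T, F t) :=
  NzdMod.prod fun t ht => h.nzdMod hA (hT t ht)

theorem mem_of_dualFrame (h : IsArrangement d F) (hA : A.card ≤ n) {x : Poly n}
    (hx : ∀ X u, DualFrame F A X u → ∃ k, u ^ k * x ∈ stratum F A) : x ∈ stratum F A :=
  LogForms.mem_of_dualFrame h.nc A (h.hasDepth (by omega))
    (fun _ hs => Ideal.mul_mem_right _ _ (mem_stratum hs)) hx

theorem homogeneousComponent_mem (h : IsArrangement d F) (e : ℕ) {x : Poly n}
    (hx : x ∈ stratum F A) : homogeneousComponent e x ∈ stratum F A := by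
  let _ : GradedAlgebra (homogeneousSubmodule (Fin (n + 1)) ℂ) := MvPolynomial.gradedAlgebra
  refine homogeneousComponent_mem_of_mem (Ideal.homogeneous_span _ _ ?_) hx e
  rintro _ ⟨i, -, rfl⟩
  exact ⟨d i, h.hom i⟩

theorem isHomogeneous_prod (h : IsArrangement d F) (T : Finset (Fin m)) :
    (∏ t ∈ T, F t).IsHomogeneous (∑ t ∈ T, d t) :=
  IsHomogeneous.prod T F d fun i _ => h.hom i

/-- J_A is homogeneous, so one may take degree-e parts, and a multiple of G has none. -/
theorem mem_of_sub_mul_mem (h : IsArrangement d F) {x c G : Poly n} {e k : ℕ}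
    (hx : x.IsHomogeneous e) (hG : G.IsHomogeneous k) (hek : e < k)
    (hc : x - c * G ∈ stratum F A) : x ∈ stratum F A := by
  have := h.homogeneousComponent_mem e hc
  rwa [map_sub, homogeneousComponent_mul e c hG, degPart_of_lt hek, zero_mul, sub_zero,
    homogeneousComponent_eq_self hx] at this

theorem eq_zero_of_C_mem (h : IsArrangement d F) {c : ℂ} (hc : C c ∈ stratum F A) : c = 0 := by
  have h1 : stratum F A ≤ idealOfVars (Fin (n + 1)) ℂ := by
    refine Ideal.span_le.mpr ?_
    rintro _ ⟨i, -, rfl⟩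
    exact h.mem_idealOfVars i
  have h2 := h1 hc
  rw [idealOfVars, ← Set.image_univ, mem_ideal_span_X_image] at h2
  by_contra h0
  obtain ⟨i, -, hi⟩ := h2 0 (by rw [mem_support_iff]; simpa using h0)
  simp at hi

/-- An element of `J_A + (F_l)` for all `l ∈ T` is in `J_A + (∏_T F_l)`. -/
theorem exists_sub_mul_prod_mem (h : IsArrangement d F) (hA : A.card + 1 ≤ n)
    (hT : ∀ t ∈ T, t ∉ A) {x : Poly n} (hx : ∀ t ∈ T, x ∈ stratum F (insert t A)) :
    ∃ c, x - c * ∏ t ∈ T, F t ∈ stratum F A := by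
  induction T using Finset.induction_on with
  | empty => exact ⟨x, by simp⟩
  | insert a s ha ih =>
    obtain ⟨c, hc⟩ := ih (fun t ht => hT t (by simp [ht])) fun t ht => hx t (by simp [ht])
    have haA : a ∉ A := hT a (by simp)
    -- Modulo J_{A ∪ a} the element vanishes and the product over s is a nonzerodivisor, so the
    -- cofactor c itself lies there and yields the new factor F_a.
    have h1 : (∏ t ∈ s, F t) * c ∈ stratum F (insert a A) := by
      have := Ideal.sub_mem _ (hx a (by simp)) (stratum_mono (Finset.subset_insert a A) hc)
      rwa [sub_sub_cancel, mul_comm] at this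
    have h2 := h.nzdMod_prod (A := insert a A) (T := s)
      (by rw [Finset.card_insert_of_notMem haA]; exact hA) (fun t ht => by
        rw [Finset.mem_insert, not_or]
        exact ⟨by rintro rfl; exact ha ht, hT t (by simp [ht])⟩) c h1
    obtain ⟨b, hb⟩ := mem_stratum_insert.mp h2
    refine ⟨b, ?_⟩
    rw [Finset.prod_insert ha]
    convert Ideal.add_mem _ hc (Ideal.mul_mem_left _ (∏ t ∈ s, F t) hb) using 1
    ring

/-- The degree argument used on every stratum: the element is a multiple of ∏_T F_t modulo J_A, a
product of too large a degree. -/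
theorem mem_of_forall_insert (h : IsArrangement d F) (hA : A.card + 1 ≤ n)
    (hT : ∀ t ∈ T, t ∉ A) {x : Poly n} {e : ℕ} (he : x.IsHomogeneous e)
    (hx : ∀ t ∈ T, x ∈ stratum F (insert t A)) (hlt : e < ∑ t ∈ T, d t) : x ∈ stratum F A := by
  obtain ⟨c, hc⟩ := h.exists_sub_mul_prod_mem hA hT hx
  exact h.mem_of_sub_mul_mem he (h.isHomogeneous_prod T) hlt hc

/-- Functions on the hypersurfaces F_t = 0 of a stratum that agree on pairwise intersections glue to
the stratum. -/
theorem exists_sub_mem_insert (h : IsArrangement d F) (hA : A.card + 2 ≤ n)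
    (hT : ∀ t ∈ T, t ∉ A) (g : Fin m → Poly n)
    (hg : ∀ s ∈ T, ∀ t ∈ T, s ≠ t → g s - g t ∈ stratum F (insert s (insert t A))) :
    ∃ x, ∀ t ∈ T, x - g t ∈ stratum F (insert t A) := by
  induction T using Finset.induction_on with
  | empty => exact ⟨0, by simp⟩
  | insert a s ha ih =>
    obtain ⟨x, hx⟩ := ih (fun t ht => hT t (by simp [ht]))
      fun p hp q hq => hg p (by simp [hp]) q (by simp [hq])
    have haA : a ∉ A := hT a (by simp)
    obtain ⟨c, hc⟩ := h.exists_sub_mul_prod_mem (A := insert a A) (T := s) (x := x - g a)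
      (by rw [Finset.card_insert_of_notMem haA]; omega) (fun t ht => by
        rw [Finset.mem_insert, not_or]
        exact ⟨by rintro rfl; exact ha ht, hT t (by simp [ht])⟩) (fun t ht => by
        have h1 := hg t (by simp [ht]) a (by simp) (by rintro rfl; exact ha ht)
        have h2 := stratum_mono (F := F) (Finset.insert_subset_insert t (Finset.subset_insert a A))
          (hx t ht)
        convert Ideal.add_mem _ h2 h1 using 1
        ring)
    -- The correction vanishes on the hypersurfaces already treated and equals x − g_a on the new
    -- one.
    refine ⟨x - c * ∏ t ∈ s, F t, fun t ht => ?_⟩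
    rcases Finset.mem_insert.mp ht with rfl | ht
    · convert hc using 1; ring
    · have : F t ∈ stratum F (insert t A) := mem_stratum (by simp)
      convert Ideal.sub_mem _ (hx t ht) (Ideal.mul_mem_left _ (c * ∏ r ∈ s.erase t, F r) this)
        using 1
      rw [← Finset.mul_prod_erase s F ht]
      ring

end IsArrangement

/-! ### Bilinear forms modulo ideals -/

section bilinear
variable {n m : ℕ}

/-- `df ∧ dg`. -/
def wdg (f g : Poly n) : Bil n := (diff f).smulRight (diff g) - (diff g).smulRight (diff f)

theorem wdg_apply (f g : Poly n) (v w : VF n) :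
    wdg f g v w = along v f * along w g - along v g * along w f := by
  simp [wdg]

theorem bil_mem {J : Ideal (Poly n)} (B : Bil n)
    (h : ∀ a b, B (Pi.single a 1) (Pi.single b 1) ∈ J) (v w : VF n) : B v w ∈ J := by
  have e (v : VF n) : v = ∑ a, v a • Pi.single a (1 : Poly n) := by
    ext1 i; simp [Pi.single_apply]
  rw [e v, e w]
  simp only [map_sum, map_smul, LinearMap.sum_apply, LinearMap.smul_apply, smul_eq_mul]
  exact J.sum_mem fun a _ => J.mul_mem_left _ (J.sum_mem fun b _ => J.mul_mem_left _ (h _ _))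

theorem isHomogeneous_along_single {e : ℕ} {f : Poly n} (h : f.IsHomogeneous e)
    (a : Fin (n + 1)) : (along (Pi.single a 1) f).IsHomogeneous (e - 1) := by
  rw [← const_single]; exact isHomogeneous_along_const h _

theorem isHomogeneous_wdg {e e' : ℕ} {f g : Poly n} (hf : f.IsHomogeneous e)
    (hg : g.IsHomogeneous e') (a b : Fin (n + 1)) :
    (wdg f g (Pi.single a 1) (Pi.single b 1)).IsHomogeneous (e - 1 + (e' - 1)) := by
  rw [wdg_apply]
  refine ((isHomogeneous_along_single hf a).mul (isHomogeneous_along_single hg b)).sub ?_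
  rw [mul_comm]
  exact (isHomogeneous_along_single hf b).mul (isHomogeneous_along_single hg a)

end bilinear
end LogForms

end

/-! ### Tangent vectors on strata of codimension three -/

noncomputable section
namespace LogForms
open MvPolynomial

theorem nzdMod_C {n : ℕ} (J : Ideal (Poly n)) {c : ℂ} (hc : c ≠ 0) : NzdMod J (C c) := by
  intro x hx
  have := J.mul_mem_left (C c⁻¹) hx
  rwa [← mul_assoc, ← C_mul, inv_mul_cancel₀ hc, C_1, one_mul] at this

/-- The product of the `F_r`, `r ∉ A`. -/
def hat {n m : ℕ} (F : Fin m → Poly n) (A : Finset (Fin m)) : Poly n := ∏ r ∈ Finset.univ \ A, F r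

theorem hat_eq_mul {n m : ℕ} (F : Fin m → Poly n) {A : Finset (Fin m)} {a : Fin m} (ha : a ∉ A) :
    hat F A = F a * hat F (insert a A) := by
  rw [hat, hat, ← Finset.mul_prod_erase _ F (a := a) (by simpa using ha)]
  congr 2
  ext x; simp

theorem hat_mem {n m : ℕ} (F : Fin m → Poly n) {A B : Finset (Fin m)} {b : Fin m} (hb : b ∈ B)
    (hA : b ∉ A) : hat F A ∈ stratum F B := by
  rw [hat_eq_mul F hA]; exact Ideal.mul_mem_right _ _ (mem_stratum hb)

theorem IsArrangement.nzdMod_hat {n m : ℕ} {d : Fin m → ℕ} {F : Fin m → Poly n}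
    {A B : Finset (Fin m)} (h : IsArrangement d F) (hA : A.card ≤ n) (hAB : A ⊆ B) :
    NzdMod (stratum F A) (hat F B) :=
  h.nzdMod_prod hA fun t ht htA => by simp at ht; exact ht (hAB htA)

theorem IsArrangement.isHomogeneous_hat {n m : ℕ} {d : Fin m → ℕ} {F : Fin m → Poly n}
    (h : IsArrangement d F) (A : Finset (Fin m)) :
    (hat F A).IsHomogeneous (∑ r ∈ Finset.univ \ A, d r) := h.isHomogeneous_prod _

/-- The genericity conditions on the residues of a logarithmic form. -/
structure IsGenericResidue {m : ℕ} (l : Fin m → Fin m → ℂ) : Prop where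
  swap : ∀ s t, l t s = - l s t
  ne_zero : ∀ s t, s ≠ t → l s t ≠ 0
  sum_ne_zero : ∀ i j k, i ≠ j → i ≠ k → j ≠ k → l i j - l i k + l j k ≠ 0

section tangent
variable {n m : ℕ} {d : Fin m → ℕ} {F : Fin m → Poly n} {l : Fin m → Fin m → ℂ}
  {A : Finset (Fin m)}

theorem logBil_mem_stratum (hl : ∀ s t, l t s = - l s t) {i j k : Fin m} (hij : i ≠ j)
    (hik : i ≠ k) (hjk : j ≠ k) (v w : VF n) :
    logBil l F Finset.univ v w ∈ stratum F {i, j, k} := by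
  have h1 := stratum_mono (F := F) (B := {i, j, k})
    (by intro x; simp; tauto) (logBil_sub_mem hl hij (Finset.mem_univ i) (Finset.mem_univ j) v w)
  have h2 : hat F {i, j} ∈ stratum F {i, j, k} := hat_mem F (b := k) (by simp)
    (by simp [hik.symm, hjk.symm])
  have h3 : C (l i j) * hat F {i, j} * (along v (F i) * along w (F j) - along v (F j) * along w (F i))
    ∈ stratum F {i, j, k} := Ideal.mul_mem_right _ _ (Ideal.mul_mem_left _ _ h2)
  have := Ideal.add_mem _ h1 h3
  rwa [hat, sub_add_cancel] at this

/-- Modulo J_ijk the form ω vanishes, so the second equation becomes i_v α ∧ dω = 0. On (w, X_i,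
X_j, X_k) only α(v, w) dω(X_i, X_j, X_k) remains, and the second factor is a nonzero constant times
F̂_ijk u³. -/
theorem IsTangent.mem_of_kills (hF : IsArrangement d F) (hn : 3 < n) (hl : IsGenericResidue l)
    {α : Bil n} (hα : IsTangent (logBil l F Finset.univ) α) (hA : A.card = 3) {v w : VF n}
    (hw : Kills F A w) : α v w ∈ stratum F A := by
  obtain ⟨i, j, k, hij, hik, hjk, rfl⟩ := Finset.card_eq_three.mp hA
  have hi : i ∈ ({i, j, k} : Finset (Fin m)) := by simp
  have hj : j ∈ ({i, j, k} : Finset (Fin m)) := by simp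
  have hk : k ∈ ({i, j, k} : Finset (Fin m)) := by simp
  refine hF.mem_of_dualFrame (by omega) fun X u hX => ⟨3, ?_⟩
  refine hF.nzdMod_hat (by omega) (Finset.Subset.refl _) _
    (nzdMod_C _ (hl.sum_ne_zero i j k hij hik hjk) _ ?_)
  have key := hα.wedgeD_eq v w (X i) (X j) (X k)
  have e := fun a b c => extB_logBil_sub_mem (F := F) (T := Finset.univ) hl.swap hij hik hjk
    (Finset.subset_univ _) a b c
  have o := fun w => logBil_mem_stratum (F := F) hl.swap hij hik hjk v w
  have e0 := e (X i) (X j) (X k)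
  have e1 := e w (X j) (X k)
  have e2 := e w (X i) (X k)
  have e3 := e w (X i) (X j)
  simp only [hX.self hi, hX.self hj, hX.self hk, hX.ne hi hj hij, hX.ne hi hk hik,
    hX.ne hj hi hij.symm, hX.ne hj hk hjk, hX.ne hk hi hik.symm, hX.ne hk hj hjk.symm,
    hw i hi, hw j hj, hw k hk] at e0 e1 e2 e3
  rw [← hat] at e0
  rw [← Ideal.Quotient.eq_zero_iff_mem] at e0 e1 e2 e3 ⊢
  simp only [← Ideal.Quotient.eq_zero_iff_mem] at o
  have key := congrArg (Ideal.Quotient.mk (stratum F {i, j, k})) key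
  simp only [wedgeD, map_add, map_sub, map_mul, map_zero, map_pow, o, mul_zero, zero_mul,
    sub_zero, add_zero] at key e0 e1 e2 e3 ⊢
  linear_combination key - (Ideal.Quotient.mk _ (α v w)) * e0 +
    (Ideal.Quotient.mk _ (α v (X i))) * e1 - (Ideal.Quotient.mk _ (α v (X j))) * e2 +
    (Ideal.Quotient.mk _ (α v (X k))) * e3

theorem DualFrame.sum_sum {X : Fin m → VF n} {u : Poly n} (h : DualFrame F A X u)
    (P : Fin m → Fin m → Poly n) {s t : Fin m} (hs : s ∈ A) (ht : t ∈ A) :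
    ∑ s' ∈ A, ∑ t' ∈ A, P s' t' * along (X s) (F s') * along (X t) (F t') = P s t * u * u := by
  rw [Finset.sum_eq_single s, Finset.sum_eq_single t, h.self hs, h.self ht]
  · intro t' ht' hne; rw [h.ne ht' ht hne, mul_zero]
  · exact fun h => absurd ht h
  · intro s' hs' hne
    exact Finset.sum_eq_zero fun t' _ => by rw [h.ne hs' hs hne]; ring
  · exact fun h => absurd hs h

theorem DualFrame.kills_of_notMem {X : Fin m → VF n} {u : Poly n} {B : Finset (Fin m)}
    (h : DualFrame F B X u) (hAB : A ⊆ B) {t : Fin m} (ht : t ∈ B) (htA : t ∉ A) :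
    Kills F A (X t) := fun s hs => h.ne (hAB hs) ht (by rintro rfl; exact htA hs)

/-- Modulo the ideal of a stratum of codimension three, a first order deformation is the derivative
of a logarithmic form. -/
theorem IsTangent.exists_eq (hF : IsArrangement d F) (hn : 3 < n) (hl : IsGenericResidue l)
    {α : Bil n} (hα : IsTangent (logBil l F Finset.univ) α) (hs : ∀ v w, α w v = - α v w)
    {i j k : Fin m} (hij : i ≠ j) (hik : i ≠ k) (hjk : j ≠ k) :
    ∃ gi gj gk : Poly n, ∀ v w, α v w - hat F {i, j, k} *
      (C (l j k) * gi * wdg (F j) (F k) v w + C (l i k) * gj * wdg (F i) (F k) v w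
        + C (l i j) * gk * wdg (F i) (F j) v w) ∈ stratum F {i, j, k} := by
  have hcard : ({i, j, k} : Finset (Fin m)).card = 3 := Finset.card_eq_three.mpr
    ⟨i, j, k, hij, hik, hjk, rfl⟩
  obtain ⟨P, hP⟩ := exists_sum_sum_along (A := {i, j, k}) hF.nc le_rfl
    (hF.hasDepth (by omega)) α (fun v w hv => by
      rw [hs w v]; exact neg_mem (hα.mem_of_kills hF hn hl hcard hv))
    fun v w hw => hα.mem_of_kills hF hn hl hcard hw
  have hPX {X : Fin m → VF n} {u : Poly n} (hX : DualFrame F {i, j, k} X u) {s t : Fin m}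
      (hs : s ∈ ({i, j, k} : Finset (Fin m))) (ht : t ∈ ({i, j, k} : Finset (Fin m))) :
      α (X s) (X t) - P s t * u * u ∈ stratum F {i, j, k} := by
    have := hP (X s) (X t)
    rwa [hX.sum_sum P hs ht] at this
  have hdiag : ∀ s ∈ ({i, j, k} : Finset (Fin m)), P s s ∈ stratum F {i, j, k} := by
    intro s hsA
    refine hF.mem_of_dualFrame (by omega) fun X u hX => ⟨2, ?_⟩
    have h1 := hPX hX hsA hsA
    rw [self_eq_neg.mp (hs (X s) (X s)), zero_sub, neg_mem_iff] at h1
    convert h1 using 1; ring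
  have hanti : ∀ s ∈ ({i, j, k} : Finset (Fin m)), ∀ t ∈ ({i, j, k} : Finset (Fin m)),
      P s t + P t s ∈ stratum F {i, j, k} := by
    intro s hsA t htA
    refine hF.mem_of_dualFrame (by omega) fun X u hX => ⟨2, ?_⟩
    have h1 := Ideal.add_mem _ (hPX hX hsA htA) (hPX hX htA hsA)
    rw [hs (X s) (X t), ← neg_mem_iff] at h1
    convert h1 using 1; ring
  -- Divisibility by F̂_ijk: for r outside the triple, X_t kills the other three of F_i, F_j, F_k,
  -- F_r, so α(X_s, X_t) = P_st u² vanishes modulo F_r as well.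
  have hoff : ∀ s ∈ ({i, j, k} : Finset (Fin m)), ∀ t ∈ ({i, j, k} : Finset (Fin m)), s ≠ t →
      ∃ c, P s t - c * hat F {i, j, k} ∈ stratum F {i, j, k} := by
    intro s hsA t htA hst
    refine hF.exists_sub_mul_prod_mem (by omega) (fun t ht => by simpa using ht) fun r hr => ?_
    have hr : r ∉ ({i, j, k} : Finset (Fin m)) := by simpa using hr
    have hc4 : (insert r ({i, j, k} : Finset (Fin m))).card = 4 := by
      rw [Finset.card_insert_of_notMem hr, hcard]
    refine hF.mem_of_dualFrame (by omega) fun X u hX => ⟨2, ?_⟩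
    have hsub := Finset.subset_insert r ({i, j, k} : Finset (Fin m))
    have h1 := stratum_mono (F := F) hsub (hPX (hX.mono hsub) hsA htA)
    have hc3 : ((insert r ({i, j, k} : Finset (Fin m))).erase t).card = 3 := by
      rw [Finset.card_erase_of_mem (hsub htA), hc4]
    have h2 := stratum_mono (F := F) (Finset.erase_subset _ _) (hα.mem_of_kills hF hn hl hc3
      (v := X s) (hX.kills_of_notMem (Finset.erase_subset _ _) (hsub htA)
        (Finset.notMem_erase t _)))
    convert Ideal.sub_mem _ h2 h1 using 1; ring
  have hi : i ∈ ({i, j, k} : Finset (Fin m)) := by simp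
  have hj : j ∈ ({i, j, k} : Finset (Fin m)) := by simp
  have hk : k ∈ ({i, j, k} : Finset (Fin m)) := by simp
  obtain ⟨ci, hci⟩ := hoff j hj k hk hjk
  obtain ⟨cj, hcj⟩ := hoff i hi k hk hik
  obtain ⟨ck, hck⟩ := hoff i hi j hj hij
  -- The residues are factored out so that the remaining g can be read as variations of the
  -- polynomials F_i.
  refine ⟨C (l j k)⁻¹ * ci, C (l i k)⁻¹ * cj, C (l i j)⁻¹ * ck, fun v w => ?_⟩
  have hinv : ∀ s t, s ≠ t → C (l s t) * C (l s t)⁻¹ = (1 : Poly n) := fun s t h => by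
    rw [← C_mul, mul_inv_cancel₀ (hl.ne_zero s t h), C_1]
  have h0 := hP v w
  have hnot1 : i ∉ ({j, k} : Finset (Fin m)) := by simp [hij, hik]
  simp only [Finset.sum_insert hnot1, Finset.sum_pair hjk] at h0
  have d1 := hdiag i hi
  have d2 := hdiag j hj
  have d3 := hdiag k hk
  have a1 := hanti j hj k hk
  have a2 := hanti i hi k hk
  have a3 := hanti i hi j hj
  rw [← mul_assoc (C (l j k)), ← mul_assoc (C (l i k)), ← mul_assoc (C (l i j)), hinv _ _ hjk,
    hinv _ _ hik, hinv _ _ hij]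
  simp only [wdg_apply]
  rw [← Ideal.Quotient.eq_zero_iff_mem] at *
  simp only [map_add, map_sub, map_mul, map_one] at *
  generalize (Ideal.Quotient.mk (stratum F {i, j, k})) = π at *
  linear_combination h0 + d1 * π (along v (F i)) * π (along w (F i))
    + d2 * π (along v (F j)) * π (along w (F j)) + d3 * π (along v (F k)) * π (along w (F k))
    + a1 * π (along v (F k)) * π (along w (F j)) + a2 * π (along v (F k)) * π (along w (F i))
    + a3 * π (along v (F j)) * π (along w (F i))
    + hci * (π (along v (F j)) * π (along w (F k)) - π (along v (F k)) * π (along w (F j)))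
    + hcj * (π (along v (F i)) * π (along w (F k)) - π (along v (F k)) * π (along w (F i)))
    + hck * (π (along v (F i)) * π (along w (F j)) - π (along v (F j)) * π (along w (F i)))

end tangent
end LogForms

end

/-! ### Division of the linearized equations by the F_j -/

noncomputable section
namespace LogForms
open MvPolynomial

section compat
variable {n m : ℕ} {d : Fin m → ℕ} {F : Fin m → Poly n} {l : Fin m → Fin m → ℂ}

/-- The value a is a multiple of F_j only modulo the larger ideal J_D. Dividing x a modulo F_i first
gives a quotient b whose reduction to D is the expected x g. -/
theorem IsArrangement.exists_quotient (hF : IsArrangement d F) {i j : Fin m}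
    {D : Finset (Fin m)} (hD : D.card ≤ n) (hi : i ∈ D) (hj : j ∉ D) {x a g : Poly n}
    (hxa : x * a ∈ stratum F {j, i}) (ha : a - F j * g ∈ stratum F D) :
    ∃ b, x * a - F j * b ∈ stratum F {i} ∧ b - x * g ∈ stratum F D := by
  obtain ⟨b, hb⟩ := mem_stratum_insert.mp hxa
  refine ⟨b, by rwa [mul_comm (F j)], hF.nzdMod hD hj _ ?_⟩
  have h1 := stratum_mono (F := F) (B := D) (by simpa using hi) hb
  convert Ideal.sub_mem _ (Ideal.mul_mem_left _ x ha) h1 using 1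
  ring

/-- The hypothesis is the first equation on a frame of four fields. Reducing it modulo F_j, F_k or
F_t isolates one term and makes it divisible; then F_j F_k F_t cancels modulo F_i, and only
afterwards is the quotient restricted to codimension four. -/
theorem IsArrangement.wedge_quotient (hF : IsArrangement d F) (hn : 3 < n) {i j k t : Fin m}
    (hij : i ≠ j) (hik : i ≠ k) (hit : i ≠ t) (hjk : j ≠ k) (hjt : j ≠ t) (hkt : k ≠ t)
    {a₁ a₂ a₃ W₁ W₂ W₃ g₁ g₂ g₃ : Poly n}
    (h : F k * F t * W₁ * a₁ - F j * F t * W₂ * a₂ + F j * F k * W₃ * a₃ ∈ stratum F {i})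
    (h₁ : a₁ - F j * g₁ ∈ stratum F {i, k, t}) (h₂ : a₂ - F k * g₂ ∈ stratum F {i, j, t})
    (h₃ : a₃ - F t * g₃ ∈ stratum F {i, j, k}) :
    W₁ * g₁ - W₂ * g₂ + W₃ * g₃ ∈ stratum F {i, j, k, t} := by
  have c2 : ∀ a b : Fin m, ({a, b} : Finset (Fin m)).card ≤ n :=
    fun a b => Finset.card_le_two.trans (by omega)
  have c3 : ∀ a b c : Fin m, ({a, b, c} : Finset (Fin m)).card ≤ n :=
    fun a b c => Finset.card_le_three.trans (by omega)
  have hm : ∀ r, stratum F {i} ≤ stratum F {r, i} := fun r => stratum_mono (by simp)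
  have hr : ∀ r x, F r * x ∈ stratum F {r, i} :=
    fun r x => Ideal.mul_mem_right _ _ (mem_stratum (by simp))
  have w₁ : W₁ * a₁ ∈ stratum F {j, i} := by
    refine hF.nzdMod (c2 _ _) (p := t) (by simp [hjt.symm, hit.symm]) _
      (hF.nzdMod (c2 _ _) (p := k) (by simp [hjk.symm, hik.symm]) _ ?_)
    convert Ideal.add_mem _ (hm j h) (hr j (F t * W₂ * a₂ - F k * W₃ * a₃)) using 1
    ring
  have w₂ : W₂ * a₂ ∈ stratum F {k, i} := by
    refine hF.nzdMod (c2 _ _) (p := t) (by simp [hkt.symm, hit.symm]) _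
      (hF.nzdMod (c2 _ _) (p := j) (by simp [hjk, hij.symm]) _ ?_)
    convert Ideal.sub_mem _ (hr k (F t * W₁ * a₁ + F j * W₃ * a₃)) (hm k h) using 1
    ring
  have w₃ : W₃ * a₃ ∈ stratum F {t, i} := by
    refine hF.nzdMod (c2 _ _) (p := k) (by simp [hkt, hik.symm]) _
      (hF.nzdMod (c2 _ _) (p := j) (by simp [hjt, hij.symm]) _ ?_)
    convert Ideal.add_mem _ (hm t h) (hr t (F j * W₂ * a₂ - F k * W₁ * a₁)) using 1
    ring
  obtain ⟨b₁, hb₁, hb₁'⟩ := hF.exists_quotient (c3 _ _ _) (by simp) (by simp [hij.symm, hjk, hjt])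
    w₁ h₁
  obtain ⟨b₂, hb₂, hb₂'⟩ := hF.exists_quotient (c3 _ _ _) (by simp)
    (by simp [hik.symm, hjk.symm, hkt]) w₂ h₂
  obtain ⟨b₃, hb₃, hb₃'⟩ := hF.exists_quotient (c3 _ _ _) (by simp)
    (by simp [hit.symm, hjt.symm, hkt.symm]) w₃ h₃
  have c1 : ({i} : Finset (Fin m)).card ≤ n := by simp; omega
  have hb : b₁ - b₂ + b₃ ∈ stratum F {i} := by
    refine hF.nzdMod c1 (p := j) (by simp [hij.symm]) _
      (hF.nzdMod c1 (p := k) (by simp [hik.symm]) _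
        (hF.nzdMod c1 (p := t) (by simp [hit.symm]) _ ?_))
    convert Ideal.sub_mem _ h (Ideal.add_mem _ (Ideal.sub_mem _
      (Ideal.mul_mem_left _ (F k * F t) hb₁) (Ideal.mul_mem_left _ (F j * F t) hb₂))
      (Ideal.mul_mem_left _ (F j * F k) hb₃)) using 1
    ring
  have s0 := stratum_mono (F := F) (B := {i, j, k, t}) (by simp) hb
  have s1 := stratum_mono (F := F) (B := {i, j, k, t}) (by intro x; simp; tauto) hb₁'
  have s2 := stratum_mono (F := F) (B := {i, j, k, t}) (by intro x; simp; tauto) hb₂'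
  have s3 := stratum_mono (F := F) (B := {i, j, k, t}) (by intro x; simp; tauto) hb₃'
  convert Ideal.sub_mem _ s0 (Ideal.add_mem _ (Ideal.sub_mem _ s1 s2) s3) using 1
  ring

/-- The same division for the second equation, where F_k F_t is the common factor and Z carries dα.
-/
theorem IsArrangement.wedgeD_quotient (hF : IsArrangement d F) (hn : 3 < n) {i j k t : Fin m}
    (hik : i ≠ k) (hit : i ≠ t) (hjk : j ≠ k) (hjt : j ≠ t) (hkt : k ≠ t)
    {a₂ a₃ V V' Z g₂ g₃ : Poly n}
    (h : F k * V * a₃ - F t * V' * a₂ - F k * F t * Z ∈ stratum F {i})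
    (h₂ : a₂ - F k * g₂ ∈ stratum F {i, j, t})
    (h₃ : a₃ - F t * g₃ ∈ stratum F {i, j, k}) :
    V * g₃ - V' * g₂ - Z ∈ stratum F {i, j, k, t} := by
  have c2 : ∀ a b : Fin m, ({a, b} : Finset (Fin m)).card ≤ n :=
    fun a b => Finset.card_le_two.trans (by omega)
  have c3 : ∀ a b c : Fin m, ({a, b, c} : Finset (Fin m)).card ≤ n :=
    fun a b c => Finset.card_le_three.trans (by omega)
  have hm : ∀ r, stratum F {i} ≤ stratum F {r, i} := fun r => stratum_mono (by simp)
  have hr : ∀ r x, F r * x ∈ stratum F {r, i} :=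
    fun r x => Ideal.mul_mem_right _ _ (mem_stratum (by simp))
  have w₂ : V' * a₂ ∈ stratum F {k, i} := by
    refine hF.nzdMod (c2 _ _) (p := t) (by simp [hkt.symm, hit.symm]) _ ?_
    convert Ideal.sub_mem _ (hr k (V * a₃ - F t * Z)) (hm k h) using 1
    ring
  have w₃ : V * a₃ ∈ stratum F {t, i} := by
    refine hF.nzdMod (c2 _ _) (p := k) (by simp [hkt, hik.symm]) _ ?_
    convert Ideal.add_mem _ (hm t h) (hr t (V' * a₂ + F k * Z)) using 1
    ring
  obtain ⟨b₂, hb₂, hb₂'⟩ := hF.exists_quotient (c3 _ _ _) (by simp)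
    (by simp [hik.symm, hjk.symm, hkt]) w₂ h₂
  obtain ⟨b₃, hb₃, hb₃'⟩ := hF.exists_quotient (c3 _ _ _) (by simp)
    (by simp [hit.symm, hjt.symm, hkt.symm]) w₃ h₃
  have c1 : ({i} : Finset (Fin m)).card ≤ n := by simp; omega
  have hb : b₃ - b₂ - Z ∈ stratum F {i} := by
    refine hF.nzdMod c1 (p := k) (by simp [hik.symm]) _
        (hF.nzdMod c1 (p := t) (by simp [hit.symm]) _ ?_)
    convert Ideal.sub_mem _ h (Ideal.sub_mem _ (Ideal.mul_mem_left _ (F k) hb₃)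
      (Ideal.mul_mem_left _ (F t) hb₂)) using 1
    ring
  have s0 := stratum_mono (F := F) (B := {i, j, k, t}) (by simp) hb
  have s2 := stratum_mono (F := F) (B := {i, j, k, t}) (by intro x; simp; tauto) hb₂'
  have s3 := stratum_mono (F := F) (B := {i, j, k, t}) (by intro x; simp; tauto) hb₃'
  convert Ideal.sub_mem _ s0 (Ideal.sub_mem _ s3 s2) using 1
  ring

end compat
end LogForms

end

/-! ### Comparison of the local variations in codimension four -/

noncomputable section
namespace LogForms
open MvPolynomial

section compat
variable {n m : ℕ} {d : Fin m → ℕ} {F : Fin m → Poly n} {l : Fin m → Fin m → ℂ}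

/-- On the vector fields that kill `F_i`, and modulo `(F_i, F_j, F_k)`, the form `α` is
`l_{jk} F̂_{ijk} g dF_j ∧ dF_k`. -/
def HasResidue (l : Fin m → Fin m → ℂ) (F : Fin m → Poly n) (α : Bil n) (i j k : Fin m)
    (g : Poly n) : Prop :=
  ∀ v w, along v (F i) = 0 → along w (F i) = 0 →
    α v w - hat F {i, j, k} * (C (l j k) * g * wdg (F j) (F k) v w) ∈ stratum F {i, j, k}

/-- In codimension three α is a multiple of F̂_ijk, which contains F_t. -/
theorem IsTangent.mem_of_four (hF : IsArrangement d F) (hn : 3 < n) (hl : IsGenericResidue l)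
    {α : Bil n} (hα : IsTangent (logBil l F Finset.univ) α) (hs : ∀ v w, α w v = - α v w)
    {i j k t : Fin m} (hij : i ≠ j) (hik : i ≠ k) (hit : i ≠ t) (hjk : j ≠ k) (hjt : j ≠ t)
    (hkt : k ≠ t) (v w : VF n) : α v w ∈ stratum F {i, j, k, t} := by
  obtain ⟨gi, gj, gk, h⟩ := hα.exists_eq hF hn hl hs hij hik hjk
  have h1 := stratum_mono (F := F) (B := {i, j, k, t}) (by grind) (h v w)
  have h2 : hat F {i, j, k} ∈ stratum F {i, j, k, t} :=
    hat_mem F (b := t) (by simp) (by simp [hit.symm, hjt.symm, hkt.symm])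
  have := Ideal.add_mem _ h1 (Ideal.mul_mem_right (C (l j k) * gi * wdg (F j) (F k) v w
    + C (l i k) * gj * wdg (F i) (F k) v w + C (l i j) * gk * wdg (F i) (F j) v w) _ h2)
  rwa [sub_add_cancel] at this

/-- Differentiating x ≡ F_j g along a field that preserves J_D, the term F_j v(g) drops out modulo
F_j. This computes dα where α itself vanishes. -/
theorem along_sub_mem {D : Finset (Fin m)} {v : VF n} (hv : Kills F D v) {j : Fin m}
    {x g : Poly n} (hx : x - F j * g ∈ stratum F D) :
    along v x - along v (F j) * g ∈ stratum F (insert j D) := by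
  have h1 := along_mem_stratum (v := v) (fun s hs => by rw [hv s hs]; exact Ideal.zero_mem _) hx
  have h2 : F j ∈ stratum F (insert j D) := mem_stratum (by simp)
  convert Ideal.add_mem _ (stratum_mono (Finset.subset_insert j D) h1)
    (Ideal.mul_mem_right (along v g) _ h2) using 1
  rw [map_sub, Derivation.leibniz, smul_eq_mul, smul_eq_mul]
  ring

theorem logBil_erase_erase {a b : Fin m} (hab : a ≠ b) {v w : VF n} (hv : along v (F a) = 0)
    (hw : along w (F a) = 0) (hv' : along v (F b) = 0) (hw' : along w (F b) = 0) :
    logBil l F Finset.univ v w =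
      F a * F b * logBil l F ((Finset.univ.erase a).erase b) v w := by
  rw [logBil_eq_mul (Finset.mem_univ a) hv hw,
    logBil_eq_mul (T := Finset.univ.erase a) (a := b) (by simp [hab.symm]) hv' hw', mul_assoc]

theorem logBil_erase_erase_sub_mem (hl : ∀ s t, l t s = - l s t) {i j k t : Fin m} (hij : i ≠ j)
    (hik : i ≠ k) (hit : i ≠ t) (hjk : j ≠ k) (hjt : j ≠ t) (v w : VF n) :
    logBil l F ((Finset.univ.erase k).erase t) v w -
      C (l i j) * hat F {i, j, k, t} * wdg (F i) (F j) v w ∈ stratum F {i, j} := by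
  have := logBil_sub_mem (F := F) (T := (Finset.univ.erase k).erase t) hl hij
    (by simp [hik, hit]) (by simp [hjk, hjt]) v w
  have e : (Finset.univ.erase k).erase t \ {i, j} = Finset.univ \ {i, j, k, t} := by
    grind
  rwa [e, ← wdg_apply] at this

theorem extB_logBil_erase_sub_mem (hl : ∀ s t, l t s = - l s t) {i j k t : Fin m} (hij : i ≠ j)
    (hik : i ≠ k) (hit : i ≠ t) (hjk : j ≠ k) (hjt : j ≠ t) (hkt : k ≠ t) {X : Fin m → VF n}
    {u : Poly n} (hX : DualFrame F {i, j, k} X u) :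
    extB (logBil l F (Finset.univ.erase t)) (X i) (X j) (X k) -
      C (l i j - l i k + l j k) * hat F {i, j, k, t} * u ^ 3 ∈ stratum F {i, j, k} := by
  have := extB_logBil_sub_mem (F := F) (T := Finset.univ.erase t) hl hij hik hjk
    (by intro x; simp; rintro (rfl | rfl | rfl) <;> assumption) (X i) (X j) (X k)
  have e : Finset.univ.erase t \ {i, j, k} = Finset.univ \ {i, j, k, t} := by
    grind
  have hi : i ∈ ({i, j, k} : Finset (Fin m)) := by simp
  have hj : j ∈ ({i, j, k} : Finset (Fin m)) := by simp
  have hk : k ∈ ({i, j, k} : Finset (Fin m)) := by simp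
  rw [e] at this
  simp only [hX.self hi, hX.self hj, hX.self hk, hX.ne hi hj hij, hX.ne hi hk hik,
    hX.ne hj hi hij.symm, hX.ne hj hk hjk, hX.ne hk hi hik.symm, hX.ne hk hj hjk.symm] at this
  convert this using 2
  rw [hat]; ring

/-- The `transport` terms are values of α, hence in J; modulo J the exterior derivative needs no
knowledge of brackets of the frame. -/
theorem extB_sub_mem {α : Bil n} {J : Ideal (Poly n)} (hα : ∀ v w, α v w ∈ J) (u v w : VF n) :
    extB α u v w - (along u (α v w) - along v (α u w) + along w (α u v)) ∈ J := by
  have h1 := J.add_mem (hα (transport u v) w) (hα v (transport u w))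
  have h2 := J.add_mem (hα (transport v u) w) (hα u (transport v w))
  have h3 := J.add_mem (hα (transport w u) v) (hα u (transport w v))
  convert J.sub_mem (J.sub_mem h2 h1) h3 using 1
  simp only [extB, nab]
  ring

-- Up to factors F̂_ijkt and u, the first equation gives λ_ij λ_kt g₁ − λ_ik λ_jt g₂ + λ_it λ_jk g₃
-- = 0. The second gives (λ_ij − λ_it + λ_jt) λ_jk g₃ − (λ_ij − λ_ik + λ_jk) λ_jt g₂ = λ_ij (λ_kt g₁
-- − λ_jt g₂ + λ_jk g₃), the bracket being dα on the frame. Eliminating g₁ leaves λ_jk λ_jt (g₃ −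
-- g₂) = 0.
set_option maxHeartbeats 1000000 in
theorem IsTangent.residue_sub_mem (hF : IsArrangement d F) (hn : 3 < n) (hl : IsGenericResidue l)
    {α : Bil n} (hα : IsTangent (logBil l F Finset.univ) α) (hs : ∀ v w, α w v = - α v w)
    {i j k t : Fin m} (hij : i ≠ j) (hik : i ≠ k) (hit : i ≠ t) (hjk : j ≠ k) (hjt : j ≠ t)
    (hkt : k ≠ t) {g₁ g₂ g₃ : Poly n} (h₁ : HasResidue l F α i k t g₁)
    (h₂ : HasResidue l F α i j t g₂) (h₃ : HasResidue l F α i j k g₃) :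
    g₃ - g₂ ∈ stratum F {i, j, k, t} := by
  have hcard : ({i, j, k, t} : Finset (Fin m)).card ≤ n := Finset.card_le_four.trans (by omega)
  refine hF.mem_of_dualFrame hcard fun X u hX => ⟨5, ?_⟩
  have hi : i ∈ ({i, j, k, t} : Finset (Fin m)) := by simp
  have hj : j ∈ ({i, j, k, t} : Finset (Fin m)) := by simp
  have hk : k ∈ ({i, j, k, t} : Finset (Fin m)) := by simp
  have ht : t ∈ ({i, j, k, t} : Finset (Fin m)) := by simp
  have nij := hX.ne hi hj hij
  have nik := hX.ne hi hk hik
  have nit := hX.ne hi ht hit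
  have nji := hX.ne hj hi hij.symm
  have njk := hX.ne hj hk hjk
  have njt := hX.ne hj ht hjt
  have nki := hX.ne hk hi hik.symm
  have nkj := hX.ne hk hj hjk.symm
  have nkt := hX.ne hk ht hkt
  have nti := hX.ne ht hi hit.symm
  have ntj := hX.ne ht hj hjt.symm
  have ntk := hX.ne ht hk hkt.symm
  have hFi : F i ∈ stratum F {i} := mem_stratum (by simp)
  set H := hat F {i, j, k, t} with hH
  have e1 : hat F {i, k, t} = F j * H := by
    rw [hH, Finset.insert_comm i j]; exact hat_eq_mul F (by simp [hij.symm, hjk, hjt])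
  have e2 : hat F {i, j, t} = F k * H := by
    rw [hH, show ({i, j, k, t} : Finset (Fin m)) = insert k {i, j, t} by grind]
    exact hat_eq_mul F (by simp [hik.symm, hjk.symm, hkt])
  have e3 : hat F {i, j, k} = F t * H := by
    rw [hH, show ({i, j, k, t} : Finset (Fin m)) = insert t {i, j, k} by grind]
    exact hat_eq_mul F (by simp [hit.symm, hjt.symm, hkt.symm])
  have a1 : α (X k) (X t) - F j * (H * (C (l k t) * g₁ * u ^ 2)) ∈ stratum F {i, k, t} := by
    convert h₁ (X k) (X t) nik nit using 2
    rw [e1, wdg_apply, hX.self hk, hX.self ht, nkt, ntk]; ring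
  have a2 : α (X j) (X t) - F k * (H * (C (l j t) * g₂ * u ^ 2)) ∈ stratum F {i, j, t} := by
    convert h₂ (X j) (X t) nij nit using 2
    rw [e2, wdg_apply, hX.self hj, hX.self ht, njt, ntj]; ring
  have a3 : α (X j) (X k) - F t * (H * (C (l j k) * g₃ * u ^ 2)) ∈ stratum F {i, j, k} := by
    convert h₃ (X j) (X k) nij nik using 2
    rw [e3, wdg_apply, hX.self hj, hX.self hk, njk, nkj]; ring
  have E1 := hF.wedge_quotient hn hij hik hit hjk hjt hkt
    (W₁ := logBil l F ((Finset.univ.erase k).erase t) (X i) (X j))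
    (W₂ := logBil l F ((Finset.univ.erase j).erase t) (X i) (X k))
    (W₃ := logBil l F ((Finset.univ.erase j).erase k) (X i) (X t)) (by
      have key := hα.wedge_eq (X i) (X j) (X k) (X t)
      rw [wedgeB, logBil_erase_erase hkt nki nkj nti ntj, logBil_erase_erase hjt nji njk nti ntk,
        logBil_erase_erase hjk nji njt nki nkt, logBil_eq_mul (Finset.mem_univ i) nij nik,
        logBil_eq_mul (Finset.mem_univ i) nij nit, logBil_eq_mul (Finset.mem_univ i) nik nit] at key
      convert Ideal.mul_mem_right (logBil l F (Finset.univ.erase i) (X j) (X t) * α (X i) (X k) -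
        logBil l F (Finset.univ.erase i) (X j) (X k) * α (X i) (X t) -
        logBil l F (Finset.univ.erase i) (X k) (X t) * α (X i) (X j)) _ hFi using 1
      linear_combination key) a1 a2 a3
  -- Contraction with X_j and evaluation on (X_i, X_j, X_k, X_t): α(X_j, X_j) is zero, and the other
  -- discarded terms contain F_i.
  have E2 := hF.wedgeD_quotient hn hik hit hjk hjt hkt
    (V := extB (logBil l F (Finset.univ.erase k)) (X i) (X j) (X t))
    (V' := extB (logBil l F (Finset.univ.erase t)) (X i) (X j) (X k))
    (Z := - (logBil l F ((Finset.univ.erase k).erase t) (X j) (X i) * extB α (X j) (X k) (X t))) (by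
      have key := hα.wedgeD_eq (X j) (X i) (X j) (X k) (X t)
      rw [wedgeD, wedgeD, self_eq_neg.mp (hs (X j) (X j)), extB_logBil_eq_mul hl.swap
        (Finset.mem_univ i) nij nik nit, extB_logBil_eq_mul hl.swap (Finset.mem_univ k) nki nkj nkt,
        extB_logBil_eq_mul hl.swap (Finset.mem_univ t) nti ntj ntk,
        logBil_erase_erase hkt nkj nki ntj nti, logBil_eq_mul (Finset.mem_univ i) nij nij,
        logBil_eq_mul (Finset.mem_univ i) nij nik, logBil_eq_mul (Finset.mem_univ i) nij nit] at key
      convert Ideal.mul_mem_right (- α (X j) (X i) *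
        extB (logBil l F (Finset.univ.erase i)) (X j) (X k) (X t) +
        logBil l F (Finset.univ.erase i) (X j) (X j) * extB α (X i) (X k) (X t) -
        logBil l F (Finset.univ.erase i) (X j) (X k) * extB α (X i) (X j) (X t) +
        logBil l F (Finset.univ.erase i) (X j) (X t) * extB α (X i) (X j) (X k)) _ hFi using 1
      linear_combination key) a2 a3
  have w1 := stratum_mono (F := F) (B := {i, j, k, t}) (by grind)
    (logBil_erase_erase_sub_mem (F := F) hl.swap hij hik hit hjk hjt (X i) (X j))
  have w1' := stratum_mono (F := F) (B := {i, j, k, t}) (by grind)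
    (logBil_erase_erase_sub_mem (F := F) hl.swap hij hik hit hjk hjt (X j) (X i))
  have w2 := stratum_mono (F := F) (B := {i, j, k, t}) (by grind)
    (logBil_erase_erase_sub_mem (F := F) hl.swap hik hij hit hjk.symm hkt (X i) (X k))
  have w3 := stratum_mono (F := F) (B := {i, j, k, t}) (by grind)
    (logBil_erase_erase_sub_mem (F := F) hl.swap hit hij hik hjt.symm hkt.symm (X i) (X t))
  have v1 := stratum_mono (F := F) (B := {i, j, k, t}) (by grind)
    (extB_logBil_erase_sub_mem (F := F) hl.swap hij hit hik hjt hjk hkt.symm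
      (hX.mono (by grind)))
  have v2 := stratum_mono (F := F) (B := {i, j, k, t}) (by grind)
    (extB_logBil_erase_sub_mem (F := F) hl.swap hij hik hit hjk hjt hkt
      (hX.mono (by grind)))
  rw [show ({i, k, j, t} : Finset (Fin m)) = {i, j, k, t} by grind] at w2
  rw [show ({i, t, j, k} : Finset (Fin m)) = {i, j, k, t} by grind] at w3
  rw [show ({i, j, t, k} : Finset (Fin m)) = {i, j, k, t} by grind] at v1
  rw [← hH] at w1 w1' w2 w3 v1 v2
  simp only [wdg_apply, hX.self hi, hX.self hj, hX.self hk, hX.self ht, nij, nik, nit, nji, nki,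
    nti] at w1 w1' w2 w3
  have y := extB_sub_mem (fun v w => hα.mem_of_four hF hn hl hs hij hik hit hjk hjt hkt v w)
    (X j) (X k) (X t)
  have y1 := stratum_mono (F := F) (B := {i, j, k, t}) (by grind)
    (along_sub_mem (hX.kills_of_notMem (by grind) hj
      (by simp [hij.symm, hjk, hjt])) a1)
  have y2 := stratum_mono (F := F) (B := {i, j, k, t}) (by grind)
    (along_sub_mem (hX.kills_of_notMem (by grind) hk
      (by simp [hik.symm, hjk.symm, hkt])) a2)
  have y3 := stratum_mono (F := F) (B := {i, j, k, t}) (by grind)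
    (along_sub_mem (hX.kills_of_notMem (by grind) ht
      (by simp [hit.symm, hjt.symm, hkt.symm])) a3)
  rw [hX.self hj] at y1
  rw [hX.self hk] at y2
  rw [hX.self ht] at y3
  refine hF.nzdMod_hat hcard (Finset.Subset.refl _) _ (hF.nzdMod_hat hcard (Finset.Subset.refl _) _
    (nzdMod_C _ (hl.ne_zero j k hjk) _ (nzdMod_C _ (hl.ne_zero j t hjt) _ ?_)))
  rw [← hH]
  rw [← Ideal.Quotient.eq_zero_iff_mem] at E1 E2 w1 w1' w2 w3 v1 v2 y y1 y2 y3 ⊢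
  simp only [map_sub, map_add, map_mul, map_pow, map_neg, mul_zero, sub_zero, zero_sub]
    at E1 E2 w1 w1' w2 w3 v1 v2 y y1 y2 y3 ⊢
  generalize Ideal.Quotient.mk (stratum F {i, j, k, t}) = π at *
  rw [sub_eq_zero] at w1 w1' w2 w3 v1 v2 y y1 y2 y3
  rw [y1, y2, y3] at y
  rw [w1, w2, w3] at E1
  rw [v1, v2, w1', y] at E2
  linear_combination π u * E1 + E2

end compat
end LogForms

end

/-! ### Gluing the variations and subtracting them -/

noncomputable section
namespace LogForms
open MvPolynomial

section residues
variable {n m : ℕ} {d : Fin m → ℕ} {F : Fin m → Poly n} {l : Fin m → Fin m → ℂ} {α : Bil n}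

theorem HasResidue.symm (hl : ∀ s t, l t s = - l s t) {i j k : Fin m} {g : Poly n}
    (h : HasResidue l F α i j k g) : HasResidue l F α i k j g := by
  intro v w hv hw
  have := h v w hv hw
  rw [show ({i, j, k} : Finset (Fin m)) = {i, k, j} by grind] at this
  convert this using 2
  rw [hl j k, wdg_apply, wdg_apply, C_neg]
  ring

/-- Uniqueness: on the frame, α(X_j, X_k) equals λ_jk F̂_ijk g u², and the cofactor of g is a
nonzerodivisor. -/
theorem HasResidue.sub_mem (hF : IsArrangement d F) (hn : 3 < n) (hl : IsGenericResidue l)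
    {i j k : Fin m} (hij : i ≠ j) (hik : i ≠ k) (hjk : j ≠ k) {g g' : Poly n}
    (h : HasResidue l F α i j k g) (h' : HasResidue l F α i j k g') :
    g - g' ∈ stratum F {i, j, k} := by
  have hcard : ({i, j, k} : Finset (Fin m)).card ≤ n := Finset.card_le_three.trans (by omega)
  refine hF.mem_of_dualFrame hcard fun X u hX => ⟨2, ?_⟩
  refine hF.nzdMod_hat hcard (Finset.Subset.refl _) _ (nzdMod_C _ (hl.ne_zero j k hjk) _ ?_)
  have hi : i ∈ ({i, j, k} : Finset (Fin m)) := by simp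
  have hj : j ∈ ({i, j, k} : Finset (Fin m)) := by simp
  have hk : k ∈ ({i, j, k} : Finset (Fin m)) := by simp
  have e := h (X j) (X k) (hX.ne hi hj hij) (hX.ne hi hk hik)
  have e' := h' (X j) (X k) (hX.ne hi hj hij) (hX.ne hi hk hik)
  rw [wdg_apply, hX.self hj, hX.self hk, hX.ne hj hk hjk, hX.ne hk hj hjk.symm] at e e'
  convert Ideal.sub_mem _ e' e using 1
  ring

theorem HasResidue.congr {i j k : Fin m} {g g' : Poly n} (h : HasResidue l F α i j k g)
    (hg : g' - g ∈ stratum F {i, j, k}) : HasResidue l F α i j k g' := by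
  intro v w hv hw
  convert Ideal.sub_mem _ (h v w hv hw)
    (Ideal.mul_mem_left _ (hat F {i, j, k} * (C (l j k) * wdg (F j) (F k) v w)) hg) using 1
  ring

theorem IsTangent.exists_hasResidue (hF : IsArrangement d F) (hn : 3 < n)
    (hl : IsGenericResidue l) (hα : IsTangent (logBil l F Finset.univ) α)
    (hs : ∀ v w, α w v = - α v w) {i j k : Fin m} (hij : i ≠ j) (hik : i ≠ k) (hjk : j ≠ k) :
    ∃ g, HasResidue l F α i j k g := by
  obtain ⟨gi, gj, gk, h⟩ := hα.exists_eq hF hn hl hs hij hik hjk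
  refine ⟨gi, fun v w hv hw => ?_⟩
  convert h v w using 2
  rw [wdg_apply (F i), wdg_apply (F i), hv, hw]
  ring

/-- Two successive gluings. For fixed i, j the g_jk agree in codimension four by
`IsTangent.residue_sub_mem` and glue over k to a function modulo J_ij. These agree in codimension
three, by symmetry in j, k and uniqueness, and glue over j. -/
theorem IsTangent.exists_forall_hasResidue (hF : IsArrangement d F) (hn : 3 < n)
    (hl : IsGenericResidue l) (hα : IsTangent (logBil l F Finset.univ) α)
    (hs : ∀ v w, α w v = - α v w) (i : Fin m) :
    ∃ g, ∀ j k, i ≠ j → i ≠ k → j ≠ k → HasResidue l F α i j k g := by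
  have h0 : ∀ j k, ∃ g, i ≠ j → i ≠ k → j ≠ k → HasResidue l F α i j k g := by
    intro j k
    by_cases h : i ≠ j ∧ i ≠ k ∧ j ≠ k
    · obtain ⟨g, hg⟩ := hα.exists_hasResidue hF hn hl hs h.1 h.2.1 h.2.2
      exact ⟨g, fun _ _ _ => hg⟩
    · exact ⟨0, fun h1 h2 h3 => absurd ⟨h1, h2, h3⟩ h⟩
  choose g hg using h0
  have h1 : ∀ j, ∃ x, i ≠ j → ∀ k, i ≠ k → j ≠ k → x - g j k ∈ stratum F {i, j, k} := by
    intro j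
    by_cases hij : i = j
    · exact ⟨0, fun h => absurd hij h⟩
    · obtain ⟨x, hx⟩ := hF.exists_sub_mem_insert (A := {i, j}) (T := Finset.univ \ {i, j})
        (by rw [Finset.card_pair hij]; omega) (fun t ht => by simpa using ht) (g j)
        (fun s hs' t ht hst => by
          simp only [Finset.mem_sdiff, Finset.mem_univ, true_and, Finset.mem_insert,
            Finset.mem_singleton, not_or] at hs' ht
          have := hα.residue_sub_mem hF hn hl hs hij (Ne.symm hs'.1) (Ne.symm ht.1) (Ne.symm hs'.2)
            (Ne.symm ht.2) hst (hg s t (Ne.symm hs'.1) (Ne.symm ht.1) hst)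
            (hg j t hij (Ne.symm ht.1) (Ne.symm ht.2)) (hg j s hij (Ne.symm hs'.1) (Ne.symm hs'.2))
          rwa [show insert s (insert t ({i, j} : Finset (Fin m))) = {i, j, s, t} by grind])
      refine ⟨x, fun _ k hik hjk => ?_⟩
      have := hx k (by simp [hik.symm, hjk.symm])
      rwa [show insert k ({i, j} : Finset (Fin m)) = {i, j, k} by grind] at this
  choose x hx using h1
  obtain ⟨y, hy⟩ := hF.exists_sub_mem_insert (A := {i}) (T := Finset.univ \ {i})
    (by simp; omega) (fun t ht => by simpa using ht) x (fun s hs' t ht hst => by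
      simp only [Finset.mem_sdiff, Finset.mem_univ, true_and, Finset.mem_singleton] at hs' ht
      have his : i ≠ s := Ne.symm hs'
      have hit : i ≠ t := Ne.symm ht
      have k1 := hx s his t hit hst
      have k2 := hx t hit s his hst.symm
      have k3 := (hg s t his hit hst).sub_mem hF hn hl his hit hst
        ((hg t s hit his hst.symm).symm hl.swap)
      rw [show ({i, t, s} : Finset (Fin m)) = {i, s, t} by grind] at k2
      rw [show insert s (insert t ({i} : Finset (Fin m))) = {i, s, t} by grind]
      convert Ideal.add_mem _ (Ideal.sub_mem _ k1 k2) k3 using 1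
      ring)
  refine ⟨y, fun j k hij hik hjk => (hg j k hij hik hjk).congr ?_⟩
  have k1 := stratum_mono (F := F) (B := {i, j, k}) (by grind) (hy j (by simp [hij.symm]))
  convert Ideal.add_mem _ k1 (hx j hij k hik hjk) using 1
  ring

/-- The form `F̂_{ijk} (l_{jk} g_i dF_j ∧ dF_k + l_{ik} g_j dF_i ∧ dF_k + l_{ij} g_k dF_i ∧ dF_j)`. -/
def tripleForm (l : Fin m → Fin m → ℂ) (F g : Fin m → Poly n) (i j k : Fin m) : Bil n :=
  hat F {i, j, k} • ((C (l j k) * g i) • wdg (F j) (F k) + (C (l i k) * g j) • wdg (F i) (F k)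
    + (C (l i j) * g k) • wdg (F i) (F j))

theorem tripleForm_apply (g : Fin m → Poly n) (i j k : Fin m) (v w : VF n) :
    tripleForm l F g i j k v w = hat F {i, j, k} * (C (l j k) * g i * wdg (F j) (F k) v w
      + C (l i k) * g j * wdg (F i) (F k) v w + C (l i j) * g k * wdg (F i) (F j) v w) := rfl

/-- Restricting the normal form on a triple to fields killing one of the three F's isolates one
coefficient, which by uniqueness may be replaced by the glued g. -/
theorem IsTangent.exists_tripleForm (hF : IsArrangement d F) (hn : 3 < n)
    (hl : IsGenericResidue l) (hα : IsTangent (logBil l F Finset.univ) α)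
    (hs : ∀ v w, α w v = - α v w) :
    ∃ g, ∀ i j k, i ≠ j → i ≠ k → j ≠ k → ∀ v w,
      α v w - tripleForm l F g i j k v w ∈ stratum F {i, j, k} := by
  choose g hg using hα.exists_forall_hasResidue hF hn hl hs
  refine ⟨g, fun i j k hij hik hjk v w => ?_⟩
  obtain ⟨gi, gj, gk, h⟩ := hα.exists_eq hF hn hl hs hij hik hjk
  have ri : HasResidue l F α i j k gi := fun v w hv hw => by
    convert h v w using 2
    rw [wdg_apply (F i), wdg_apply (F i), hv, hw]
    ring
  have rj : HasResidue l F α j i k gj := fun v w hv hw => by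
    rw [show ({j, i, k} : Finset (Fin m)) = {i, j, k} by grind]
    convert h v w using 2
    rw [wdg_apply (F j), wdg_apply (F i) (F j), hv, hw]
    ring
  have rk : HasResidue l F α k i j gk := fun v w hv hw => by
    rw [show ({k, i, j} : Finset (Fin m)) = {i, j, k} by grind]
    convert h v w using 2
    rw [wdg_apply (F j), wdg_apply (F i) (F k), hv, hw]
    ring
  have si := (hg i j k hij hik hjk).sub_mem hF hn hl hij hik hjk ri
  have sj := (hg j i k hij.symm hjk hik).sub_mem hF hn hl hij.symm hjk hik rj
  have sk := (hg k i j hik.symm hjk.symm hij).sub_mem hF hn hl hik.symm hjk.symm hij rk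
  rw [show ({j, i, k} : Finset (Fin m)) = {i, j, k} by grind] at sj
  rw [show ({k, i, j} : Finset (Fin m)) = {i, j, k} by grind] at sk
  have := h v w
  rw [tripleForm_apply]
  convert Ideal.sub_mem _ (h v w) (Ideal.add_mem _ (Ideal.add_mem _
    (Ideal.mul_mem_left _ (hat F {i, j, k} * C (l j k) * wdg (F j) (F k) v w) si)
    (Ideal.mul_mem_left _ (hat F {i, j, k} * C (l i k) * wdg (F i) (F k) v w) sj))
    (Ideal.mul_mem_left _ (hat F {i, j, k} * C (l i j) * wdg (F i) (F j) v w) sk)) using 1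
  ring

theorem sum_sdiff_triple {i j k : Fin m} (hij : i ≠ j) (hik : i ≠ k) (hjk : j ≠ k)
    {M : Type} [AddCommMonoid M] (f : Fin m → M) :
    ∑ r, f r = ∑ r ∈ Finset.univ \ {i, j, k}, f r + (f i + (f j + f k)) := by
  rw [← Finset.sum_sdiff (Finset.subset_univ {i, j, k}),
    Finset.sum_insert (by simp [hij, hik]), Finset.sum_pair hjk]

theorem sum_sdiff_pair {i j : Fin m} (hij : i ≠ j) {M : Type} [AddCommMonoid M] (f : Fin m → M) :
    ∑ r, f r = ∑ r ∈ Finset.univ \ {i, j}, f r + (f i + f j) := by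
  rw [← Finset.sum_sdiff (Finset.subset_univ {i, j}), Finset.sum_pair hij]

theorem IsTangent.exists_tripleForm_homogeneous (hF : IsArrangement d F) (hn : 3 < n)
    (hl : IsGenericResidue l) (hα : IsTangent (logBil l F Finset.univ) α)
    (hs : ∀ v w, α w v = - α v w)
    (hdeg : ∀ a b, (α (Pi.single a 1) (Pi.single b 1)).IsHomogeneous (∑ r, d r - 2)) :
    ∃ g : Fin m → Poly n, (∀ i, (g i).IsHomogeneous (d i)) ∧
      ∀ i j k, i ≠ j → i ≠ k → j ≠ k → ∀ v w,
        α v w - tripleForm l F g i j k v w ∈ stratum F {i, j, k} := by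
  obtain ⟨g, hg⟩ := hα.exists_tripleForm hF hn hl hs
  -- Every cofactor of g_p has degree Σ d − 2 − d_p, so taking the degree Σ d − 2 part of the
  -- congruence selects the part of g_p of degree d_p.
  refine ⟨fun i => homogeneousComponent (d i) (g i),
    fun i => homogeneousComponent_isHomogeneous _ _, fun i j k hij hik hjk => ?_⟩
  refine bil_mem (α - tripleForm l F (fun i => homogeneousComponent (d i) (g i)) i j k)
    fun a b => ?_
  have h1 := hF.homogeneousComponent_mem (∑ r, d r - 2)
    (hg i j k hij hik hjk (Pi.single a 1) (Pi.single b 1))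
  have key : ∀ p q r, p ≠ q → p ≠ r → q ≠ r → ({p, q, r} : Finset (Fin m)) = {i, j, k} →
      homogeneousComponent (∑ r, d r - 2) (hat F {i, j, k} *
        (C (l q r) * g p * wdg (F q) (F r) (Pi.single a 1) (Pi.single b 1))) =
      hat F {i, j, k} * (C (l q r) * homogeneousComponent (d p) (g p) *
        wdg (F q) (F r) (Pi.single a 1) (Pi.single b 1)) := by
    intro p q r hpq hpr hqr e
    have hom : (C (l q r) * hat F {i, j, k} *
        wdg (F q) (F r) (Pi.single a 1) (Pi.single b 1)).IsHomogeneous _ :=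
      ((hF.isHomogeneous_hat {i, j, k}).C_mul (l q r)).mul
        (isHomogeneous_wdg (hF.hom q) (hF.hom r) a b)
    have hp := sum_sdiff_triple hpq hpr hqr d
    rw [e] at hp
    have := hF.pos q
    have := hF.pos r
    have h2 := homogeneousComponent_mul (∑ r, d r - 2) (g p) hom
    rw [degPart, if_pos (by omega), show ∑ r, d r - 2 - (∑ r ∈ Finset.univ \ {i, j, k}, d r +
      (d q - 1 + (d r - 1))) = d p by omega] at h2
    rw [show hat F {i, j, k} * (C (l q r) * g p *
        wdg (F q) (F r) (Pi.single a 1) (Pi.single b 1)) = g p * (C (l q r) * hat F {i, j, k} *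
        wdg (F q) (F r) (Pi.single a 1) (Pi.single b 1)) by ring, h2]
    ring
  rw [map_sub, homogeneousComponent_eq_self (hdeg a b), tripleForm_apply, mul_add, mul_add,
    map_add, map_add, key i j k hij hik hjk rfl, key j i k hij.symm hjk hik (by grind),
    key k i j hik.symm hjk.symm hij (by grind)] at h1
  rw [LinearMap.sub_apply, LinearMap.sub_apply, tripleForm_apply]
  convert h1 using 2
  ring

theorem stratum_update {A : Finset (Fin m)} {r : Fin m} (hr : r ∉ A) (x : Poly n) :
    stratum (Function.update F r x) A = stratum F A := by
  refine congrArg Ideal.span (Set.image_congr fun a ha => ?_)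
  exact Function.update_of_ne (by rintro rfl; exact hr ha) _ _

theorem hat_update {A : Finset (Fin m)} {r : Fin m} (hr : r ∉ A) (x : Poly n) :
    hat (Function.update F r x) A = x * hat F (insert r A) := by
  rw [hat_eq_mul _ hr, Function.update_self]
  congr 1
  refine Finset.prod_congr rfl fun a ha => Function.update_of_ne ?_ _ _
  rintro rfl
  simp at ha

theorem logBil_update_sub_mem (hl : ∀ s t, l t s = - l s t) {i j k : Fin m} (hij : i ≠ j)
    (hik : i ≠ k) (hjk : j ≠ k) (x : Poly n) (v w : VF n) :
    logBil l (Function.update F i x) Finset.univ v w -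
      hat F {i, j, k} * (C (l j k) * x * wdg (F j) (F k) v w) ∈ stratum F {i, j, k} := by
  have h := logBil_sub_mem (F := Function.update F i x) hl hjk (Finset.mem_univ j)
    (Finset.mem_univ k) v w
  have hi : i ∉ ({j, k} : Finset (Fin m)) := by simp [hij, hik]
  rw [← hat, stratum_update hi, hat_update hi, Function.update_of_ne hij.symm,
    Function.update_of_ne hik.symm, ← wdg_apply] at h
  convert stratum_mono (F := F) (B := {i, j, k}) (by grind) h using 1
  ring

theorem logBil_update_mem (hl : ∀ s t, l t s = - l s t) {i j k r : Fin m} (hij : i ≠ j)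
    (hik : i ≠ k) (hjk : j ≠ k) (hr : r ∉ ({i, j, k} : Finset (Fin m))) (x : Poly n) (v w : VF n) :
    logBil l (Function.update F r x) Finset.univ v w ∈ stratum F {i, j, k} := by
  rw [← stratum_update hr x]
  exact logBil_mem_stratum hl hij hik hjk v w

/-- Modulo J_ijk, varying F_r by g_r contributes nothing for r outside the triple. For r in it, it
contributes the term of `tripleForm` with g_r, the only one in which F_r has been replaced. -/
theorem sub_sum_logBil_update_mem (hl : ∀ s t, l t s = - l s t) {g : Fin m → Poly n}
    {i j k : Fin m} (hij : i ≠ j) (hik : i ≠ k) (hjk : j ≠ k) {v w : VF n}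
    (h : α v w - tripleForm l F g i j k v w ∈ stratum F {i, j, k}) :
    (α - ∑ r, logBil l (Function.update F r (g r)) Finset.univ) v w ∈ stratum F {i, j, k} := by
  have h1 := logBil_update_sub_mem (F := F) hl hij hik hjk (g i) v w
  have h2 := logBil_update_sub_mem (F := F) hl hij.symm hjk hik (g j) v w
  have h3 := logBil_update_sub_mem (F := F) hl hik.symm hjk.symm hij (g k) v w
  rw [show ({j, i, k} : Finset (Fin m)) = {i, j, k} by grind] at h2
  rw [show ({k, i, j} : Finset (Fin m)) = {i, j, k} by grind] at h3
  have h4 : ∑ r ∈ Finset.univ \ {i, j, k}, logBil l (Function.update F r (g r)) Finset.univ v w ∈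
      stratum F {i, j, k} := Ideal.sum_mem _ fun r hr =>
    logBil_update_mem hl hij hik hjk (by simpa using hr) (g r) v w
  rw [LinearMap.sub_apply, LinearMap.sub_apply, LinearMap.sum_apply, LinearMap.sum_apply,
    sum_sdiff_triple hij hik hjk]
  rw [tripleForm_apply] at h
  convert Ideal.sub_mem _ h (Ideal.add_mem _ h4 (Ideal.add_mem _ h1 (Ideal.add_mem _ h2 h3))) using 1
  ring

end residues
end LogForms

end

/-! ### Equations for the residues on strata of codimension two -/

noncomputable section
namespace LogForms
open MvPolynomial

section pairs
variable {n m : ℕ} {d : Fin m → ℕ} {F : Fin m → Poly n} {l : Fin m → Fin m → ℂ} {β : Bil n}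

theorem exists_bil (c : Fin (n + 1) → Fin (n + 1) → Poly n) :
    ∃ γ : Bil n, ∀ a b, γ (Pi.single a 1) (Pi.single b 1) = c a b :=
  ⟨Matrix.toLinearMap₂' (Poly n) (Matrix.of c), fun a b => by
    simp [Matrix.toLinearMap₂'_apply, Pi.single_apply]⟩

/-- The quotient by F̂_A is stated through `degPart` rather than as homogeneous, so that its
vanishing in negative degree is not lost to truncated subtraction. -/
theorem IsArrangement.exists_hat_quotient (hF : IsArrangement d F) {A : Finset (Fin m)}
    (hA : A.card + 1 ≤ n) {e : ℕ}
    (he : ∀ a b, (β (Pi.single a 1) (Pi.single b 1)).IsHomogeneous e)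
    (hβ : ∀ t ∉ A, ∀ v w, β v w ∈ stratum F (insert t A)) :
    ∃ γ : Bil n, (∀ a b, ∃ c, γ (Pi.single a 1) (Pi.single b 1) =
      degPart e (∑ r ∈ Finset.univ \ A, d r) c) ∧
      ∀ v w, β v w - hat F A * γ v w ∈ stratum F A := by
  have h := fun a b => hF.exists_sub_mul_prod_mem hA (T := Finset.univ \ A)
    (fun t ht => by simpa using ht) (x := β (Pi.single a 1) (Pi.single b 1))
    fun t ht => hβ t (by simpa using ht) _ _
  choose c hc using h
  obtain ⟨γ, hγ⟩ := exists_bil fun a b => degPart e (∑ r ∈ Finset.univ \ A, d r) (c a b)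
  refine ⟨γ, fun a b => ⟨c a b, hγ a b⟩, ?_⟩
  refine bil_mem (β - hat F A • γ) fun a b => ?_
  have := hF.homogeneousComponent_mem e (hc a b)
  rw [map_sub, homogeneousComponent_eq_self (he a b), ← hat,
    homogeneousComponent_mul e _ (hF.isHomogeneous_hat A), ← hγ] at this
  rwa [LinearMap.sub_apply, LinearMap.sub_apply, LinearMap.smul_apply, LinearMap.smul_apply,
    smul_eq_mul, mul_comm]

/-- In ω ∧ β = 0 on (X_i, X_j, v, w), modulo J_ij, only ω(X_i, X_j) β(v, w) survives, and ω(X_i,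
X_j) is λ_ij F̂_ij u². -/
theorem IsTangent.mem_of_kills_pair (hF : IsArrangement d F) (hn : 3 < n)
    (hl : IsGenericResidue l) (hβ : IsTangent (logBil l F Finset.univ) β) {i j : Fin m}
    (hij : i ≠ j) {v w : VF n} (hv : Kills F {i, j} v) (hw : Kills F {i, j} w) :
    β v w ∈ stratum F {i, j} := by
  have hcard : ({i, j} : Finset (Fin m)).card ≤ n := Finset.card_le_two.trans (by omega)
  refine hF.mem_of_dualFrame hcard fun X u hX => ⟨2, ?_⟩
  refine hF.nzdMod_hat hcard (Finset.Subset.refl _) _ (nzdMod_C _ (hl.ne_zero i j hij) _ ?_)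
  have hi : i ∈ ({i, j} : Finset (Fin m)) := by simp
  have hj : j ∈ ({i, j} : Finset (Fin m)) := by simp
  have e := fun v w => logBil_sub_mem (F := F) hl.swap hij (Finset.mem_univ i) (Finset.mem_univ j)
    v w
  have e1 := e (X i) (X j)
  have e2 := e (X i) v
  have e3 := e (X i) w
  have e4 := e (X j) v
  have e5 := e (X j) w
  have e6 := e v w
  have key := hβ.wedge_eq (X i) (X j) v w
  simp only [hX.self hi, hX.self hj, hX.ne hi hj hij, hX.ne hj hi hij.symm, hv i hi, hv j hj,
    hw i hi, hw j hj, mul_zero, sub_zero] at e1 e2 e3 e4 e5 e6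
  rw [← hat] at e1
  have key := congrArg (Ideal.Quotient.mk (stratum F {i, j})) key
  rw [← Ideal.Quotient.eq_zero_iff_mem] at e1 e2 e3 e4 e5 e6 ⊢
  simp only [wedgeB, map_add, map_sub, map_mul, map_zero, map_pow, e2, e3, e4, e5, e6] at key e1 ⊢
  linear_combination key - (Ideal.Quotient.mk _ (β v w)) * e1

/-- `β = F̂_{ij} γ` modulo `(F_i, F_j)`. -/
def HasPairResidue (F : Fin m → Poly n) (β : Bil n) (i j : Fin m) (γ : Bil n) : Prop :=
  ∀ v w, β v w - hat F {i, j} * γ v w ∈ stratum F {i, j}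

theorem HasPairResidue.symm {i j : Fin m} {γ : Bil n} (h : HasPairResidue F β i j γ) :
    HasPairResidue F β j i γ := by
  intro v w; rw [Finset.pair_comm]; exact h v w

theorem HasPairResidue.mem_of_kills (hF : IsArrangement d F) (hn : 3 < n)
    (hl : IsGenericResidue l) (hβ : IsTangent (logBil l F Finset.univ) β) {i j : Fin m}
    (hij : i ≠ j) {γ : Bil n} (h : HasPairResidue F β i j γ) {v w : VF n}
    (hv : Kills F {i, j} v) (hw : Kills F {i, j} w) : γ v w ∈ stratum F {i, j} := by
  have hcard : ({i, j} : Finset (Fin m)).card ≤ n := Finset.card_le_two.trans (by omega)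
  refine hF.nzdMod_hat hcard (Finset.Subset.refl _) _ ?_
  have := Ideal.sub_mem _ (hβ.mem_of_kills_pair hF hn hl hij hv hw) (h v w)
  rwa [sub_sub_cancel] at this

/-- The second equation, contracted with X_i on (X_i, X_j, X_k, w), is divisible by F_k modulo J_ij.
After division and restriction to J_ijk, where β vanishes, dβ(X_i, X_k, w) becomes u F̂_ijk (γ'(X_k,
w) − γ(X_i, w)). -/
theorem HasPairResidue.relation (hF : IsArrangement d F) (hn : 3 < n)
    (hl : IsGenericResidue l) (hβ : IsTangent (logBil l F Finset.univ) β)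
    (hs : ∀ v w, β w v = - β v w) {i j k : Fin m} (hij : i ≠ j) (hik : i ≠ k) (hjk : j ≠ k)
    (hJ : ∀ v w, β v w ∈ stratum F {i, j, k}) {γ γ' : Bil n} (h : HasPairResidue F β i j γ)
    (h' : HasPairResidue F β j k γ') {X : Fin m → VF n} {u : Poly n}
    (hX : DualFrame F {i, j, k} X u) {w : VF n} (hw : Kills F {i, j, k} w) :
    u ^ 3 * (C (l i j - l i k + l j k) * γ (X i) w + C (l i j) * (γ' (X k) w - γ (X i) w)) ∈
      stratum F {i, j, k} := by
  have hcard : ({i, j, k} : Finset (Fin m)).card ≤ n := Finset.card_le_three.trans (by omega)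
  have hcard2 : ({i, j} : Finset (Fin m)).card ≤ n := Finset.card_le_two.trans (by omega)
  refine hF.nzdMod_hat hcard (Finset.Subset.refl _) _
    (hF.nzdMod_hat hcard (Finset.Subset.refl _) _ ?_)
  have hi : i ∈ ({i, j, k} : Finset (Fin m)) := by simp
  have hj : j ∈ ({i, j, k} : Finset (Fin m)) := by simp
  have hk : k ∈ ({i, j, k} : Finset (Fin m)) := by simp
  have nij := hX.ne hi hj hij
  have nik := hX.ne hi hk hik
  have nji := hX.ne hj hi hij.symm
  have njk := hX.ne hj hk hjk
  have nki := hX.ne hk hi hik.symm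
  have nkj := hX.ne hk hj hjk.symm
  set H := hat F {i, j, k} with hH
  have e1 : hat F {i, j} = F k * H := by
    rw [hH, show ({i, j, k} : Finset (Fin m)) = insert k {i, j} by grind]
    exact hat_eq_mul F (by simp [hik.symm, hjk.symm])
  have e2 : hat F {j, k} = F i * H := hat_eq_mul F (by simp [hij, hik])
  have b1 : β (X i) w - F k * (H * γ (X i) w) ∈ stratum F {i, j} := by
    have := h (X i) w
    rwa [e1, mul_assoc] at this
  have b2 : β (X k) w - F i * (H * γ' (X k) w) ∈ stratum F {j, k} := by
    have := h' (X k) w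
    rwa [e2, mul_assoc] at this
  have hFj : F j ∈ stratum F {i, j} := mem_stratum (by simp)
  have E := hF.nzdMod hcard2 (p := k) (by simp [hik.symm, hjk.symm])
    (extB (logBil l F (Finset.univ.erase k)) (X i) (X j) w * β (X i) (X k)
      - H * γ (X i) w * extB (logBil l F Finset.univ) (X i) (X j) (X k)
      - logBil l F (Finset.univ.erase k) (X i) (X j) * extB β (X i) (X k) w) (by
      have key := hβ.wedgeD_eq (X i) (X i) (X j) (X k) w
      rw [wedgeD, wedgeD, self_eq_neg.mp (hs (X i) (X i)),
        extB_logBil_eq_mul hl.swap (Finset.mem_univ j) nji njk (hw j hj),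
        extB_logBil_eq_mul hl.swap (Finset.mem_univ k) nki nkj (hw k hk),
        logBil_eq_mul (Finset.mem_univ j) nji nji, logBil_eq_mul (Finset.mem_univ k) nki nkj,
        logBil_eq_mul (Finset.mem_univ j) nji njk,
        logBil_eq_mul (Finset.mem_univ j) nji (hw j hj)] at key
      convert Ideal.add_mem _
        (Ideal.mul_mem_left _ (extB (logBil l F Finset.univ) (X i) (X j) (X k)) b1)
        (Ideal.mul_mem_right (β (X i) (X j) *
          extB (logBil l F (Finset.univ.erase j)) (X i) (X k) w
          - logBil l F (Finset.univ.erase j) (X i) (X i) * extB β (X j) (X k) w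
          - logBil l F (Finset.univ.erase j) (X i) (X k) * extB β (X i) (X j) w
          + logBil l F (Finset.univ.erase j) (X i) w * extB β (X i) (X j) (X k)) _ hFj) using 1
      linear_combination key)
  have E := stratum_mono (F := F) (B := {i, j, k}) (by grind) E
  have w1 := stratum_mono (F := F) (B := {i, j, k}) (by grind)
    (logBil_sub_mem (F := F) (T := Finset.univ.erase k) hl.swap hij (by simp [hik])
      (by simp [hjk]) (X i) (X j))
  rw [show Finset.univ.erase k \ {i, j} = Finset.univ \ {i, j, k} by grind, ← hat, ← hH,
    hX.self hi, hX.self hj, nij, nji] at w1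
  have w2 := extB_logBil_sub_mem (F := F) (T := Finset.univ) hl.swap hij hik hjk
    (Finset.subset_univ _) (X i) (X j) (X k)
  rw [← hat, ← hH] at w2
  simp only [hX.self hi, hX.self hj, hX.self hk, nij, nik, nji, njk, nki, nkj] at w2
  have y := extB_sub_mem hJ (X i) (X k) w
  have y1 := stratum_mono (F := F) (B := {i, j, k}) (by grind)
    (along_sub_mem (hX.kills_of_notMem (by grind) hk (by simp [hik.symm, hjk.symm])) b1)
  have y2 := stratum_mono (F := F) (B := {i, j, k}) (by grind)
    (along_sub_mem (hX.kills_of_notMem (by grind) hi (by simp [hij, hik])) b2)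
  have y3 := along_mem_stratum (v := w) (fun s hs => by rw [hw s hs]; exact Ideal.zero_mem _)
    (hJ (X i) (X k))
  rw [hX.self hk] at y1
  rw [hX.self hi] at y2
  have z := hJ (X i) (X k)
  rw [← Ideal.Quotient.eq_zero_iff_mem] at E w1 w2 y y1 y2 y3 z ⊢
  simp only [map_sub, map_add, map_mul, map_pow, map_zero, mul_zero, sub_zero,
    zero_mul] at E w1 w2 y y1 y2 y3 z ⊢
  generalize Ideal.Quotient.mk (stratum F {i, j, k}) = π at *
  rw [sub_eq_zero] at w1 w2 y y1 y2
  rw [y1, y2, y3] at y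
  rw [w1, w2, y, z] at E
  linear_combination -E

/-- The relation and its mirror image under i ↔ k form a linear system in γ(X_i, w) and γ'(X_k, w).
With s = λ_ij − λ_ik + λ_jk its determinant is, up to sign, s λ_ik, which is nonzero. -/
theorem HasPairResidue.pow_mul_mem (hF : IsArrangement d F) (hn : 3 < n)
    (hl : IsGenericResidue l) (hβ : IsTangent (logBil l F Finset.univ) β)
    (hs : ∀ v w, β w v = - β v w) {i j k : Fin m} (hij : i ≠ j) (hik : i ≠ k) (hjk : j ≠ k)
    (hJ : ∀ v w, β v w ∈ stratum F {i, j, k}) {γ γ' : Bil n} (h : HasPairResidue F β i j γ)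
    (h' : HasPairResidue F β j k γ') {X : Fin m → VF n} {u : Poly n}
    (hX : DualFrame F {i, j, k} X u) {w : VF n} (hw : Kills F {i, j, k} w) :
    u ^ 3 * γ (X i) w ∈ stratum F {i, j, k} := by
  have e : ({k, j, i} : Finset (Fin m)) = {i, j, k} := by grind
  have h1 := HasPairResidue.relation hF hn hl hβ hs hij hik hjk hJ h h' hX hw
  have h2 := HasPairResidue.relation hF hn hl hβ hs hjk.symm hik.symm hij.symm
    (by rw [e]; exact hJ) h'.symm h.symm (by rw [e]; exact hX) (w := w) (by rw [e]; exact hw)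
  rw [e] at h2
  refine nzdMod_C _ (hl.sum_ne_zero i j k hij hik hjk) _ (nzdMod_C _ (hl.ne_zero i k hik) _ ?_)
  convert Ideal.sub_mem _
    (Ideal.mul_mem_left _ (C (l j k - (l i j - l i k + l j k))) h1)
    (Ideal.mul_mem_left _ (C (l i j)) h2) using 1
  rw [hl.swap j k, hl.swap i k, hl.swap i j]
  simp only [C_sub, C_add, C_neg]
  ring

/-- Along the frame u v splits into X_i, X_j, X_k components and a field killing the triple. The
first two are handled by the linear system; the other two pair with w inside the fields killing {i,
j}, where γ vanishes. -/
theorem HasPairResidue.mem_of_kills_triple (hF : IsArrangement d F) (hn : 3 < n)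
    (hl : IsGenericResidue l) (hβ : IsTangent (logBil l F Finset.univ) β)
    (hs : ∀ v w, β w v = - β v w) {i j k : Fin m} (hij : i ≠ j) (hik : i ≠ k) (hjk : j ≠ k)
    (hJ : ∀ v w, β v w ∈ stratum F {i, j, k}) {γ γ' γ'' : Bil n} (h : HasPairResidue F β i j γ)
    (h' : HasPairResidue F β j k γ') (h'' : HasPairResidue F β i k γ'') (v : VF n) {w : VF n}
    (hw : Kills F {i, j, k} w) : γ v w ∈ stratum F {i, j, k} := by
  have hcard : ({i, j, k} : Finset (Fin m)).card ≤ n := Finset.card_le_three.trans (by omega)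
  refine hF.mem_of_dualFrame hcard fun X u hX => ⟨4, ?_⟩
  have hsub : ({i, j} : Finset (Fin m)) ⊆ {i, j, k} := by grind
  have hw2 : Kills F {i, j} w := fun s hs => hw s (hsub hs)
  have e : ({j, i, k} : Finset (Fin m)) = {i, j, k} := by grind
  have h1 := HasPairResidue.pow_mul_mem hF hn hl hβ hs hij hik hjk hJ h h' hX hw
  have h2 := HasPairResidue.pow_mul_mem hF hn hl hβ hs hij.symm hjk hik
    (by rw [e]; exact hJ) h.symm h'' (by rw [e]; exact hX) (w := w) (by rw [e]; exact hw)
  rw [e] at h2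
  have h3 := stratum_mono (F := F) hsub (h.mem_of_kills hF hn hl hβ hij (v := X k)
    (hX.kills_of_notMem hsub (by simp) (by simp [hik.symm, hjk.symm])) hw2)
  have h4 := stratum_mono (F := F) hsub (h.mem_of_kills hF hn hl hβ hij
    (fun s hs => hX.kills v s (hsub hs)) hw2)
  rw [Finset.sum_insert (by simp [hij, hik]), Finset.sum_pair hjk] at h4
  simp only [map_sub, map_add, map_smul, LinearMap.sub_apply, LinearMap.add_apply,
    LinearMap.smul_apply, smul_eq_mul] at h4
  convert Ideal.add_mem _ (Ideal.mul_mem_left _ (u ^ 3) h4) (Ideal.add_mem _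
    (Ideal.mul_mem_left _ (along v (F i)) h1) (Ideal.add_mem _
    (Ideal.mul_mem_left _ (along v (F j)) h2)
    (Ideal.mul_mem_left _ (u ^ 3 * along v (F k)) h3))) using 1
  ring

end pairs
end LogForms

end

/-! ### The residues in codimension two are constant -/

noncomputable section
namespace LogForms
open MvPolynomial

section pairs
variable {n m : ℕ} {d : Fin m → ℕ} {F : Fin m → Poly n} {l : Fin m → Fin m → ℂ} {β : Bil n}

/-- The first order deformations that vanish on the strata of codimension three. -/
structure IsReduced (d : Fin m → ℕ) (l : Fin m → Fin m → ℂ) (F : Fin m → Poly n)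
    (β : Bil n) : Prop where
  tangent : IsTangent (logBil l F Finset.univ) β
  swap : ∀ v w, β w v = - β v w
  hom : ∀ a b, (β (Pi.single a 1) (Pi.single b 1)).IsHomogeneous (∑ r, d r - 2)
  mem : ∀ i j k, i ≠ j → i ≠ k → j ≠ k → ∀ v w, β v w ∈ stratum F {i, j, k}

theorem IsReduced.exists_hasPairResidue (hF : IsArrangement d F) (hn : 3 < n)
    (hβ : IsReduced d l F β) {i j : Fin m} (hij : i ≠ j) :
    ∃ γ : Bil n, (∀ a b, (γ (Pi.single a 1) (Pi.single b 1)).IsHomogeneous (d i + d j - 2)) ∧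
      HasPairResidue F β i j γ := by
  obtain ⟨γ, h1, h2⟩ := hF.exists_hat_quotient (A := {i, j})
    (by rw [Finset.card_pair hij]; omega) hβ.hom (fun t ht v w => by
      simp only [Finset.mem_insert, Finset.mem_singleton, not_or] at ht
      exact hβ.mem t i j ht.1 ht.2 hij v w)
  refine ⟨γ, fun a b => ?_, h2⟩
  obtain ⟨c, hc⟩ := h1 a b
  rw [hc, show d i + d j - 2 = (∑ r, d r - 2) - ∑ r ∈ Finset.univ \ {i, j}, d r by
    rw [sum_sdiff_pair hij d]; omega]
  exact isHomogeneous_degPart _ _ _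

theorem HasPairResidue.add_swap_mem (hF : IsArrangement d F) (hn : 3 < n)
    (hs : ∀ v w, β w v = - β v w) {i j : Fin m} {γ : Bil n}
    (h : HasPairResidue F β i j γ) (v w : VF n) : γ w v + γ v w ∈ stratum F {i, j} := by
  have hcard : ({i, j} : Finset (Fin m)).card ≤ n := Finset.card_le_two.trans (by omega)
  refine hF.nzdMod_hat hcard (Finset.Subset.refl _) _ ?_
  have := Ideal.add_mem _ (h w v) (h v w)
  rw [hs v w, ← neg_mem_iff] at this
  convert this using 1
  ring

theorem IsArrangement.exists_sum_sum_homogeneous (hF : IsArrangement d F) {A : Finset (Fin m)}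
    (hA : A.card + 2 ≤ n + 1) {γ : Bil n} {e : ℕ}
    (he : ∀ a b, (γ (Pi.single a 1) (Pi.single b 1)).IsHomogeneous e)
    (hl : ∀ v w, Kills F A v → γ v w ∈ stratum F A)
    (hr : ∀ v w, Kills F A w → γ v w ∈ stratum F A) :
    ∃ P : Fin m → Fin m → Poly n,
      (∀ s t, (P s t).IsHomogeneous (e - (d s - 1 + (d t - 1)))) ∧ ∀ v w,
      γ v w - ∑ s ∈ A, ∑ t ∈ A, P s t * along v (F s) * along w (F t) ∈ stratum F A := by
  obtain ⟨P, hP⟩ := exists_sum_sum_along hF.nc le_rfl (hF.hasDepth hA) γ hl hr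
  refine ⟨fun s t => degPart e (d s - 1 + (d t - 1)) (P s t),
    fun s t => isHomogeneous_degPart _ _ _, fun v w => ?_⟩
  have key := bil_mem (J := stratum F A) (γ - ∑ s ∈ A, ∑ t ∈ A,
    degPart e (d s - 1 + (d t - 1)) (P s t) • (diff (F s)).smulRight (diff (F t))) (fun a b => by
      have h1 := hF.homogeneousComponent_mem e (hP (Pi.single a 1) (Pi.single b 1))
      simp only [map_sub, map_sum, mul_assoc] at h1
      have h2 : ∀ s t, homogeneousComponent e (P s t * (along (Pi.single a 1) (F s) *
          along (Pi.single b 1) (F t))) = _ := fun s t =>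
        homogeneousComponent_mul e (P s t) ((isHomogeneous_along_single (hF.hom s) a).mul
          (isHomogeneous_along_single (hF.hom t) b))
      simp only [h2] at h1
      rw [homogeneousComponent_eq_self (he a b)] at h1
      simpa [LinearMap.sum_apply] using h1) v w
  simpa [LinearMap.sum_apply, mul_assoc] using key

/-- Modulo J_ijk, γ is a combination Σ P_st dF_s dF_t, antisymmetric modulo the ideal. The
coefficient P_ij has degree zero, while P_ik and P_jk vanish on every further hypersurface and have
too small a degree. -/
theorem IsReduced.exists_const_triple (hF : IsArrangement d F) (hn : 3 < n)
    (hbal : ∀ i j, i ≠ j → d i + d j < ∑ r ∈ Finset.univ \ {i, j}, d r)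
    (hl : IsGenericResidue l) (hβ : IsReduced d l F β) {i j : Fin m} (hij : i ≠ j) {γ : Bil n}
    (hom : ∀ a b, (γ (Pi.single a 1) (Pi.single b 1)).IsHomogeneous (d i + d j - 2))
    (hγ : HasPairResidue F β i j γ) {k : Fin m} (hik : i ≠ k) (hjk : j ≠ k) :
    ∃ c : ℂ, ∀ v w, γ v w - C c * wdg (F i) (F j) v w ∈ stratum F {i, j, k} := by
  have hcard : ({i, j, k} : Finset (Fin m)).card = 3 := Finset.card_eq_three.mpr
    ⟨i, j, k, hij, hik, hjk, rfl⟩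
  have hkill : ∀ t, i ≠ t → j ≠ t → ∀ v w, Kills F {i, j, t} w → γ v w ∈ stratum F {i, j, t} := by
    intro t hit hjt v w hw
    obtain ⟨γ', -, h'⟩ := hβ.exists_hasPairResidue hF hn hjt
    obtain ⟨γ'', -, h''⟩ := hβ.exists_hasPairResidue hF hn hit
    exact hγ.mem_of_kills_triple hF hn hl hβ.tangent hβ.swap hij hit hjt
      (hβ.mem i j t hij hit hjt) h' h'' v hw
  have hswap : ∀ v w, γ w v + γ v w ∈ stratum F {i, j, k} := fun v w =>
    stratum_mono (by grind) (hγ.add_swap_mem hF hn hβ.swap v w)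
  obtain ⟨P, hPd, hP⟩ := hF.exists_sum_sum_homogeneous (A := {i, j, k}) (by omega) hom
    (fun v w hv => by
      have := Ideal.sub_mem _ (hswap v w) (hkill k hik hjk w v hv)
      rwa [add_sub_cancel_left] at this) (hkill k hik hjk)
  have hPX {X : Fin m → VF n} {u : Poly n} (hX : DualFrame F {i, j, k} X u) {s t : Fin m}
      (hs : s ∈ ({i, j, k} : Finset (Fin m))) (ht : t ∈ ({i, j, k} : Finset (Fin m))) :
      γ (X s) (X t) - P s t * u * u ∈ stratum F {i, j, k} := by
    have := hP (X s) (X t)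
    rwa [hX.sum_sum P hs ht] at this
  have hanti : ∀ s ∈ ({i, j, k} : Finset (Fin m)), ∀ t ∈ ({i, j, k} : Finset (Fin m)),
      P s t + P t s ∈ stratum F {i, j, k} := by
    intro s hsA t htA
    refine hF.mem_of_dualFrame (by omega) fun X u hX => ⟨2, ?_⟩
    have h1 := Ideal.sub_mem _ (hswap (X t) (X s))
      (Ideal.add_mem _ (hPX hX hsA htA) (hPX hX htA hsA))
    convert h1 using 1; ring
  have hdiag : ∀ s ∈ ({i, j, k} : Finset (Fin m)), P s s ∈ stratum F {i, j, k} := by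
    intro s hsA
    refine nzdMod_C _ (two_ne_zero (α := ℂ)) _ ?_
    convert hanti s hsA s hsA using 1
    rw [map_ofNat]; ring
  -- The degree of P_ik is d_j − d_k (and of P_jk, d_i − d_k), truncated at zero, which by balance
  -- is less than the sum of the d_r outside the triple. Vanishing modulo F_t holds because X_k
  -- kills {i, j, t}.
  have hoff : ∀ s, s ∈ ({i, j} : Finset (Fin m)) → P s k ∈ stratum F {i, j, k} := by
    intro s hs
    have hsA : s ∈ ({i, j, k} : Finset (Fin m)) := by grind
    have b1 := hbal i j hij
    have b2 := hbal i k hik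
    have b3 := hbal j k hjk
    have s1 := sum_sdiff_triple hij hik hjk d
    rw [sum_sdiff_pair hij d] at s1
    have s2 := sum_sdiff_triple hij hik hjk d
    rw [sum_sdiff_pair hik d] at s2
    have s3 := sum_sdiff_triple hij hik hjk d
    rw [sum_sdiff_pair hjk d] at s3
    have p1 := hF.pos i
    have p2 := hF.pos j
    have p3 := hF.pos k
    refine hF.mem_of_forall_insert (T := Finset.univ \ {i, j, k}) (by omega)
      (fun t ht => by simpa using ht) (hPd s k) (fun t ht => ?_) ?_
    · have ht : t ∉ ({i, j, k} : Finset (Fin m)) := by simpa using ht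
      have hit : i ≠ t := by rintro rfl; simp at ht
      have hjt : j ≠ t := by rintro rfl; simp at ht
      have hkt : k ≠ t := by rintro rfl; simp at ht
      refine hF.mem_of_dualFrame
        (by rw [Finset.card_insert_of_notMem ht, hcard]; omega) fun X u hX => ⟨2, ?_⟩
      have hsub := Finset.subset_insert t ({i, j, k} : Finset (Fin m))
      have h1 := stratum_mono (F := F) hsub (hPX (hX.mono hsub) hsA (t := k) (by simp))
      have h2 := stratum_mono (F := F) (B := insert t {i, j, k}) (by grind)
        (hkill t hit hjt (X s) (X k) (hX.kills_of_notMem (by grind) (by simp)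
          (by simp [hik.symm, hjk.symm, hkt])))
      convert Ideal.sub_mem _ h2 h1 using 1; ring
    · rcases Finset.mem_insert.mp hs with rfl | hs
      · omega
      · rw [Finset.mem_singleton.mp hs]; omega
  have hi : i ∈ ({i, j, k} : Finset (Fin m)) := by simp
  have hj : j ∈ ({i, j, k} : Finset (Fin m)) := by simp
  have hk : k ∈ ({i, j, k} : Finset (Fin m)) := by simp
  have hPij : P i j = C (coeff 0 (P i j)) := by
    have h0 := hPd i j
    have p1 := hF.pos i
    have p2 := hF.pos j
    rw [show d i + d j - 2 - (d i - 1 + (d j - 1)) = 0 by omega] at h0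
    rw [← homogeneousComponent_zero, homogeneousComponent_eq_self h0]
  refine ⟨coeff 0 (P i j), fun v w => ?_⟩
  rw [← hPij]
  have h0 := hP v w
  have hnot1 : i ∉ ({j, k} : Finset (Fin m)) := by simp [hij, hik]
  simp only [Finset.sum_insert hnot1, Finset.sum_pair hjk] at h0
  have d1 := hdiag i hi
  have d2 := hdiag j hj
  have d3 := hdiag k hk
  have a1 := hanti j hj k hk
  have a2 := hanti i hi k hk
  have a3 := hanti i hi j hj
  have o1 := hoff i (by simp)
  have o2 := hoff j (by simp)
  simp only [wdg_apply]
  rw [← Ideal.Quotient.eq_zero_iff_mem] at h0 d1 d2 d3 a1 a2 a3 o1 o2 ⊢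
  simp only [map_add, map_sub, map_mul] at h0 d1 d2 d3 a1 a2 a3 o1 o2 ⊢
  generalize (Ideal.Quotient.mk (stratum F {i, j, k})) = π at *
  linear_combination h0 + d1 * π (along v (F i)) * π (along w (F i))
    + d2 * π (along v (F j)) * π (along w (F j)) + d3 * π (along v (F k)) * π (along w (F k))
    + a1 * π (along v (F k)) * π (along w (F j)) + a2 * π (along v (F k)) * π (along w (F i))
    + a3 * π (along v (F j)) * π (along w (F i))
    + o2 * (π (along v (F j)) * π (along w (F k)) - π (along v (F k)) * π (along w (F j)))
    + o1 * (π (along v (F i)) * π (along w (F k)) - π (along v (F k)) * π (along w (F i)))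

/-- The constants found for various k agree, as is seen on codimension four. Then γ − c dF_i∧dF_j
vanishes modulo every J_ijk, and its degree d_i + d_j − 2 is below the sum of the remaining degrees
by balance. -/
theorem IsReduced.exists_const_pair (hF : IsArrangement d F) (hn : 3 < n)
    (hbal : ∀ i j, i ≠ j → d i + d j < ∑ r ∈ Finset.univ \ {i, j}, d r)
    (hl : IsGenericResidue l) (hβ : IsReduced d l F β) {i j : Fin m} (hij : i ≠ j) :
    ∃ c : ℂ, ∀ v w, β v w - hat F {i, j} * (C c * wdg (F i) (F j) v w) ∈ stratum F {i, j} := by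
  obtain ⟨γ, hom, hγ⟩ := hβ.exists_hasPairResidue hF hn hij
  have h1 : ∀ k, ∃ c : ℂ, i ≠ k → j ≠ k →
      ∀ v w, γ v w - C c * wdg (F i) (F j) v w ∈ stratum F {i, j, k} := by
    intro k
    by_cases h : i ≠ k ∧ j ≠ k
    · obtain ⟨c, hc⟩ := hβ.exists_const_triple hF hn hbal hl hij hom hγ h.1 h.2
      exact ⟨c, fun _ _ => hc⟩
    · exact ⟨0, fun h1 h2 => absurd ⟨h1, h2⟩ h⟩
  choose c hc using h1
  have heq : ∀ k t, i ≠ k → j ≠ k → i ≠ t → j ≠ t → c k = c t := by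
    intro k t hik hjk hit hjt
    rw [← sub_eq_zero]
    refine hF.eq_zero_of_C_mem (A := {i, j, k, t}) ?_
    refine hF.mem_of_dualFrame (Finset.card_le_four.trans (by omega)) fun X u hX => ⟨2, ?_⟩
    have k1 := stratum_mono (F := F) (B := {i, j, k, t}) (by grind) (hc k hik hjk (X i) (X j))
    have k2 := stratum_mono (F := F) (B := {i, j, k, t}) (by grind) (hc t hit hjt (X i) (X j))
    rw [wdg_apply, hX.self (by simp), hX.self (by simp), hX.ne (by simp) (by simp) hij] at k1 k2
    convert Ideal.sub_mem _ k2 k1 using 1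
    rw [C_sub]; ring
  have hb := hbal i j hij
  obtain ⟨k₀, hk₀⟩ : (Finset.univ \ {i, j} : Finset (Fin m)).Nonempty := by
    by_contra h
    rw [Finset.not_nonempty_iff_eq_empty] at h
    rw [h, Finset.sum_empty] at hb
    omega
  simp only [Finset.mem_sdiff, Finset.mem_univ, true_and, Finset.mem_insert,
    Finset.mem_singleton, not_or] at hk₀
  refine ⟨c k₀, fun v w => ?_⟩
  have key := bil_mem (J := stratum F {i, j}) (γ - (C (c k₀) : Poly n) • wdg (F i) (F j))
    (fun a b => by
      refine hF.mem_of_forall_insert (T := Finset.univ \ {i, j})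
        (by rw [Finset.card_pair hij]; omega) (fun t ht => by simpa using ht)
        (e := d i + d j - 2) ?_ (fun t ht => ?_) (by omega)
      · refine (hom a b).sub ?_
        have p1 := hF.pos i
        have p2 := hF.pos j
        rw [show d i + d j - 2 = d i - 1 + (d j - 1) by omega]
        exact (isHomogeneous_wdg (hF.hom i) (hF.hom j) a b).C_mul _
      · simp only [Finset.mem_sdiff, Finset.mem_univ, true_and, Finset.mem_insert,
          Finset.mem_singleton, not_or] at ht
        rw [heq k₀ t (Ne.symm hk₀.1) (Ne.symm hk₀.2) (Ne.symm ht.1) (Ne.symm ht.2),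
          show insert t ({i, j} : Finset (Fin m)) = {i, j, t} by grind]
        exact hc t (Ne.symm ht.1) (Ne.symm ht.2) _ _) v w
  rw [LinearMap.sub_apply, LinearMap.sub_apply, LinearMap.smul_apply, LinearMap.smul_apply,
    smul_eq_mul] at key
  convert Ideal.add_mem _ (hγ v w) (Ideal.mul_mem_left _ (hat F {i, j}) key) using 1
  ring

theorem IsReduced.exists_residues (hF : IsArrangement d F) (hn : 3 < n)
    (hbal : ∀ i j, i ≠ j → d i + d j < ∑ r ∈ Finset.univ \ {i, j}, d r)
    (hl : IsGenericResidue l) (hβ : IsReduced d l F β) :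
    ∃ c : Fin m → Fin m → ℂ, (∀ s t, c t s = - c s t) ∧
      ∀ i j, i ≠ j → ∀ v w, β v w - logBil c F Finset.univ v w ∈ stratum F {i, j} := by
  have h0 : ∀ i j, ∃ c : ℂ, i ≠ j →
      ∀ v w, β v w - hat F {i, j} * (C c * wdg (F i) (F j) v w) ∈ stratum F {i, j} := by
    intro i j
    by_cases hij : i = j
    · exact ⟨0, fun h => absurd hij h⟩
    · obtain ⟨c, hc⟩ := hβ.exists_const_pair hF hn hbal hl hij
      exact ⟨c, fun _ => hc⟩
  choose b hb using h0
  -- The constants for (i, j) and (j, i) were chosen independently; keeping those with i < j makes c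
  -- antisymmetric by construction.
  let c : Fin m → Fin m → ℂ := fun s t => if s < t then b s t else if t < s then - b t s else 0
  have hc : ∀ s t, c t s = - c s t := by
    intro s t
    rcases lt_trichotomy s t with h | rfl | h
    · simp [c, h, h.not_gt]
    · simp [c]
    · simp [c, h, h.not_gt]
  have key : ∀ i j, i < j → ∀ v w,
      β v w - logBil c F Finset.univ v w ∈ stratum F {i, j} := by
    intro i j hij v w
    have h1 := logBil_sub_mem (F := F) hc hij.ne (Finset.mem_univ i) (Finset.mem_univ j) v w
    have e : c i j = b i j := if_pos hij
    rw [← hat, ← wdg_apply, e] at h1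
    convert Ideal.sub_mem _ (hb i j hij.ne v w) h1 using 1
    ring
  refine ⟨c, hc, fun i j hij v w => ?_⟩
  rcases lt_or_gt_of_ne hij with h | h
  · exact key i j h v w
  · rw [Finset.pair_comm]; exact key j i h v w

end pairs
end LogForms

end

/-! ### Vanishing of the remainder in codimension one and globally -/

noncomputable section
namespace LogForms
open MvPolynomial

section residual
variable {n m : ℕ} {d : Fin m → ℕ} {F : Fin m → Poly n} {l c : Fin m → Fin m → ℂ} {β η : Bil n}

theorem logBil_swap (hc : ∀ s t, c t s = - c s t) (T : Finset (Fin m)) (v w : VF n) :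
    logBil c F T w v = - logBil c F T v w := by
  rw [logBil_apply, logBil_apply, Finset.sum_comm, ← Finset.sum_neg_distrib]
  refine Finset.sum_congr rfl fun s _ => ?_
  rw [← Finset.sum_neg_distrib]
  refine Finset.sum_congr rfl fun t _ => ?_
  rw [hc s t, Finset.pair_comm, C_neg]
  ring

theorem IsArrangement.isHomogeneous_logBil (hF : IsArrangement d F) (hc : ∀ s t, c t s = - c s t)
    (a b : Fin (n + 1)) :
    (logBil c F Finset.univ (Pi.single a 1) (Pi.single b 1)).IsHomogeneous (∑ r, d r - 2) := by
  rw [logBil_apply]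
  refine IsHomogeneous.sum _ _ _ fun s _ => IsHomogeneous.sum _ _ _ fun t _ => ?_
  by_cases h : s = t
  · subst h
    rw [self_eq_neg.mp (hc s s)]
    simpa using isHomogeneous_zero _ _ _
  · have := (isHomogeneous_logTerm hF.pos hF.hom h (Pi.single a 1) (Pi.single b 1)).C_mul (c s t)
    rw [const_single, const_single] at this
    simpa only [mul_assoc] using this

/-- The differences of a reduced first order deformation and a logarithmic form that vanish on the
strata of codimension two. -/
structure IsResidual (d : Fin m → ℕ) (l c : Fin m → Fin m → ℂ) (F : Fin m → Poly n)
    (η : Bil n) : Prop where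
  tangent : IsTangent (logBil l F Finset.univ) (η + logBil c F Finset.univ)
  residue_swap : ∀ s t, c t s = - c s t
  swap : ∀ v w, η w v = - η v w
  hom : ∀ a b, (η (Pi.single a 1) (Pi.single b 1)).IsHomogeneous (∑ r, d r - 2)
  mem : ∀ i j, i ≠ j → ∀ v w, η v w ∈ stratum F {i, j}

/-- Tangency is known only for η plus the logarithmic form. The second equation, contracted with
X_j, is evaluated on (X_j, X_i, v, w). There each logarithmic contribution from c is multiplied by a
factor divisible by F_i or is itself divisible by it, apart from zero terms. What survives is ω(X_j,
X_i) dη(X_j, v, w), with dη ≡ u F̂_ij δ(v, w). -/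
theorem IsResidual.mem_of_kills (hF : IsArrangement d F) (hn : 3 < n) (hl : IsGenericResidue l)
    (hη : IsResidual d l c F η) {i j : Fin m} (hij : i ≠ j) {δ : Bil n}
    (hδ : ∀ v w, η v w - hat F {i} * δ v w ∈ stratum F {i}) {v w : VF n}
    (hv : Kills F {i, j} v) (hw : Kills F {i, j} w) : δ v w ∈ stratum F {i, j} := by
  have hcard : ({i, j} : Finset (Fin m)).card ≤ n := Finset.card_le_two.trans (by omega)
  refine hF.mem_of_dualFrame hcard fun X u hX => ⟨3, ?_⟩
  refine hF.nzdMod_hat hcard (Finset.Subset.refl _) _ (hF.nzdMod_hat hcard (Finset.Subset.refl _) _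
    (nzdMod_C _ (hl.ne_zero i j hij) _ ?_))
  have hi : i ∈ ({i, j} : Finset (Fin m)) := by simp
  have hj : j ∈ ({i, j} : Finset (Fin m)) := by simp
  have nij := hX.ne hi hj hij
  have nji := hX.ne hj hi hij.symm
  set H := hat F {i, j} with hH
  have e1 : hat F {i} = F j * H := by
    rw [hH, Finset.pair_comm]; exact hat_eq_mul F (by simp [hij.symm])
  have b1 : η v w - F j * (H * δ v w) ∈ stratum F {i} := by
    have := hδ v w
    rwa [e1, mul_assoc] at this
  have hFi : F i ∈ stratum F {i, j} := mem_stratum (by simp)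
  have key := hη.tangent.wedgeD_eq (X j) (X j) (X i) v w
  have hsw := logBil_swap (F := F) hη.residue_swap Finset.univ (X j) (X j)
  rw [wedgeD, wedgeD] at key
  simp only [extB_add, LinearMap.add_apply] at key
  rw [self_eq_neg.mp (hη.swap (X j) (X j)), self_eq_neg.mp hsw,
    extB_logBil_eq_mul hl.swap (Finset.mem_univ i) nij (hv i hi) (hw i hi),
    extB_logBil_eq_mul hη.residue_swap (Finset.mem_univ i) nij (hv i hi) (hw i hi),
    logBil_eq_mul (l := l) (Finset.mem_univ i) nij nij,
    logBil_eq_mul (l := l) (Finset.mem_univ i) nij (hv i hi),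
    logBil_eq_mul (l := l) (Finset.mem_univ i) nij (hw i hi),
    logBil_eq_mul (l := c) (Finset.mem_univ i) nij (hv i hi),
    logBil_eq_mul (l := c) (Finset.mem_univ i) nij (hw i hi)] at key
  have w1 := logBil_sub_mem (F := F) hl.swap hij (Finset.mem_univ i) (Finset.mem_univ j) (X j) (X i)
  rw [← hat, ← hH, hX.self hi, hX.self hj, nij, nji] at w1
  have y := extB_sub_mem (hη.mem i j hij) (X j) v w
  have y1 := stratum_mono (F := F) (B := {i, j}) (by grind)
    (along_sub_mem (hX.kills_of_notMem (by grind) hj (by simp [hij.symm])) b1)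
  have y2 := along_mem_stratum (v := v) (fun s hs => by rw [hv s hs]; exact Ideal.zero_mem _)
    (hη.mem i j hij (X j) w)
  have y3 := along_mem_stratum (v := w) (fun s hs => by rw [hw s hs]; exact Ideal.zero_mem _)
    (hη.mem i j hij (X j) v)
  have z1 := hη.mem i j hij (X j) v
  have z2 := hη.mem i j hij (X j) w
  rw [hX.self hj] at y1
  have key := congrArg (Ideal.Quotient.mk (stratum F {i, j})) key
  rw [← Ideal.Quotient.eq_zero_iff_mem] at w1 y y1 y2 y3 z1 z2 hFi ⊢
  simp only [map_sub, map_add, map_mul, map_pow, map_neg, map_zero, mul_zero, sub_zero,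
    zero_sub, add_zero, zero_mul, hFi, z1, z2] at key w1 y y1 y2 y3 ⊢
  generalize Ideal.Quotient.mk (stratum F {i, j}) = π at *
  rw [sub_eq_zero] at w1 y y1
  rw [y1, y2, y3] at y
  rw [w1, y] at key
  linear_combination key

/-- Division by F̂_i followed by antisymmetrization. The separate clause for d_i < 2 records that
the true degree d_i − 2 is then negative. -/
theorem IsResidual.exists_quotient (hF : IsArrangement d F) (hn : 3 < n)
    (hη : IsResidual d l c F η) {i : Fin m} (hi : 0 < ∑ r ∈ Finset.univ \ {i}, d r) :
    ∃ δ : Bil n, (∀ v w, δ w v = - δ v w) ∧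
      (∀ a b, (δ (Pi.single a 1) (Pi.single b 1)).IsHomogeneous (d i - 2)) ∧
      (d i < 2 → ∀ a b, δ (Pi.single a 1) (Pi.single b 1) = 0) ∧
      ∀ v w, η v w - hat F {i} * δ v w ∈ stratum F {i} := by
  obtain ⟨γ, h1, h2⟩ := hF.exists_hat_quotient (A := {i}) (by simp; omega) hη.hom
    (fun t ht v w => by
      rw [Finset.mem_singleton] at ht
      exact hη.mem t i ht v w)
  have hsum : ∑ r, d r = ∑ r ∈ Finset.univ \ {i}, d r + d i := by
    rw [← Finset.sum_sdiff (Finset.subset_univ {i}), Finset.sum_singleton]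
  have p1 := hF.pos i
  have hdeg : ∑ r, d r - 2 - ∑ r ∈ Finset.univ \ {i}, d r = d i - 2 := by omega
  have h3 : ∀ a b, (γ (Pi.single a 1) (Pi.single b 1)).IsHomogeneous (d i - 2) := by
    intro a b
    obtain ⟨c, hc⟩ := h1 a b
    rw [hc, ← hdeg]
    exact isHomogeneous_degPart _ _ _
  have happ : ∀ v w, ((C (2⁻¹ : ℂ) : Poly n) • (γ - γ.flip)) v w =
    C (2⁻¹ : ℂ) * (γ v w - γ w v) := fun v w => rfl
  refine ⟨(C (2⁻¹ : ℂ) : Poly n) • (γ - γ.flip), fun v w => ?_, fun a b => ?_, fun hd a b => ?_,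
    fun v w => ?_⟩
  · rw [happ, happ]; ring
  · rw [happ]; exact ((h3 a b).sub (h3 b a)).C_mul _
  · have h0 : ∀ a b, γ (Pi.single a 1) (Pi.single b 1) = 0 := by
      intro a b
      obtain ⟨c, hc⟩ := h1 a b
      rw [hc]
      refine degPart_of_lt ?_ _
      omega
    rw [happ, h0, h0, sub_zero, mul_zero]
  · have hc : C (2⁻¹ : ℂ) * 2 = (1 : Poly n) := by
      rw [← map_ofNat C 2, ← C_mul, inv_mul_cancel₀ two_ne_zero, C_1]
    have k := Ideal.mul_mem_left _ (C (2⁻¹ : ℂ)) (Ideal.sub_mem _ (h2 v w) (h2 w v))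
    rw [hη.swap v w] at k
    convert k using 1
    rw [happ]
    linear_combination - (η v w) * hc

/-- Division gives δ ≡ dF_i ∧ a_i + dF_j ∧ a_j modulo J_ij. Since δ has degree d_i − 2 and dF_i has
coefficients of degree d_i − 1, the first term has no part in that degree; the second dies on fields
killing F_j. -/
theorem IsArrangement.mem_of_kills_single (hF : IsArrangement d F) (hn : 3 < n) {i j : Fin m}
    (hij : i ≠ j) {δ : Bil n} (hs : ∀ v w, δ w v = - δ v w) (hi : 2 ≤ d i)
    (hdeg : ∀ a b, (δ (Pi.single a 1) (Pi.single b 1)).IsHomogeneous (d i - 2))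
    (hδ : ∀ v w, Kills F {i, j} v → Kills F {i, j} w → δ v w ∈ stratum F {i, j})
    {v w : VF n} (hv : along v (F j) = 0) (hw : along w (F j) = 0) : δ v w ∈ stratum F {i, j} := by
  have hcard : ({i, j} : Finset (Fin m)).card ≤ 2 := Finset.card_le_two
  obtain ⟨a, ha⟩ := exists_sum_wedge_along hF.nc le_rfl (hF.hasDepth (by omega)) δ hs hδ
  let a' : VF n →ₗ[Poly n] Poly n := Fintype.linearCombination (Poly n) fun b =>
    degPart (d i - 2) (d j - 1) (a j (Pi.single b 1))
  have ha' (b) : a' (Pi.single b 1) = degPart (d i - 2) (d j - 1) (a j (Pi.single b 1)) := by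
    rw [Fintype.linearCombination_apply_single, one_smul]
  let B : Bil n := δ - ((diff (F j)).smulRight a' - ((diff (F j)).smulRight a').flip)
  have hB (v w : VF n) : B v w = δ v w - (along v (F j) * a' w - along w (F j) * a' v) := by
    simp [B]
  have key := bil_mem (J := stratum F {i, j}) B (fun p q => by
    have h1 (p s) := isHomogeneous_along_single (hF.hom s) p
    have := hF.homogeneousComponent_mem (d i - 2) (ha (Pi.single p 1) (Pi.single q 1))
    rw [Finset.sum_pair hij] at this
    simp only [map_sub, map_add] at this
    simp only [mul_comm (along _ _)] at this
    simp only [homogeneousComponent_mul _ _ (h1 _ _), homogeneousComponent_eq_self (hdeg p q),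
      degPart_of_lt (show d i - 2 < d i - 1 by omega), zero_mul, sub_zero, zero_add] at this
    rw [hB, ha', ha', mul_comm (along _ _), mul_comm (along _ _)]
    exact this) v w
  rwa [hB, hv, hw, zero_mul, zero_mul, sub_zero, sub_zero] at key

/-- δ vanishes on pairs of fields killing F_j and on pairs killing F_k, so it is x dF_j ∧ dF_k
modulo J_ijk. The same argument with t in place of j shows that x vanishes modulo each further F_t,
while its degree is d_i − d_j − d_k; `hpos` covers the case where the truncated degree is zero. -/
theorem IsArrangement.mem_stratum_triple (hF : IsArrangement d F) (hn : 3 < n) {i j k : Fin m}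
    (hij : i ≠ j) (hik : i ≠ k) (hjk : j ≠ k) {δ : Bil n} (hs : ∀ v w, δ w v = - δ v w)
    (hdeg : ∀ a b, (δ (Pi.single a 1) (Pi.single b 1)).IsHomogeneous (d i - 2))
    (hlt : d i < d j + d k + ∑ r ∈ Finset.univ \ {i, j, k}, d r)
    (hpos : 0 < ∑ r ∈ Finset.univ \ {i, j, k}, d r)
    (hδ : ∀ t, i ≠ t → ∀ v w, along v (F t) = 0 → along w (F t) = 0 → δ v w ∈ stratum F {i, t})
    (v w : VF n) : δ v w ∈ stratum F {i, j, k} := by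
  have hcard : ({i, j, k} : Finset (Fin m)).card ≤ 3 := Finset.card_le_three
  have hsub : stratum F {j, k} ≤ stratum F {i, j, k} := stratum_mono (by grind)
  have hj (v w) (hv : along v (F j) = 0) (hw : along w (F j) = 0) : δ v w ∈ stratum F {i, j, k} :=
    stratum_mono (by grind) (hδ j hij v w hv hw)
  have hk (v w) (hv : along v (F k) = 0) (hw : along w (F k) = 0) : δ v w ∈ stratum F {i, j, k} :=
    stratum_mono (by grind) (hδ k hik v w hv hw)
  have hr : ∀ v w, Kills F {j, k} w → δ v w ∈ stratum F {i, j, k} := by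
    intro v w hw
    refine LogForms.mem_of_dualFrame hF.nc {j, k} (hF.hasDepth (by omega))
      (fun t ht => Ideal.mul_mem_right _ _ (hsub (mem_stratum ht))) fun X u hX => ⟨1, ?_⟩
    have hv := hj _ w (hX.kills v j (by simp)) (hw j (by simp))
    rw [Finset.sum_pair hjk] at hv
    simp only [map_sub, map_add, map_smul, LinearMap.sub_apply, LinearMap.add_apply,
      LinearMap.smul_apply, smul_eq_mul] at hv
    have e1 := hk (X j) w (hX.ne (by simp) (by simp) hjk.symm) (hw k (by simp))
    have e2 := hj (X k) w (hX.ne (by simp) (by simp) hjk) (hw j (by simp))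
    rw [pow_one]
    rw [← Ideal.Quotient.eq_zero_iff_mem] at *
    simpa [e1, e2] using hv
  obtain ⟨P, hP⟩ := exists_sum_sum_along hF.nc hsub (hF.hasDepth (by omega)) δ
    (fun v w hv => by rw [hs]; exact Ideal.neg_mem_iff _ |>.mpr (hr w v hv)) hr
  obtain ⟨y, hy⟩ : ∃ y, ∀ v w, δ v w - y * wdg (F j) (F k) v w ∈ stratum F {i, j, k} := by
    refine ⟨C (2⁻¹ : ℂ) * (P j k - P k j), fun v w => ?_⟩
    have hc : C (2⁻¹ : ℂ) * 2 = (1 : Poly n) := by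
      rw [← map_ofNat C 2, ← C_mul, inv_mul_cancel₀ two_ne_zero, C_1]
    have h := Ideal.mul_mem_left _ (C (2⁻¹ : ℂ)) (Ideal.sub_mem _ (hP v w) (hP w v))
    rw [hs v w] at h
    simp only [Finset.sum_pair hjk] at h
    rw [wdg_apply]
    convert h using 1
    linear_combination - (δ v w) * hc
  set x := degPart (d i - 2) (d j - 1 + (d k - 1)) y with hx
  have hxδ : ∀ v w, δ v w - x * wdg (F j) (F k) v w ∈ stratum F {i, j, k} := by
    have := bil_mem (J := stratum F {i, j, k}) (δ - x • wdg (F j) (F k)) fun a b => by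
      have := hF.homogeneousComponent_mem (d i - 2) (hy (Pi.single a 1) (Pi.single b 1))
      rwa [map_sub, homogeneousComponent_mul _ _ (isHomogeneous_wdg (hF.hom j) (hF.hom k) a b),
        homogeneousComponent_eq_self (hdeg a b)] at this
    exact this
  have hxmem : x ∈ stratum F {i, j, k} := by
    refine hF.mem_of_forall_insert (T := Finset.univ \ {i, j, k}) (by omega) (by simp)
      (isHomogeneous_degPart _ _ _) (fun t ht => ?_) ?_
    · have hti : i ≠ t := by grind
      have h4 : (insert t {i, j, k} : Finset (Fin m)).card ≤ 4 :=
        (Finset.card_insert_le _ _).trans (by omega)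
      refine hF.mem_of_dualFrame (by omega) fun X u hX => ⟨2, ?_⟩
      have hjm : j ∈ (insert t {i, j, k} : Finset (Fin m)) := by simp
      have hkm : k ∈ (insert t {i, j, k} : Finset (Fin m)) := by simp
      have htm : t ∈ (insert t {i, j, k} : Finset (Fin m)) := by simp
      have e1 := stratum_mono (F := F) (B := insert t {i, j, k}) (by grind)
        (hδ t hti (X j) (X k) (hX.ne htm hjm (by grind)) (hX.ne htm hkm (by grind)))
      have e2 := stratum_mono (F := F) (B := insert t {i, j, k}) (by grind) (hxδ (X j) (X k))
      rw [wdg_apply, hX.self hjm, hX.self hkm, hX.ne hjm hkm hjk, hX.ne hkm hjm hjk.symm] at e2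
      convert Ideal.sub_mem _ e1 e2 using 1
      ring
    · have := hF.pos j
      have := hF.pos k
      omega
  have := Ideal.add_mem _ (hxδ v w) (Ideal.mul_mem_right (wdg (F j) (F k) v w) _ hxmem)
  rwa [sub_add_cancel] at this

theorem sum_sdiff_single (i : Fin m) : ∑ r ∈ Finset.univ \ {i}, d r + d i = ∑ r, d r := by
  rw [← Finset.sum_sdiff (Finset.subset_univ {i}), Finset.sum_singleton]

/-- From all J_ijk to J_ij and then to (F_i): the degree d_i − 2 of δ is by balance smaller than the
sum of the degrees outside {i, j}, and outside {i}. -/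
theorem IsResidual.mem_single (hF : IsArrangement d F) (hn : 3 < n) (hm : 3 < m)
    (hbal : ∀ i j, i ≠ j → d i + d j < ∑ r ∈ Finset.univ \ {i, j}, d r)
    (hl : IsGenericResidue l) (hη : IsResidual d l c F η) (i : Fin m) (v w : VF n) :
    η v w ∈ stratum F {i} := by
  have hne : Nontrivial (Fin m) := Fin.nontrivial_iff_two_le.mpr (by omega)
  have hpos : d i < ∑ r ∈ Finset.univ \ {i}, d r := by
    obtain ⟨j, hj⟩ := exists_ne i
    have h1 := hbal i j hj.symm
    have h2 := sum_sdiff_pair hj.symm d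
    have h3 := sum_sdiff_single (d := d) i
    omega
  obtain ⟨δ, hs, hdeg, h0, hδ⟩ := hη.exists_quotient hF hn (i := i) (by omega)
  suffices h : δ v w ∈ stratum F {i} by
    have := Ideal.add_mem _ (hδ v w) (Ideal.mul_mem_left _ (hat F {i}) h)
    rwa [sub_add_cancel] at this
  refine bil_mem δ (fun a b => ?_) v w
  by_cases hi : d i < 2
  · rw [h0 hi]; exact Ideal.zero_mem _
  rw [not_lt] at hi
  refine hF.mem_of_forall_insert (T := Finset.univ \ {i}) (by simp; omega) (by simp) (hdeg a b)
    (fun j hj => ?_) (by omega)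
  have hij : i ≠ j := by grind
  rw [Finset.pair_comm]
  have h2 := hbal i j hij
  refine hF.mem_of_forall_insert (T := Finset.univ \ {i, j})
    (by rw [Finset.card_pair hij]; omega) (by simp) (hdeg a b)
    (fun k hk => ?_) (by omega)
  have hik : i ≠ k := by grind
  have hjk : j ≠ k := by grind
  have h4 := hbal i k hik
  have h5 := hbal j k hjk
  have h6 := sum_sdiff_pair hij d
  have h7 := sum_sdiff_pair hik d
  have h8 := sum_sdiff_pair hjk d
  have h9 := sum_sdiff_triple hij hik hjk d
  have h10 := hF.pos k
  rw [show (insert k {i, j} : Finset (Fin m)) = {i, j, k} by grind]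
  refine hF.mem_stratum_triple hn hij hik hjk hs hdeg (by omega) ?_ (fun t ht v w hv hw => ?_) _ _
  · have := hF.pos i
    have := hF.pos j
    omega
  · exact hF.mem_of_kills_single hn ht hs hi hdeg
      (fun v w hv hw => hη.mem_of_kills hF hn hl ht hδ hv hw) hv hw

/-- The same degree argument on the empty stratum: degree Σ d − 2 against the product of all F_i. -/
theorem IsResidual.eq_zero (hF : IsArrangement d F) (hn : 3 < n) (hm : 3 < m)
    (hbal : ∀ i j, i ≠ j → d i + d j < ∑ r ∈ Finset.univ \ {i, j}, d r)
    (hl : IsGenericResidue l) (hη : IsResidual d l c F η) (v w : VF n) : η v w = 0 := by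
  have h0 : stratum F (∅ : Finset (Fin m)) = ⊥ := by simp [stratum]
  rw [← Ideal.mem_bot, ← h0]
  refine bil_mem η (fun a b => ?_) v w
  refine hF.mem_of_forall_insert (T := Finset.univ) (by simp; omega) (by simp) (hη.hom a b)
    (fun i _ => hη.mem_single hF hn hm hbal hl i _ _) ?_
  have h1 := sum_sdiff_single (d := d) (⟨0, by omega⟩ : Fin m)
  have h2 := hF.pos ⟨0, by omega⟩
  omega

end residual
end LogForms

end

/-! ### Conditions on the constant residues -/

noncomputable section
namespace LogForms
open MvPolynomial

section residues
variable {n m : ℕ} {d : Fin m → ℕ} {F : Fin m → Poly n} {l c : Fin m → Fin m → ℂ}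

theorem DualFrame.exists_logBil_eq {A : Finset (Fin m)} {X : Fin m → VF n} {u : Poly n}
    (hX : DualFrame F A X u) (hl : ∀ s t, l t s = - l s t) {i j k r : Fin m}
    (hA : {i, j, k, r} = A) (hij : i ≠ j) (hik : i ≠ k) (hir : i ≠ r) (hjk : j ≠ k) (hjr : j ≠ r)
    (hkr : k ≠ r) :
    ∃ G, logBil l F Finset.univ (X i) (X j) = F k * F r * G ∧
      G - C (l i j) * hat F A * u ^ 2 ∈ stratum F A := by
  subst hA
  have hi : i ∈ ({i, j, k, r} : Finset (Fin m)) := by simp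
  have hj : j ∈ ({i, j, k, r} : Finset (Fin m)) := by simp
  have hk : k ∈ ({i, j, k, r} : Finset (Fin m)) := by simp
  have hr : r ∈ ({i, j, k, r} : Finset (Fin m)) := by simp
  refine ⟨_, logBil_erase_erase hkr (hX.ne hk hi hik.symm) (hX.ne hk hj hjk.symm)
    (hX.ne hr hi hir.symm) (hX.ne hr hj hjr.symm), ?_⟩
  have := stratum_mono (F := F) (B := {i, j, k, r}) (by grind)
    (logBil_erase_erase_sub_mem (F := F) hl hij hik hir hjk hjr (X i) (X j))
  rw [wdg_apply, hX.self hi, hX.self hj, hX.ne hi hj hij, hX.ne hj hi hij.symm] at this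
  convert this using 2
  ring

/-- On a frame of four fields, ω(X_s, X_t) is exactly F_p F_q times a factor congruent to λ_st
F̂_stpq u². So the first equation, divided by F_s F_t F_p F_q, exhibits the Plücker expression times
nonzerodivisors. -/
theorem IsArrangement.wedgeCoord_eq_zero_of_ne (hF : IsArrangement d F) (hn : 3 < n)
    (h0 : ∀ i, F i ≠ 0) (hl : ∀ s t, l t s = - l s t) (hc : ∀ s t, c t s = - c s t)
    (h : IsTangent (logBil l F Finset.univ) (logBil c F Finset.univ)) {s t p q : Fin m}
    (hst : s ≠ t) (hsp : s ≠ p) (hsq : s ≠ q) (htp : t ≠ p) (htq : t ≠ q) (hpq : p ≠ q) :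
    wedgeCoord l c s t p q = 0 := by
  have hcard : ({s, t, p, q} : Finset (Fin m)).card ≤ n := Finset.card_le_four.trans (by omega)
  refine hF.eq_zero_of_C_mem (A := {s, t, p, q}) (hF.mem_of_dualFrame hcard fun X u hX => ⟨4, ?_⟩)
  refine hF.nzdMod_hat hcard (Finset.Subset.refl _) _ (hF.nzdMod_hat hcard
    (Finset.Subset.refl _) _ ?_)
  have key := h.wedge_eq (X s) (X t) (X p) (X q)
  have a1 : ({s, p, t, q} : Finset (Fin m)) = {s, t, p, q} := by grind
  have a2 : ({s, q, t, p} : Finset (Fin m)) = {s, t, p, q} := by grind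
  have a3 : ({t, p, s, q} : Finset (Fin m)) = {s, t, p, q} := by grind
  have a4 : ({t, q, s, p} : Finset (Fin m)) = {s, t, p, q} := by grind
  have a5 : ({p, q, s, t} : Finset (Fin m)) = {s, t, p, q} := by grind
  have f (l : Fin m → Fin m → ℂ) (hl : ∀ s t, l t s = - l s t) {i j k r : Fin m} :=
    hX.exists_logBil_eq hl (i := i) (j := j) (k := k) (r := r)
  obtain ⟨x1, e1, m1⟩ := f l hl rfl hst hsp hsq htp htq hpq
  obtain ⟨x2, e2, m2⟩ := f l hl a1 hsp hst hsq htp.symm hpq htq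
  obtain ⟨x3, e3, m3⟩ := f l hl a2 hsq hst hsp htq.symm hpq.symm htp
  obtain ⟨x4, e4, m4⟩ := f l hl a3 htp hst.symm htq hsp.symm hpq hsq
  obtain ⟨x5, e5, m5⟩ := f l hl a4 htq hst.symm htp hsq.symm hpq.symm hsp
  obtain ⟨x6, e6, m6⟩ := f l hl a5 hpq hsp.symm htp.symm hsq.symm htq.symm hst
  obtain ⟨y1, e1', m1'⟩ := f c hc rfl hst hsp hsq htp htq hpq
  obtain ⟨y2, e2', m2'⟩ := f c hc a1 hsp hst hsq htp.symm hpq htq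
  obtain ⟨y3, e3', m3'⟩ := f c hc a2 hsq hst hsp htq.symm hpq.symm htp
  obtain ⟨y4, e4', m4'⟩ := f c hc a3 htp hst.symm htq hsp.symm hpq hsq
  obtain ⟨y5, e5', m5'⟩ := f c hc a4 htq hst.symm htp hsq.symm hpq.symm hsp
  obtain ⟨y6, e6', m6'⟩ := f c hc a5 hpq hsp.symm htp.symm hsq.symm htq.symm hst
  rw [wedgeB, e1, e2, e3, e4, e5, e6, e1', e2', e3', e4', e5', e6'] at key
  -- The cancellation is made in the polynomial ring, before reduction, since the F's are zero
  -- modulo the stratum.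
  have key : x1 * y6 - x2 * y5 + x3 * y4 + x4 * y3 - x5 * y2 + x6 * y1 = 0 := by
    refine mul_left_cancel₀ (mul_ne_zero (mul_ne_zero (h0 s) (h0 t))
      (mul_ne_zero (h0 p) (h0 q))) ?_
    linear_combination key
  clear e1 e2 e3 e4 e5 e6 e1' e2' e3' e4' e5' e6' f a1 a2 a3 a4 a5
  have key := congrArg (Ideal.Quotient.mk (stratum F {s, t, p, q})) key
  rw [← Ideal.Quotient.eq_zero_iff_mem] at m1 m2 m3 m4 m5 m6 m1' m2' m3' m4' m5' m6' ⊢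
  simp only [wedgeCoord, map_sub, map_add, map_mul, map_pow, map_zero]
    at key m1 m2 m3 m4 m5 m6 m1' m2' m3' m4' m5' m6' ⊢
  generalize Ideal.Quotient.mk (stratum F {s, t, p, q}) = π at *
  rw [sub_eq_zero] at m1 m2 m3 m4 m5 m6 m1' m2' m3' m4' m5' m6'
  rw [m1, m2, m3, m4, m5, m6, m1', m2', m3', m4', m5', m6'] at key
  linear_combination key

theorem IsArrangement.wedgeCoord_eq_zero (hF : IsArrangement d F) (hn : 3 < n)
    (h0 : ∀ i, F i ≠ 0) (hl : ∀ s t, l t s = - l s t) (hc : ∀ s t, c t s = - c s t)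
    (h : IsTangent (logBil l F Finset.univ) (logBil c F Finset.univ)) (s t p q : Fin m) :
    wedgeCoord l c s t p q = 0 := by
  by_cases hne : s ≠ t ∧ s ≠ p ∧ s ≠ q ∧ t ≠ p ∧ t ≠ q ∧ p ≠ q
  · obtain ⟨h1, h2, h3, h4, h5, h6⟩ := hne
    exact hF.wedgeCoord_eq_zero_of_ne hn h0 hl hc h h1 h2 h3 h4 h5 h6
  have hl0 (s) : l s s = 0 := self_eq_neg.mp (hl s s)
  have hc0 (s) : c s s = 0 := self_eq_neg.mp (hc s s)
  rw [wedgeCoord]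
  have : s = t ∨ s = p ∨ s = q ∨ t = p ∨ t = q ∨ p = q := by tauto
  rcases this with rfl | rfl | rfl | rfl | rfl | rfl
  · rw [hl0, hc0]; ring
  · rw [hl0, hc0, hl s t, hc s t]; ring
  · rw [hl0, hc0, hl s t, hc s t, hl s p, hc s p]; ring
  · rw [hl0, hc0]; ring
  · rw [hl0, hc0, hl t p, hc t p]; ring
  · rw [hl0, hc0]; ring

/-- By Euler the contraction is Σ_t (Σ_s d_s c_st) F̂_t dF_t. On X_t and modulo F_t only the t-th
term survives. -/
theorem IsArrangement.sum_mul_eq_zero (hF : IsArrangement d F) (hn : 3 < n)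
    (hc : ∀ s t, c t s = - c s t)
    (h : ∀ v, logBil c F Finset.univ (radialField n) v = 0) (t : Fin m) :
    ∑ s, d s * c s t = 0 := by
  refine hF.eq_zero_of_C_mem (A := {t}) (hF.mem_of_dualFrame (by simp; omega) fun X u hX =>
    ⟨1, ?_⟩)
  refine hF.nzdMod_hat (by simp; omega) (Finset.Subset.refl _) _ ?_
  have key := h (X t)
  rw [logBil_radialField hc fun i => ⟨F i, hF.hom i⟩, ← Finset.add_sum_erase _ _ (Finset.mem_univ t),
    logDer, hX.self (Finset.mem_singleton_self t), Finset.erase_eq] at key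
  have h2 : ∑ x ∈ Finset.univ \ {t}, C (∑ s, (d s : ℂ) * c s x) * logDer F (X t) x
      ∈ stratum F {t} := by
    refine Ideal.sum_mem _ fun x hx => Ideal.mul_mem_left _ _ (Ideal.mul_mem_left _ _ ?_)
    refine Ideal.mem_of_dvd _ (Finset.dvd_prod_of_mem F (a := t) ?_)
      (mem_stratum (Finset.mem_singleton_self t))
    grind
  have := Ideal.neg_mem_iff _ |>.mpr h2
  convert this using 1
  rw [hat]
  linear_combination key

end residues
end LogForms

end

/-! ### From bilinear forms back to the parametrization -/

noncomputable section
namespace LogForms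
open MvPolynomial

section parametrization
variable {n m : ℕ} {d : Fin m → ℕ} {lam : Alt (Fin m) ℂ 2} {F : ∀ i, HomPoly n (d i)}

theorem wedgeCoord_comm {R : Type} [CommRing R] (l l' : Fin m → Fin m → R) (s t p q : Fin m) :
    wedgeCoord l l' s t p q = wedgeCoord l' l s t p q := by
  rw [wedgeCoord, wedgeCoord]; ring

theorem exists_coord_eq {c : Fin m → Fin m → ℂ} (hc : ∀ s t, c t s = - c s t) :
    ∃ a : Alt (Fin m) ℂ 2, coord a = c := by
  refine ⟨∑ i, ∑ j, (c i j / 2) • wedge (oneForm (Pi.single i 1)) (oneForm (Pi.single j 1)), ?_⟩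
  ext s t
  rw [coord, sum_apply_vec]
  simp only [sum_apply_vec, AlternatingMap.smul_apply]
  change ∑ i, ∑ j, (c i j / 2) •
    coord (wedge (oneForm (Pi.single i 1)) (oneForm (Pi.single j 1))) s t = c s t
  simp only [coord_wedge, Pi.single_apply, smul_eq_mul, mul_sub, Finset.sum_sub_distrib, mul_ite,
    mul_one, mul_zero, Finset.sum_ite_eq, Finset.mem_univ, if_true]
  rw [hc s t]
  ring

theorem IsGeneric.isGenericResidue (h : IsGeneric d lam F) : IsGenericResidue (coord lam) :=
  ⟨coord_swap lam, h.ne_zero, h.sum_ne_zero⟩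

theorem IsGeneric.isArrangement (h : IsGeneric d lam F) :
    IsArrangement d fun i => (F i : Poly n) where
  nc := h.normalCrossings
  hom i := (F i).2
  pos i := by
    rw [Nat.pos_iff_ne_zero]
    intro h0
    have hF : (F i : Poly n).IsHomogeneous 0 := h0 ▸ (F i).2
    rw [← totalDegree_zero_iff_isHomogeneous, totalDegree_eq_zero_iff_eq_C] at hF
    have h1 := (h.irreducible i).ne_zero
    refine (h.irreducible i).not_isUnit ?_
    rw [hF] at h1 ⊢
    exact (isUnit_iff_ne_zero.mpr fun h2 => h1 (by rw [h2, C_0])).map C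

theorem IsBalanced.add_lt (h : IsBalanced 2 d) {i j : Fin m} (hij : i ≠ j) :
    d i + d j < ∑ r ∈ Finset.univ \ {i, j}, d r := by
  have := h {i, j} (Finset.card_pair hij)
  rwa [Finset.sum_pair hij, Finset.compl_eq_univ_sdiff] at this

theorem add_mem_tangentForms {e : ℕ} {ω α β : Form n 2} (hα : α ∈ tangentForms n e ω)
    (hβ : β ∈ tangentForms n e ω) : α + β ∈ tangentForms n e ω := by
  rw [mem_tangentForms_iff] at *
  obtain ⟨⟨h1, h2⟩, h3, h4⟩ := hα
  obtain ⟨⟨h5, h6⟩, -, h7⟩ := hβ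
  refine ⟨⟨fun v => (h1 v).add (h5 v), ?_⟩, h3, by rw [map_add]; exact h4.add h7⟩
  rw [radial_eq_zero_iff] at *
  intro v
  rw [map_add, LinearMap.add_apply, LinearMap.add_apply, h2, h6, add_zero]

theorem add_sum_mem_tangentForms {e : ℕ} {ω α : Form n 2} (hα : α ∈ tangentForms n e ω)
    {ι : Type} (T : Finset ι) {f : ι → Form n 2} (hf : ∀ i, f i ∈ tangentForms n e ω) :
    α + ∑ i ∈ T, f i ∈ tangentForms n e ω := by
  classical
  induction T using Finset.induction_on with
  | empty => simpa using hα
  | insert a s ha ih =>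
    rw [Finset.sum_insert ha, add_left_comm]
    exact add_mem_tangentForms (hf a) ih

theorem dRho_mk (lam' : grTangentRep d lam) (g : ∀ i, HomPoly n (d i)) :
    dRho d lam F (Submodule.Quotient.mk lam', fun i => Submodule.Quotient.mk (g i)) =
      (Submodule.span ℂ {phi d lam F}).mkQ
        (phi d lam' F + ∑ i, phi d lam (Function.update F i (g i))) := by
  rw [dRho, LinearMap.coprod_apply, map_add, map_sum, LinearMap.sum_apply]
  rfl

theorem IsGeneric.phi_mem_tangentForms (h : IsGeneric d lam F) {lam' : Alt (Fin m) ℂ 2}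
    (hlam' : lam' ∈ grTangentRep d lam) :
    phi d lam' F ∈ tangentForms n (∑ i, d i) (phi d lam F) := by
  have h2 : wedge lam' lam = 0 := hlam'.2
  rw [wedge_eq_zero_iff] at h2
  exact mem_tangentForms_iff.mpr ⟨phi_mem_projTwoForms h.isArrangement.pos
    (sum_mul_coord_of_mem hlam'.1) F, isTangent_phi d h.gr.wedgeCoord_self F,
    isTangent_phi d (fun s t p q => by rw [wedgeCoord_comm]; exact h2 s t p q) F⟩

theorem IsGeneric.phi_update_mem_tangentForms (h : IsGeneric d lam F) (i : Fin m)
    (x : HomPoly n (d i)) :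
    phi d lam (Function.update F i x) ∈ tangentForms n (∑ i, d i) (phi d lam F) :=
  mem_tangentForms_iff.mpr ⟨phi_mem_projTwoForms h.isArrangement.pos
    (sum_mul_coord_of_mem h.gr.mem_wedgeSqPerp) _, isTangent_phi d h.gr.wedgeCoord_self F,
    isTangent_phi_update d h.gr.wedgeCoord_self F i x⟩

/-- The surjectivity: the glued variations g give the directions F_i', and the constant residues of
what remains give λ'. -/
theorem IsGeneric.exists_eq (h : IsGeneric d lam F) (hn : 3 < n) (hm : 3 < m)
    (hd : IsBalanced 2 d) {α : Form n 2} (hα : α ∈ tangentForms n (∑ i, d i) (phi d lam F)) :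
    ∃ lam' ∈ grTangentRep d lam, ∃ g : ∀ i, HomPoly n (d i),
      α = phi d lam' F + ∑ i, phi d lam (Function.update F i (g i)) := by
  have hF := h.isArrangement
  have hl := h.isGenericResidue
  obtain ⟨hproj, -, hα⟩ := mem_tangentForms_iff.mp hα
  rw [bil_phi] at hα
  obtain ⟨g, hg, hgα⟩ := hα.exists_tripleForm_homogeneous hF hn hl (bil_swap α)
    (fun a b => by rw [bil_single]; exact hproj.1 _)
  let G : ∀ i, HomPoly n (d i) := fun i => ⟨g i, hg i⟩
  have hG : bil (∑ r, phi d lam (Function.update F r (G r))) =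
      ∑ r, logBil (coord lam) (Function.update (fun i => (F i : Poly n)) r (g r)) Finset.univ := by
    rw [map_sum]
    refine Finset.sum_congr rfl fun r _ => ?_
    rw [bil_phi, coe_update]
  -- Each subtracted term is itself tangent and killed by the radial field, so β keeps both
  -- properties of α and now vanishes in codimension three.
  set β := α - ∑ r, phi d lam (Function.update F r (G r)) with hβ
  have hbβ : IsReduced d (coord lam) (fun i => (F i : Poly n)) (bil β) := by
    refine ⟨?_, bil_swap β, fun a b => ?_, fun i j k hij hik hjk v w => ?_⟩
    · rw [hβ, map_sub, map_sum]
      refine hα.sub (IsTangent.sum _ fun r _ => ?_)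
      rw [← bil_phi]
      exact isTangent_phi_update d h.gr.wedgeCoord_self F r (G r)
    · rw [bil_single, hβ, AlternatingMap.sub_apply, sum_apply_vec]
      exact (hproj.1 _).sub (IsHomogeneous.sum _ _ _ fun r _ =>
        (phi_mem_projTwoForms hF.pos (sum_mul_coord_of_mem h.gr.mem_wedgeSqPerp) _).1 _)
    · rw [hβ, map_sub, hG]
      exact sub_sum_logBil_update_mem hl.swap hij hik hjk (hgα i j k hij hik hjk v w)
  have hbal := fun i j => hd.add_lt (i := i) (j := j)
  obtain ⟨c, hc, hcβ⟩ := hbβ.exists_residues hF hn hbal hl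
  have hη : IsResidual d (coord lam) c (fun i => (F i : Poly n))
      (bil β - logBil c (fun i => (F i : Poly n)) Finset.univ) := by
    refine ⟨?_, hc, fun v w => ?_, fun a b => ?_, hcβ⟩
    · convert hbβ.tangent
      exact LinearMap.ext fun v => LinearMap.ext fun w => sub_add_cancel _ _
    · rw [LinearMap.sub_apply, LinearMap.sub_apply, LinearMap.sub_apply, LinearMap.sub_apply,
        bil_swap β v w, logBil_swap hc _ v w]
      ring
    · exact (hbβ.hom a b).sub (hF.isHomogeneous_logBil hc a b)
  have hβc : bil β = logBil c (fun i => (F i : Poly n)) Finset.univ :=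
    LinearMap.ext fun v => LinearMap.ext fun w => sub_eq_zero.mp (hη.eq_zero hF hn hm hbal hl v w)
  obtain ⟨lam', rfl⟩ := exists_coord_eq hc
  refine ⟨lam', ⟨mem_wedgeSqPerp ⟨⟨0, by omega⟩, (hF.pos _).ne'⟩
    (hF.sum_mul_eq_zero hn hc fun v => ?_), ?_⟩, G, ?_⟩
  · rw [← hβc, hβ, map_sub, map_sum, LinearMap.sub_apply, LinearMap.sub_apply,
      radial_eq_zero_iff.mp hproj.2, LinearMap.sum_apply, LinearMap.sum_apply, zero_sub,
      neg_eq_zero]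
    exact Finset.sum_eq_zero fun r _ => radial_eq_zero_iff.mp (phi_mem_projTwoForms hF.pos
      (sum_mul_coord_of_mem h.gr.mem_wedgeSqPerp) _).2 v
  · change wedge lam' lam = 0
    refine wedge_eq_zero_iff.mpr fun s t p q => ?_
    rw [wedgeCoord_comm]
    refine hF.wedgeCoord_eq_zero hn (fun i => (h.irreducible i).ne_zero) hl.swap hc ?_ s t p q
    rw [← hβc]
    exact hbβ.tangent
  · rw [← bil_phi] at hβc
    rw [← bil_injective hβc, hβ, sub_add_cancel]

end parametrization
end LogForms

end

/-! ### The theorem -/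

open LogForms

theorem proposition3p2 (n m : ℕ) (hn : 3 < n) (hm : 3 < m) (d : Fin m → ℕ)
    (hd : IsBalanced 2 d) (lam : Alt (Fin m) ℂ 2) (F : ∀ i, HomPoly n (d i))
    (hU : IsGeneric d lam F) :
    Set.range (dRho d lam F) = zariskiTangent n (∑ i, d i) (phi d lam F) := by
  ext x
  constructor
  · rintro ⟨⟨a, b⟩, rfl⟩
    obtain ⟨lam', rfl⟩ := Submodule.Quotient.mk_surjective _ a
    choose g hg using fun i => Submodule.Quotient.mk_surjective _ (b i)
    obtain rfl : (fun i => Submodule.Quotient.mk (g i)) = b := funext hg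
    rw [dRho_mk]
    exact ⟨_, add_sum_mem_tangentForms (hU.phi_mem_tangentForms lam'.2) _
      fun i => hU.phi_update_mem_tangentForms i (g i), rfl⟩
  · rintro ⟨α, hα, rfl⟩
    obtain ⟨lam', hlam', g, rfl⟩ := hU.exists_eq hn hm hd hα
    exact ⟨_, dRho_mk ⟨lam', hlam'⟩ g⟩
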